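/- Let $k$ be an algebraically closed field of characteristic $0$, $G$ a finite group and $\mathcal C$ a braided $G$-crossed fusion category over $k$: a fusion category with a (not necessarily faithful) grading $\mathcal C=\bigoplus_{g\in G}\mathcal C_g$, a $k$-linear action of $G$ by tensor autoequivalences $X\mapsto g(X)$ with $g(\mathcal C_h)\subseteq\mathcal C_{ghg^{-1}}$ and structure isomorphisms $(\mu_g)_{X,Y}\colon g(X)\otimes g(Y)\to g(X\otimes Y)$ and $(\gamma_{g,h})_X\colon g(h(X))\to (gh)(X)$, and natural isomorphisms $c_{X,Y}\colon X\otimes Y\to g(Y)\otimes X$ for $X\in\mathcal C_g$, $Y\in\mathcal C$, compatible with the action and satisfying the two hexagon axioms. Let $\mathcal C^{G}$ be the equivariantization: its objects are pairs $(X,v)$ with isomorphisms $v_g\colon g(X)\to X$ such that $v_{gh}\circ(\gamma_{g,h})_X=v_g\circ g(v_h)$. It is braided by $X\otimes Y=\bigoplus_g X_g\otimes Y\to\bigoplus_g g(Y)\otimes X_g\to\bigoplus_g Y\otimes X_g=Y\otimes X$, where $X_g$ is the component of $X$ in $\mathcal C_g$, the first map is $\bigoplus_g c_{X_g,Y}$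 and the second is $\bigoplus_g v_g^Y\otimes \mathrm{id}$. For a braided category $\mathcal B$ let $\mathcal B^{\mathrm{rev}}$ be the same monoidal category with the inverse braiding $c_{Y,X}^{-1}$. Let $\mathcal C^{\mathrm{rev}}$ be the following braided $G$-crossed fusion category. As a $k$-linear category with $G$-action it is $\mathcal C$, with tensor product $X\otimes^{\mathrm{rev}}Y=X\otimes g^{-1}(Y)$ for $X\in\mathcal C_g$ (extended additively in $X$), with grading $(\mathcal C^{\mathrm{rev}})_g=\mathcal C_{g^{-1}}$, and with crossed braiding $c^{\mathrm{rev}}_{X,Y}=c^{-1}_{g^{-1}(Y),\,g^{-1}h^{-1}g(X)}$ for $X\in\mathcal C_g$, $Y\in\mathcal C_h$ (where $\gamma$ is used to identify its source and target with $X\otimes^{\mathrm{rev}}Y$ and $g^{-1}(Y)\otimes^{\mathrm{rev}}X$). For a braided category $\mathcal B$ containing $\mathrm{Rep}(G)$, with regular algebra $A=\mathrm{Fun}(G)$, let $\mathcal B_G$ be the de-equivariantization: the category of $A$-modules in $\mathcal B$ with tensor product $\otimes_A$, with $g(M)$ the object $M$ on which $A$ acts through right translation of functions by $g$, with $M$ of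 degree $g$ if the two $A$-actions on $M$ obtained from $M\otimes A\to A\otimes M\to M$ by means of the braiding and of the inverse braiding differ by right translation by $g$, i.e. $a_M\circ c_{M,A}=a_M\circ c_{A,M}^{-1}\circ(\mathrm{id}_M\otimes t_g)$ with $c$ the braiding of $\mathcal B$, $a_M$ the action and $t_g(\delta_y)=\delta_{yg}$ right translation of delta functions, and with crossed braiding $M\otimes_A N\to g(N)\otimes_A M$ induced by the braiding of $\mathcal B$. Here $\mathcal B=(\mathcal C^G)^{\mathrm{rev}}$, with $A=\bigoplus_{x\in G}\mathbf 1$ on which $G$ acts by left translations. Then: (a) $\mathcal C^{\mathrm{rev}}$ is indeed a braided $G$-crossed fusion category, and the identity functor $(X,v)\mapsto (X,v)$ is an equivalence of $k$-linear braided monoidal categories $$(\mathcal C^{\mathrm{rev}})^G\;\cong\;(\mathcal C^G)^{\mathrm{rev}}$$ when it is equipped with the tensor structure $$X\otimes^{\mathrm{rev}}Y=\bigoplus_{g\in G}X_g\otimes g^{-1}(Y)\xrightarrow{\ \bigoplus_g \mathrm{id}\otimes v^Y_{g^{-1}}\ }\bigoplus_{g\in G}X_g\otimes Y=X\otimes Y.$$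 (b) $((\mathcal C^G)^{\mathrm{rev}})_G$ is a braided $G$-crossed fusion category, and there is a braided $G$-crossed equivalence $$\mathcal C^{\mathrm{rev}}\;\cong\;((\mathcal C^G)^{\mathrm{rev}})_G,$$ that is, a $k$-linear tensor equivalence $F$ that respects the gradings, with isomorphisms of tensor functors $\eta_g\colon F\circ g\to g\circ F$ that are compatible with the isomorphisms $\gamma_{g,h}$ and such that $F(c_{X,Y})$ corresponds to $(\eta_g^{-1}\otimes\mathrm{id})\circ c_{F(X),F(Y)}$ under the tensor structure of $F$, for $X$ of degree $g$. -/

import Mathlib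

open CategoryTheory CategoryTheory.Limits CategoryTheory.MonoidalCategory

set_option linter.unusedSectionVars false

namespace GCrossed

/-- A `k`-linear monoidal category is a fusion category over `k`: it is abelian, its tensor
product is bilinear, it is rigid, its unit object is simple, its morphism spaces are
finite dimensional, every object is a finite direct sum of simple objects, and there are only
finitely many simple objects up to isomorphism. -/
structure IsFusion (k : Type*) [Field k] (D : Type*) [Category D] [P : Preadditive D] [Linear k D]
    [MonoidalCategory D] : Prop where
  abelian : ∃ a : Abelian D, a.toPreadditive = P
  tensor_additive : MonoidalPreadditive D
  tensor_linear : MonoidalLinear k D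
  rigid : Nonempty (RigidCategory D)
  simple_unit : Simple (𝟙_ D)
  finite_hom : ∀ X Y : D, FiniteDimensional k (X ⟶ Y)
  semisimple : ∀ X : D, ∃ (n : ℕ) (S : Fin n → D) (b : Bicone S),
    (∀ i, Simple (S i)) ∧ Nonempty b.IsBilimit ∧ Nonempty (X ≅ b.pt)
  finite_simples : ∃ (n : ℕ) (S : Fin n → D), ∀ X : D, Simple X → ∃ i, Nonempty (X ≅ S i)

/-- The structure maps of a braided `G`-crossed category (no axioms yet). -/
class CrossedData (G : Type*) [Group G] (C : Type*) [Category C] [MonoidalCategory C] where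
  /-- the functor `X ↦ g(X)` -/
  act : G → C ⥤ C
  /-- `μ_g(X,Y) : g(X) ⊗ g(Y) ⟶ g(X ⊗ Y)` -/
  μ (g : G) (X Y : C) : (act g).obj X ⊗ (act g).obj Y ⟶ (act g).obj (X ⊗ Y)
  /-- the unit constraint of the tensor functor `g` -/
  ε (g : G) : 𝟙_ C ⟶ (act g).obj (𝟙_ C)
  /-- `γ_{g,h}(X) : g(h(X)) ⟶ (gh)(X)`; products in `G` are given with a
  proof of equality, which avoids transports -/
  γ {g h l : G} (e : g * h = l) (X : C) : (act g).obj ((act h).obj X) ⟶ (act l).obj X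
  /-- the identification of `X` with `1(X)` -/
  ι {u : G} (e : u = 1) (X : C) : X ⟶ (act u).obj X
  /-- `deg g X`: the object `X` belongs to the component `C_g` -/
  deg : G → ObjectProperty C
  /-- the crossed braiding `X ⊗ Y ⟶ g(Y) ⊗ X` for `X` in `C_g` -/
  cb {g : G} {X : C} (hX : deg g X) (Y : C) : X ⊗ Y ⟶ (act g).obj Y ⊗ X

open CrossedData

/-- The action axioms: each `g` is an additive tensor autoequivalence with tensor structure `μ`,
`ε`, and `g ↦ g(-)` is a monoidal functor from `G` to the category of tensor autoequivalences of
`C`, with structure isomorphisms `γ` and `ι`. -/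
class IsAction (G : Type*) [Group G] (C : Type*) [Category C] [Preadditive C] [MonoidalCategory C]
    [CrossedData G C] : Prop where
  act_additive : ∀ g : G, (act g : C ⥤ C).Additive
  act_equivalence : ∀ g : G, (act g : C ⥤ C).IsEquivalence
  μ_iso : ∀ (g : G) (X Y : C), IsIso (μ g X Y)
  ε_iso : ∀ g : G, IsIso (ε g : 𝟙_ C ⟶ _)
  γ_iso : ∀ {g h l : G} (e : g * h = l) (X : C), IsIso (γ e X)
  ι_iso : ∀ {u : G} (e : u = 1) (X : C), IsIso (ι e X)
  μ_natural : ∀ (g : G) {X X' Y Y' : C} (f : X ⟶ X') (f' : Y ⟶ Y'),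
    ((act g).map f ⊗ₘ (act g).map f') ≫ μ g X' Y' = μ g X Y ≫ (act g).map (f ⊗ₘ f')
  μ_associativity : ∀ (g : G) (X Y Z : C),
    μ g X Y ▷ (act g).obj Z ≫ μ g (X ⊗ Y) Z ≫ (act g).map (α_ X Y Z).hom =
      (α_ _ _ _).hom ≫ (act g).obj X ◁ μ g Y Z ≫ μ g X (Y ⊗ Z)
  μ_left_unitality : ∀ (g : G) (X : C),
    ε g ▷ (act g).obj X ≫ μ g (𝟙_ C) X ≫ (act g).map (λ_ X).hom = (λ_ _).hom
  μ_right_unitality : ∀ (g : G) (X : C),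
    (act g).obj X ◁ ε g ≫ μ g X (𝟙_ C) ≫ (act g).map (ρ_ X).hom = (ρ_ _).hom
  γ_natural : ∀ {g h l : G} (e : g * h = l) {X Y : C} (f : X ⟶ Y),
    (act g).map ((act h).map f) ≫ γ e Y = γ e X ≫ (act l).map f
  ι_natural : ∀ {u : G} (e : u = 1) {X Y : C} (f : X ⟶ Y), f ≫ ι e Y = ι e X ≫ (act u).map f
  γ_μ : ∀ {g h l : G} (e : g * h = l) (X Y : C),
    (γ e X ⊗ₘ γ e Y) ≫ μ l X Y =
      μ g ((act h).obj X) ((act h).obj Y) ≫ (act g).map (μ h X Y) ≫ γ e (X ⊗ Y)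
  γ_ε : ∀ {g h l : G} (e : g * h = l), ε g ≫ (act g).map (ε h) ≫ γ e (𝟙_ C) = ε l
  ι_μ : ∀ {u : G} (e : u = 1) (X Y : C), (ι e X ⊗ₘ ι e Y) ≫ μ u X Y = ι e (X ⊗ Y)
  ι_ε : ∀ {u : G} (e : u = 1), ι e (𝟙_ C) = ε u
  γ_associativity : ∀ {a b c ab bc abc : G} (e₁ : a * b = ab) (e₂ : b * c = bc)
    (e₃ : ab * c = abc) (e₄ : a * bc = abc) (X : C),
    (act a).map (γ e₂ X) ≫ γ e₄ X = γ e₁ ((act c).obj X) ≫ γ e₃ X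
  γ_left_unitality : ∀ {u g : G} (e : u = 1) (e' : u * g = g) (X : C),
    ι e ((act g).obj X) ≫ γ e' X = 𝟙 _
  γ_right_unitality : ∀ {u g : G} (e : u = 1) (e' : g * u = g) (X : C),
    (act g).map (ι e X) ≫ γ e' X = 𝟙 _

attribute [instance] IsAction.act_additive IsAction.act_equivalence IsAction.μ_iso
  IsAction.ε_iso IsAction.γ_iso IsAction.ι_iso

/-- The axioms of a braided `G`-crossed category: besides the action axioms,
`C` is the direct sum of the full subcategories `C_g`, this is a grading of the tensor
product, `g(C_h) ⊆ C_{ghg⁻¹}`, and the crossed braiding is a natural isomorphism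
satisfying the compatibility with the action and the two hexagons. -/
class IsBraidedCrossed (G : Type*) [Group G] [Fintype G] (C : Type*) [Category C] [Preadditive C]
    [MonoidalCategory C] [CrossedData G C] : Prop extends IsAction G C where
  deg_iso : ∀ (g : G) {X Y : C}, (X ≅ Y) → deg g X → deg g Y
  deg_orthogonal : ∀ {g h : G} {X Y : C}, g ≠ h → deg g X → deg h Y → ∀ f : X ⟶ Y, f = 0
  deg_decomposition : ∀ X : C, ∃ (Y : G → C) (i : ∀ g, Y g ⟶ X) (p : ∀ g, X ⟶ Y g),
    (∀ g, deg g (Y g)) ∧ (∀ g, i g ≫ p g = 𝟙 (Y g)) ∧ ∑ g, p g ≫ i g = 𝟙 X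
  deg_unit : deg (1 : G) (𝟙_ C)
  deg_tensor : ∀ {g h : G} {X Y : C}, deg g X → deg h Y → deg (g * h) (X ⊗ Y)
  deg_act : ∀ (g : G) {h : G} {X : C}, deg h X → deg (g * h * g⁻¹) ((act g).obj X)
  cb_iso : ∀ {g : G} {X : C} (hX : deg g X) (Y : C), IsIso (cb hX Y)
  cb_natural : ∀ {g : G} {X X' Y Y' : C} (hX : deg g X) (hX' : deg g X')
    (f : X ⟶ X') (f' : Y ⟶ Y'),
    (f ⊗ₘ f') ≫ cb hX' Y' = cb hX Y ≫ ((act g).map f' ⊗ₘ f)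
  cb_action : ∀ (g : G) {h : G} {X : C} (hX : deg h X) (Y : C),
    μ g X Y ≫ (act g).map (cb hX Y) ≫ inv (μ g ((act h).obj Y) X) ≫
        γ (rfl : g * h = g * h) Y ▷ (act g).obj X =
      cb (deg_act g hX) ((act g).obj Y) ≫
        γ (show g * h * g⁻¹ * g = g * h by group) Y ▷ (act g).obj X
  cb_hexagon₁ : ∀ {g : G} {X : C} (hX : deg g X) (Y Z : C),
    (α_ X Y Z).hom ≫ cb hX (Y ⊗ Z) ≫ inv (μ g Y Z) ▷ X ≫ (α_ _ _ _).hom =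
      cb hX Y ▷ Z ≫ (α_ _ _ _).hom ≫ (act g).obj Y ◁ cb hX Z
  cb_hexagon₂ : ∀ {g h : G} {X Y : C} (hX : deg g X) (hY : deg h Y) (Z : C),
    cb (deg_tensor hX hY) Z =
      (α_ _ _ _).hom ≫ X ◁ cb hY Z ≫ (α_ _ _ _).inv ≫ cb hX ((act h).obj Z) ▷ Y ≫
        (α_ _ _ _).hom ≫ γ (rfl : g * h = g * h) Z ▷ (X ⊗ Y)

attribute [instance] IsBraidedCrossed.cb_iso

/-- A braided `G`-crossed fusion category over `k`. -/
structure IsBraidedCrossedFusion (k G : Type*) [Field k] [Group G] [Fintype G]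
    (C : Type*) [Category C] [Preadditive C] [Linear k C] [MonoidalCategory C]
    [CrossedData G C] : Prop where
  fusion : IsFusion k C
  act_linear : ∀ g : G, (act g : C ⥤ C).Linear k
  crossed : IsBraidedCrossed G C
end GCrossed

namespace GCrossed
open CrossedData

section Equivariantization

variable (G : Type*) [Group G] (C : Type*) [Category C] [Preadditive C] [MonoidalCategory C]
  [CrossedData G C]

/-- A `G`-equivariant object of `C`: an object `X` with isomorphisms `v_g : g(X) ≅ X` such that
`v_{gh} ∘ γ_{g,h} = v_g ∘ g(v_h)`. -/
structure Equivariant where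
  obj : C
  v : ∀ g : G, (act g).obj obj ≅ obj
  v_mul : ∀ {g h l : G} (e : g * h = l),
    γ e obj ≫ (v l).hom = (act g).map (v h).hom ≫ (v g).hom

namespace Equivariant

variable {G C}

/-- Morphisms of equivariant objects: morphisms `f` with `f ∘ v_g = v_g ∘ g(f)`. -/
@[ext]
structure Hom (X Y : Equivariant G C) where
  hom : X.obj ⟶ Y.obj
  comm : ∀ g : G, (act g).map hom ≫ (Y.v g).hom = (X.v g).hom ≫ hom

instance : Category (Equivariant G C) where
  Hom := Hom
  id X := ⟨𝟙 _, by simp⟩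
  comp f g := ⟨f.hom ≫ g.hom, fun a => by
    rw [Functor.map_comp, Category.assoc, g.comm, ← Category.assoc, f.comm, Category.assoc]⟩
  id_comp f := Hom.ext (Category.id_comp _)
  comp_id f := Hom.ext (Category.comp_id _)
  assoc f g h := Hom.ext (Category.assoc _ _ _)

@[ext] lemma hom_ext {X Y : Equivariant G C} {f g : X ⟶ Y} (h : f.hom = g.hom) : f = g := Hom.ext h
@[simp] lemma id_hom (X : Equivariant G C) : Hom.hom (𝟙 X) = 𝟙 X.obj := rfl
@[simp] lemma comp_hom {X Y Z : Equivariant G C} (f : X ⟶ Y) (g : Y ⟶ Z) :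
    (f ≫ g).hom = f.hom ≫ g.hom := rfl

variable (G C) in
/-- The functor forgetting the equivariant structure. -/
@[simps] def forget : Equivariant G C ⥤ C where
  obj X := X.obj
  map f := f.hom

instance : (forget G C).Faithful := ⟨fun h => Hom.ext h⟩

/-- An equivariant morphism whose underlying morphism is invertible is invertible. -/
@[simps] def mkIso {X Y : Equivariant G C} (e : X.obj ≅ Y.obj)
    (h : ∀ g : G, (act g).map e.hom ≫ (Y.v g).hom = (X.v g).hom ≫ e.hom) : X ≅ Y where
  hom := ⟨e.hom, h⟩
  inv := ⟨e.inv, fun g => by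
    rw [← cancel_epi ((act g).map e.hom), ← Category.assoc, ← Functor.map_comp, e.hom_inv_id,
      CategoryTheory.Functor.map_id, Category.id_comp, ← Category.assoc, h g, Category.assoc, e.hom_inv_id,
      Category.comp_id]⟩
  hom_inv_id := Hom.ext e.hom_inv_id
  inv_hom_id := Hom.ext e.inv_hom_id

section Linear

variable [∀ g : G, (act g : C ⥤ C).Additive]

instance (X Y : Equivariant G C) : Add (X ⟶ Y) :=
  ⟨fun f f' => ⟨f.hom + f'.hom, fun g => by
    simp [Functor.map_add, f.comm, f'.comm]⟩⟩
instance (X Y : Equivariant G C) : Zero (X ⟶ Y) := ⟨⟨0, fun g => by simp⟩⟩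
instance (X Y : Equivariant G C) : Neg (X ⟶ Y) :=
  ⟨fun f => ⟨-f.hom, fun g => by simp [Functor.map_neg, f.comm]⟩⟩
instance (X Y : Equivariant G C) : Sub (X ⟶ Y) :=
  ⟨fun f f' => ⟨f.hom - f'.hom, fun g => by simp [Functor.map_sub, f.comm, f'.comm]⟩⟩
instance (X Y : Equivariant G C) : SMul ℕ (X ⟶ Y) :=
  ⟨fun n f => ⟨n • f.hom, fun g => by simp [f.comm]⟩⟩
instance (X Y : Equivariant G C) : SMul ℤ (X ⟶ Y) :=
  ⟨fun n f => ⟨n • f.hom, fun g => by simp [f.comm]⟩⟩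

lemma hom_injective (X Y : Equivariant G C) :
    Function.Injective (fun f : X ⟶ Y => f.hom) := fun _ _ h => Hom.ext h

instance (X Y : Equivariant G C) : AddCommGroup (X ⟶ Y) :=
  (hom_injective X Y).addCommGroup _ rfl (fun _ _ => rfl) (fun _ => rfl) (fun _ _ => rfl)
    (fun _ _ => rfl) (fun _ _ => rfl)

instance : Preadditive (Equivariant G C) where
  add_comp _ _ _ f f' g := Hom.ext (Preadditive.add_comp _ _ _ f.hom f'.hom g.hom)
  comp_add _ _ _ f g g' := Hom.ext (Preadditive.comp_add _ _ _ f.hom g.hom g'.hom)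

instance : (forget G C).Additive where

variable {k : Type*} [Field k] [Linear k C] [∀ g : G, (act g : C ⥤ C).Linear k]

instance (X Y : Equivariant G C) : SMul k (X ⟶ Y) :=
  ⟨fun n f => ⟨n • f.hom, fun g => by simp [Functor.map_smul, f.comm]⟩⟩

instance (X Y : Equivariant G C) : Module k (X ⟶ Y) :=
  (hom_injective X Y).module k ⟨⟨fun f : X ⟶ Y => f.hom, rfl⟩, fun _ _ => rfl⟩ (fun _ _ => rfl)

instance : Linear k (Equivariant G C) where
  smul_comp _ _ _ r f g := Hom.ext (Linear.smul_comp _ _ _ r f.hom g.hom)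
  comp_smul _ _ _ f r g := Hom.ext (Linear.comp_smul _ _ _ f.hom r g.hom)

end Linear

section Monoidal

variable [IsAction G C]

section Aux

variable {g : G} {X Y Z X' Y' : C}

/-- The isomorphism `g(X ⊗ Y) ≅ X ⊗ Y` induced by `g(X) ≅ X` and `g(Y) ≅ Y`. -/
noncomputable def tensV (x : (act g).obj X ≅ X) (y : (act g).obj Y ≅ Y) :
    (act g).obj (X ⊗ Y) ≅ X ⊗ Y :=
  (asIso (μ g X Y)).symm ≪≫ (x ⊗ᵢ y)

lemma μ_tensV (x : (act g).obj X ≅ X) (y : (act g).obj Y ≅ Y) :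
    μ g X Y ≫ (tensV x y).hom = (x.hom ⊗ₘ y.hom) := by
  simp [tensV]

lemma tensV_natural {x : (act g).obj X ≅ X} {y : (act g).obj Y ≅ Y}
    {x' : (act g).obj X' ≅ X'} {y' : (act g).obj Y' ≅ Y'} {f : X ⟶ X'} {f' : Y ⟶ Y'}
    (h : (act g).map f ≫ x'.hom = x.hom ≫ f) (h' : (act g).map f' ≫ y'.hom = y.hom ≫ f') :
    (act g).map (f ⊗ₘ f') ≫ (tensV x' y').hom = (tensV x y).hom ≫ (f ⊗ₘ f') := by
  rw [← cancel_epi (μ g X Y), ← reassoc_of% IsAction.μ_natural, μ_tensV, reassoc_of% μ_tensV,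
    tensorHom_comp_tensorHom, tensorHom_comp_tensorHom, h, h']

lemma tensV_associator (x : (act g).obj X ≅ X) (y : (act g).obj Y ≅ Y) (z : (act g).obj Z ≅ Z) :
    (act g).map (α_ X Y Z).hom ≫ (tensV x (tensV y z)).hom =
      (tensV (tensV x y) z).hom ≫ (α_ X Y Z).hom := by
  rw [← cancel_epi (μ g (X ⊗ Y) Z), ← cancel_epi (μ g X Y ▷ _), reassoc_of% IsAction.μ_associativity,
    μ_tensV, reassoc_of% μ_tensV]
  rw [← id_tensorHom, ← tensorHom_id, tensorHom_comp_tensorHom, tensorHom_comp_tensorHom_assoc,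
    μ_tensV, μ_tensV, Category.id_comp, Category.id_comp, associator_naturality]

lemma tensV_leftUnitor (x : (act g).obj X ≅ X) :
    (act g).map (λ_ X).hom ≫ x.hom =
      (tensV (asIso (ε g : 𝟙_ C ⟶ _)).symm x).hom ≫ (λ_ X).hom := by
  rw [← cancel_epi (μ g (𝟙_ C) X), ← cancel_epi (ε g ▷ _), reassoc_of% IsAction.μ_left_unitality,
    reassoc_of% μ_tensV]
  simp [MonoidalCategory.tensorHom_def]

lemma tensV_rightUnitor (x : (act g).obj X ≅ X) :
    (act g).map (ρ_ X).hom ≫ x.hom =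
      (tensV x (asIso (ε g : 𝟙_ C ⟶ _)).symm).hom ≫ (ρ_ X).hom := by
  rw [← cancel_epi (μ g X (𝟙_ C)), ← cancel_epi (_ ◁ ε g), reassoc_of% IsAction.μ_right_unitality,
    reassoc_of% μ_tensV]
  simp [MonoidalCategory.tensorHom_def']

end Aux

/-- The tensor product of equivariant objects: `X ⊗ Y` with the structure
`g(X ⊗ Y) ≅ g(X) ⊗ g(Y) ≅ X ⊗ Y`. -/
@[simps] noncomputable def tensorObj (X Y : Equivariant G C) : Equivariant G C where
  obj := X.obj ⊗ Y.obj
  v g := tensV (X.v g) (Y.v g)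
  v_mul {g h l} e := by
    rw [← cancel_epi ((act g).map (μ h X.obj Y.obj)),
      ← cancel_epi (μ g ((act h).obj X.obj) ((act h).obj Y.obj)), ← reassoc_of% (IsAction.γ_μ e),
      μ_tensV, ← Functor.map_comp_assoc, μ_tensV, ← reassoc_of% IsAction.μ_natural, μ_tensV,
      tensorHom_comp_tensorHom, tensorHom_comp_tensorHom, X.v_mul e, Y.v_mul e]

/-- The unit object with its canonical equivariant structure. -/
@[simps] noncomputable def tensorUnit : Equivariant G C where
  obj := 𝟙_ C
  v g := (asIso (ε g : 𝟙_ C ⟶ _)).symm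
  v_mul {g h l} e := by
    rw [← cancel_epi ((act g).map (ε h : 𝟙_ C ⟶ _)), ← cancel_epi (ε g : 𝟙_ C ⟶ _),
      reassoc_of% (IsAction.γ_ε e), ← Functor.map_comp_assoc]
    simp

noncomputable instance : MonoidalCategoryStruct (Equivariant G C) where
  tensorObj := tensorObj
  tensorUnit := tensorUnit
  tensorHom f f' := ⟨f.hom ⊗ₘ f'.hom, fun g => tensV_natural (f.comm g) (f'.comm g)⟩
  whiskerLeft X Y Y' f := ⟨X.obj ◁ f.hom, fun g => by
    have := tensV_natural ((𝟙 X : X ⟶ X).comm g) (f.comm g)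
    rw [id_hom, id_tensorHom] at this
    exact this⟩
  whiskerRight {X X'} f Y := ⟨f.hom ▷ Y.obj, fun g => by
    have := tensV_natural (f.comm g) ((𝟙 Y : Y ⟶ Y).comm g)
    rw [id_hom, tensorHom_id] at this
    exact this⟩
  associator X Y Z := mkIso (α_ X.obj Y.obj Z.obj)
    (fun g => tensV_associator (X.v g) (Y.v g) (Z.v g))
  leftUnitor X := mkIso (λ_ X.obj) (fun g => tensV_leftUnitor (X.v g))
  rightUnitor X := mkIso (ρ_ X.obj) (fun g => tensV_rightUnitor (X.v g))

section
variable (X Y Z : Equivariant G C)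
@[simp] lemma tensor_obj : (X ⊗ Y).obj = X.obj ⊗ Y.obj := rfl
@[simp] lemma unit_obj : (𝟙_ (Equivariant G C)).obj = 𝟙_ C := rfl
variable {X Y Z} {X' Y' : Equivariant G C}
@[simp] lemma tensorHom_hom (f : X ⟶ Y) (f' : X' ⟶ Y') :
    Hom.hom (f ⊗ₘ f') = f.hom ⊗ₘ f'.hom := rfl
@[simp] lemma whiskerLeft_hom (f : X ⟶ Y) : Hom.hom (Z ◁ f) = Z.obj ◁ f.hom := rfl
@[simp] lemma whiskerRight_hom (f : X ⟶ Y) : Hom.hom (f ▷ Z) = f.hom ▷ Z.obj := rfl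
variable (X Y Z)
@[simp] lemma associator_hom : Hom.hom (α_ X Y Z).hom = (α_ X.obj Y.obj Z.obj).hom := rfl
@[simp] lemma associator_inv : Hom.hom (α_ X Y Z).inv = (α_ X.obj Y.obj Z.obj).inv := rfl
@[simp] lemma leftUnitor_hom : Hom.hom (λ_ X).hom = (λ_ X.obj).hom := rfl
@[simp] lemma rightUnitor_hom : Hom.hom (ρ_ X).hom = (ρ_ X.obj).hom := rfl
end

noncomputable instance : MonoidalCategory (Equivariant G C) where
  tensorHom_def _ _ := Hom.ext (MonoidalCategory.tensorHom_def _ _)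
  id_tensorHom_id _ _ := Hom.ext (MonoidalCategory.id_tensorHom_id _ _)
  tensorHom_comp_tensorHom _ _ _ _ := Hom.ext (MonoidalCategory.tensorHom_comp_tensorHom _ _ _ _)
  whiskerLeft_id _ _ := Hom.ext (MonoidalCategory.whiskerLeft_id _ _)
  id_whiskerRight _ _ := Hom.ext (MonoidalCategory.id_whiskerRight _ _)
  associator_naturality _ _ _ := Hom.ext (MonoidalCategory.associator_naturality _ _ _)
  leftUnitor_naturality _ := Hom.ext (MonoidalCategory.leftUnitor_naturality _)
  rightUnitor_naturality _ := Hom.ext (MonoidalCategory.rightUnitor_naturality _)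
  pentagon _ _ _ _ := Hom.ext (MonoidalCategory.pentagon _ _ _ _)
  triangle _ _ := Hom.ext (MonoidalCategory.triangle _ _)

instance [MonoidalPreadditive C] : MonoidalPreadditive (Equivariant G C) where
  whiskerLeft_zero := Hom.ext MonoidalPreadditive.whiskerLeft_zero
  zero_whiskerRight := Hom.ext MonoidalPreadditive.zero_whiskerRight
  whiskerLeft_add _ _ := Hom.ext (MonoidalPreadditive.whiskerLeft_add _ _)
  add_whiskerRight _ _ := Hom.ext (MonoidalPreadditive.add_whiskerRight _ _)

end Monoidal

end Equivariant
end Equivariantization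
end GCrossed

namespace GCrossed
open CrossedData

section Naturality

variable {G : Type*} [Group G] {C : Type*} [Category C] [Preadditive C]
  [MonoidalCategory C] [CrossedData G C]

lemma μ_natural_left [IsAction G C] (g : G) {X X' : C} (f : X ⟶ X') (Y : C) :
    (act g).map f ▷ (act g).obj Y ≫ μ g X' Y = μ g X Y ≫ (act g).map (f ▷ Y) := by
  simpa using IsAction.μ_natural g f (𝟙 Y)

lemma μ_natural_right [IsAction G C] (g : G) (X : C) {Y Y' : C} (f : Y ⟶ Y') :
    (act g).obj X ◁ (act g).map f ≫ μ g X Y' = μ g X Y ≫ (act g).map (X ◁ f) := by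
  simpa using IsAction.μ_natural g (𝟙 X) f

lemma cb_natural_left [Fintype G] [IsBraidedCrossed G C] {g : G} {X X' : C}
    (hX : deg g X) (hX' : deg g X') (f : X ⟶ X') (Y : C) :
    f ▷ Y ≫ cb hX' Y = cb hX Y ≫ (act g).obj Y ◁ f := by
  simpa using IsBraidedCrossed.cb_natural hX hX' f (𝟙 Y)

lemma cb_natural_right [Fintype G] [IsBraidedCrossed G C] {g : G} {X : C}
    (hX : deg g X) {Y Y' : C} (f : Y ⟶ Y') :
    X ◁ f ≫ cb hX Y' = cb hX Y ≫ (act g).map f ▷ X := by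
  simpa using IsBraidedCrossed.cb_natural hX hX (𝟙 X) f

lemma cb_action' [Fintype G] [IsBraidedCrossed G C] (g : G) {h : G} {X : C}
    (hX : deg h X) (Y : C) :
    μ g X Y ≫ (act g).map (cb hX Y) =
      cb (IsBraidedCrossed.deg_act g hX) ((act g).obj Y) ≫
        γ (show g * h * g⁻¹ * g = g * h by group) Y ▷ (act g).obj X ≫
        inv (γ (rfl : g * h = g * h) Y) ▷ (act g).obj X ≫ μ g ((act h).obj Y) X := by
  rw [← reassoc_of% (IsBraidedCrossed.cb_action g hX Y)]
  simp

lemma inv_γ_natural [IsAction G C] {g h l : G} (e : g * h = l) {X Y : C} (f : X ⟶ Y) :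
    (act l).map f ≫ inv (γ e Y) = inv (γ e X) ≫ (act g).map ((act h).map f) := by
  rw [IsIso.eq_inv_comp, ← reassoc_of% (IsAction.γ_natural e f), IsIso.hom_inv_id, Category.comp_id]

lemma μ_inv_γ [IsAction G C] {g h l : G} (e : g * h = l) (X Y : C) :
    μ l X Y ≫ inv (γ e (X ⊗ Y)) = (inv (γ e X) ⊗ₘ inv (γ e Y)) ≫
      μ g ((act h).obj X) ((act h).obj Y) ≫ (act g).map (μ h X Y) := by
  rw [← cancel_mono (γ e (X ⊗ Y))]
  simp only [Category.assoc, IsIso.inv_hom_id, Category.comp_id, ← IsAction.γ_μ e]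
  rw [MonoidalCategory.tensorHom_comp_tensorHom_assoc]
  simp

lemma inv_γ_associativity [IsAction G C] {a b c ab bc abc : G} (e₁ : a * b = ab)
    (e₂ : b * c = bc) (e₃ : ab * c = abc) (e₄ : a * bc = abc) (X : C) :
    inv (γ e₄ X) ≫ (act a).map (inv (γ e₂ X)) = inv (γ e₃ X) ≫ inv (γ e₁ ((act c).obj X)) := by
  rw [Functor.map_inv, ← IsIso.inv_comp, ← IsIso.inv_comp]
  simp only [IsAction.γ_associativity e₁ e₂ e₃ e₄]

end Naturality

section Components

variable {G : Type*} [Group G] [Fintype G] {C : Type*} [Category C] [Preadditive C]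
  [MonoidalCategory C] [CrossedData G C] [IsBraidedCrossed G C]

/-- The component `X_g` of degree `g` of an object `X`. -/
noncomputable def comp (X : C) (g : G) : C :=
  (IsBraidedCrossed.deg_decomposition (G := G) X).choose g

/-- The inclusion `X_g ⟶ X`. -/
noncomputable def inc (X : C) (g : G) : comp X g ⟶ X :=
  (IsBraidedCrossed.deg_decomposition (G := G) X).choose_spec.choose g

/-- The projection `X ⟶ X_g`. -/
noncomputable def prj (X : C) (g : G) : X ⟶ comp X g :=
  (IsBraidedCrossed.deg_decomposition (G := G) X).choose_spec.choose_spec.choose g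

lemma deg_comp (X : C) (g : G) : deg g (comp X g) :=
  (IsBraidedCrossed.deg_decomposition (G := G) X).choose_spec.choose_spec.choose_spec.1 g

@[simp] lemma inc_prj (X : C) (g : G) : inc X g ≫ prj X g = 𝟙 _ :=
  (IsBraidedCrossed.deg_decomposition (G := G) X).choose_spec.choose_spec.choose_spec.2.1 g

lemma sum_prj_inc (X : C) : ∑ g : G, prj X g ≫ inc X g = 𝟙 X :=
  (IsBraidedCrossed.deg_decomposition (G := G) X).choose_spec.choose_spec.choose_spec.2.2

lemma comp_prj_eq_zero {X W : C} {g h : G} (hW : deg g W) (f : W ⟶ X) (hne : g ≠ h) :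
    f ≫ prj X h = 0 :=
  IsBraidedCrossed.deg_orthogonal hne hW (deg_comp X h) _

lemma comp_prj_inc {X W : C} {g : G} (hW : deg g W) (f : W ⟶ X) :
    f ≫ prj X g ≫ inc X g = f := by
  conv_rhs => rw [← Category.comp_id f, ← sum_prj_inc (G := G) X, Preadditive.comp_sum]
  rw [Finset.sum_eq_single g]
  · intro h _ hne
    rw [← Category.assoc, comp_prj_eq_zero hW f hne.symm, zero_comp]
  · simp

/-- Two morphisms out of `F(X)`, `F` additive, agree if they agree on all `F(X_g)`. -/
lemma map_component_ext {D : Type*} [Category D] [Preadditive D] (F : C ⥤ D) [F.Additive]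
    {X : C} {T : D} {f f' : F.obj X ⟶ T}
    (h : ∀ g : G, F.map (inc X g) ≫ f = F.map (inc X g) ≫ f') : f = f' := by
  rw [← Category.id_comp f, ← Category.id_comp f', ← F.map_id, ← sum_prj_inc (G := G) X,
    F.map_sum, Preadditive.sum_comp, Preadditive.sum_comp]
  simp only [F.map_comp, Category.assoc, h]

end Components

section Braiding

variable {G : Type*} [Group G] [Fintype G] {C : Type*} [Category C] [Preadditive C]
  [MonoidalCategory C] [MonoidalPreadditive C] [CrossedData G C] [IsBraidedCrossed G C]

lemma whisker_component_ext {X Y T : C} {f f' : X ⊗ Y ⟶ T}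
    (h : ∀ g : G, inc X g ▷ Y ≫ f = inc X g ▷ Y ≫ f') : f = f' :=
  map_component_ext (tensorRight Y) h

namespace Equivariant

/-- The braiding `X ⊗ Y = ⊕ X_g ⊗ Y ⟶ ⊕ g(Y) ⊗ X_g ⟶ ⊕ Y ⊗ X_g = Y ⊗ X` determined by
an equivariant structure on `Y`. -/
noncomputable def braidHom (X : C) {Y : C} (y : ∀ g : G, (act g).obj Y ≅ Y) : X ⊗ Y ⟶ Y ⊗ X :=
  ∑ g : G, prj X g ▷ Y ≫ cb (deg_comp X g) Y ≫ (y g).hom ▷ comp X g ≫ Y ◁ inc X g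

/-- The inverse of `braidHom`. -/
noncomputable def braidInv (X : C) {Y : C} (y : ∀ g : G, (act g).obj Y ≅ Y) : Y ⊗ X ⟶ X ⊗ Y :=
  ∑ g : G, Y ◁ prj X g ≫ (y g).inv ▷ comp X g ≫ inv (cb (deg_comp X g) Y) ≫ inc X g ▷ Y

lemma whisker_braidHom {X Y W : C} (y : ∀ g : G, (act g).obj Y ≅ Y) {g : G}
    (hW : deg g W) (f : W ⟶ X) :
    f ▷ Y ≫ braidHom X y = cb hW Y ≫ (y g).hom ▷ W ≫ Y ◁ f := by
  rw [braidHom, Preadditive.comp_sum, Finset.sum_eq_single g]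
  · have := cb_natural_left hW (deg_comp X g) (f ≫ prj X g) Y
    rw [← comp_whiskerRight_assoc, reassoc_of% this, whisker_exchange_assoc, ← whiskerLeft_comp,
      Category.assoc, comp_prj_inc hW]
  · intro h _ hne
    rw [← comp_whiskerRight_assoc, comp_prj_eq_zero hW f hne.symm]
    simp
  · simp

lemma whisker_braidInv {X Y W : C} (y : ∀ g : G, (act g).obj Y ≅ Y) {g : G}
    (hW : deg g W) (f : W ⟶ X) :
    Y ◁ f ≫ braidInv X y = (y g).inv ▷ W ≫ inv (cb hW Y) ≫ f ▷ Y := by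
  rw [braidInv, Preadditive.comp_sum, Finset.sum_eq_single g]
  · have := cb_natural_left hW (deg_comp X g) (f ≫ prj X g) Y
    rw [← IsIso.inv_comp_eq, ← Category.assoc,
      ← IsIso.eq_comp_inv] at this
    rw [← whiskerLeft_comp_assoc, whisker_exchange_assoc, ← reassoc_of% this, ← comp_whiskerRight,
      Category.assoc, comp_prj_inc hW]
  · intro h _ hne
    rw [← whiskerLeft_comp_assoc, comp_prj_eq_zero hW f hne.symm]
    simp
  · simp

/-- The braiding of an object with an equivariant object. -/
@[simps] noncomputable def braidIso (X : C) {Y : C} (y : ∀ g : G, (act g).obj Y ≅ Y) :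
    X ⊗ Y ≅ Y ⊗ X where
  hom := braidHom X y
  inv := braidInv X y
  hom_inv_id := whisker_component_ext (G := G) fun g => by
    rw [reassoc_of% (whisker_braidHom y (deg_comp X g)), whisker_braidInv y (deg_comp X g)]
    simp
  inv_hom_id := map_component_ext (G := G) (tensorLeft Y) fun g => by
    change Y ◁ _ ≫ _ = Y ◁ _ ≫ _
    rw [reassoc_of% (whisker_braidInv y (deg_comp X g)), whisker_braidHom y (deg_comp X g)]
    simp

lemma braid_equivariant {X Y : C} (x : ∀ g : G, (act g).obj X ≅ X)
    (y : ∀ g : G, (act g).obj Y ≅ Y)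
    (hy : ∀ {g h l : G} (e : g * h = l), γ e Y ≫ (y l).hom = (act g).map (y h).hom ≫ (y g).hom)
    (g : G) :
    (act g).map (braidHom X y) ≫ (tensV (y g) (x g)).hom =
      (tensV (x g) (y g)).hom ≫ braidHom X y := by
  rw [← cancel_epi (μ g X Y)]
  refine map_component_ext (G := G) (act g ⋙ tensorRight _) fun h => ?_
  change (act g).map (inc X h) ▷ (act g).obj Y ≫ _ = (act g).map (inc X h) ▷ (act g).obj Y ≫ _
  have hW := deg_comp X h
  have hgW := IsBraidedCrossed.deg_act g hW
  have e2 : γ (show g * h * g⁻¹ * g = g * h by group) Y ≫ inv (γ (rfl : g * h = g * h) Y) ≫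
      (act g).map (y h).hom ≫ (y g).hom =
      (act (g * h * g⁻¹)).map (y g).hom ≫ (y (g * h * g⁻¹)).hom := by
    rw [← hy rfl, IsIso.inv_hom_id_assoc, hy]
  rw [reassoc_of% μ_tensV, reassoc_of% μ_natural_left, ← Functor.map_comp_assoc, whisker_braidHom y hW,
    ← MonoidalCategory.tensorHom_def, Functor.map_comp_assoc, reassoc_of% cb_action',
    ← reassoc_of% IsAction.μ_natural, μ_tensV, tensorHom_comp_tensorHom,
    MonoidalCategory.tensorHom_def _ ((act g).map (inc X h) ≫ _), 
    ← comp_whiskerRight_assoc, ← comp_whiskerRight_assoc, Category.assoc,  e2,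
    MonoidalCategory.tensorHom_def', Category.assoc, ← whisker_exchange_assoc,
    ← comp_whiskerRight_assoc,
    whisker_braidHom y hgW, reassoc_of% cb_natural_right, comp_whiskerRight_assoc]

noncomputable instance : BraidedCategory (Equivariant G C) where
  braiding X Y := mkIso (braidIso X.obj Y.v) (fun g => braid_equivariant X.v Y.v Y.v_mul g)
  braiding_naturality_right X Y Z f := Hom.ext <| whisker_component_ext (G := G) fun g => by
    change inc X.obj g ▷ _ ≫ X.obj ◁ f.hom ≫ braidHom X.obj Z.v =
      inc X.obj g ▷ _ ≫ braidHom X.obj Y.v ≫ f.hom ▷ X.obj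
    have hW := deg_comp X.obj g
    rw [← whisker_exchange_assoc, whisker_braidHom _ hW, reassoc_of% (whisker_braidHom _ hW),
      reassoc_of% cb_natural_right, whisker_exchange, ← comp_whiskerRight_assoc, f.comm,
      comp_whiskerRight_assoc]
  braiding_naturality_left {X Y} f Z := Hom.ext <| whisker_component_ext (G := G) fun g => by
    change inc X.obj g ▷ _ ≫ f.hom ▷ Z.obj ≫ braidHom Y.obj Z.v =
      inc X.obj g ▷ _ ≫ braidHom X.obj Z.v ≫ Z.obj ◁ f.hom
    have hW := deg_comp X.obj g
    rw [← comp_whiskerRight_assoc, whisker_braidHom _ hW, reassoc_of% (whisker_braidHom _ hW)]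
    simp
  hexagon_forward X Y Z := Hom.ext <|
      map_component_ext (G := G) (tensorRight Y.obj ⋙ tensorRight Z.obj) fun g => by
    change (inc X.obj g ▷ Y.obj) ▷ Z.obj ≫ (α_ X.obj Y.obj Z.obj).hom ≫
        braidHom X.obj (fun g => tensV (Y.v g) (Z.v g)) ≫ (α_ Y.obj Z.obj X.obj).hom =
      (inc X.obj g ▷ Y.obj) ▷ Z.obj ≫ braidHom X.obj Y.v ▷ Z.obj ≫ (α_ _ _ _).hom ≫
        Y.obj ◁ braidHom X.obj Z.v
    have hW := deg_comp X.obj g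
    have e : (α_ _ Y.obj Z.obj).hom ≫ cb hW (Y.obj ⊗ Z.obj) ≫ inv (μ g Y.obj Z.obj) ▷ _ =
        cb hW Y.obj ▷ Z.obj ≫ (α_ _ _ _).hom ≫ (act g).obj Y.obj ◁ cb hW Z.obj ≫
          (α_ _ _ _).inv := by
      simp [← reassoc_of% (IsBraidedCrossed.cb_hexagon₁ hW Y.obj Z.obj)]
    rw [associator_naturality_left_assoc, reassoc_of% (whisker_braidHom _ hW), ← comp_whiskerRight_assoc,
      whisker_braidHom _ hW, tensV]
    simp only [Iso.trans_hom, Iso.symm_hom, asIso_inv, tensorIso_hom, comp_whiskerRight,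
      Category.assoc]
    rw [reassoc_of% e, associator_naturality_middle_assoc, ← whiskerLeft_comp,
      whisker_braidHom _ hW]
    simp only [MonoidalCategory.tensorHom_def, comp_whiskerRight, whiskerLeft_comp, Category.assoc]
    rw [← associator_inv_naturality_left_assoc, whisker_exchange_assoc]
    simp
  hexagon_reverse X Y Z := Hom.ext <|
      map_component_ext (G := G) (tensorRight (Y.obj ⊗ Z.obj)) fun g =>
      map_component_ext (G := G) (tensorRight Z.obj ⋙ tensorLeft (comp X.obj g)) fun h => by
    change comp X.obj g ◁ inc Y.obj h ▷ Z.obj ≫ inc X.obj g ▷ (Y.obj ⊗ Z.obj) ≫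
        (α_ X.obj Y.obj Z.obj).inv ≫
        braidHom (X.obj ⊗ Y.obj) Z.v ≫ (α_ Z.obj X.obj Y.obj).inv =
      comp X.obj g ◁ inc Y.obj h ▷ Z.obj ≫
      inc X.obj g ▷ (Y.obj ⊗ Z.obj) ≫ X.obj ◁ braidHom Y.obj Z.v ≫ (α_ _ _ _).inv ≫
        braidHom X.obj Z.v ▷ Y.obj
    have hW := deg_comp X.obj g
    have hV := deg_comp Y.obj h
    have e : comp X.obj g ◁ inc Y.obj h ▷ Z.obj ≫ inc X.obj g ▷ (Y.obj ⊗ Z.obj) ≫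
        (α_ X.obj Y.obj Z.obj).inv = (α_ _ _ _).inv ≫ (inc X.obj g ⊗ₘ inc Y.obj h) ▷ Z.obj := by
      simp [MonoidalCategory.tensorHom_def']
    rw [reassoc_of% e, reassoc_of% (whisker_braidHom _ (IsBraidedCrossed.deg_tensor hW hV)),
      ← whisker_exchange_assoc (inc X.obj g), ← whiskerLeft_comp_assoc, whisker_braidHom _ hV,
      associator_inv_naturality_left_assoc, ← comp_whiskerRight, whisker_braidHom _ hW,
      IsBraidedCrossed.cb_hexagon₂ hW hV]
    simp only [Category.assoc, Iso.inv_hom_id_assoc]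
    rw [← comp_whiskerRight_assoc, Z.v_mul]
    simp only [comp_whiskerRight, whiskerLeft_comp, Category.assoc,
      associator_inv_naturality_middle_assoc, associator_inv_naturality_right_assoc]
    rw [whisker_exchange_assoc (cb hW Z.obj), ← comp_whiskerRight_assoc (_ ◁ _),
      cb_natural_right]
    simp only [MonoidalCategory.tensorHom_def, whiskerLeft_comp, comp_whiskerRight, Category.assoc]
    rw [← associator_naturality_left_assoc, ← associator_naturality_left_assoc,
      whisker_exchange_assoc, whisker_exchange]
    simp

end Equivariant
end Braiding
end GCrossed

namespace GCrossed
open CrossedData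

/-- The underlying category of the reverse `C^rev`; it is `C` itself. -/
def Rev (_ : Type*) (C : Type*) : Type _ := C

section Reverse

variable (G : Type*) [Group G] [Fintype G] (C : Type*) [Category C]

instance : Category (Rev G C) := inferInstanceAs (Category C)
instance [Preadditive C] : Preadditive (Rev G C) := inferInstanceAs (Preadditive C)
instance {k : Type*} [Field k] [Preadditive C] [Linear k C] : Linear k (Rev G C) :=
  inferInstanceAs (Linear k C)

end Reverse

namespace Rev

section Monoidal

variable {G : Type*} [Group G] [Fintype G] {C : Type*} [Category C] [Preadditive C]
  [HasFiniteBiproducts C] [MonoidalCategory C] [MonoidalPreadditive C] [CrossedData G C]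
  [IsBraidedCrossed G C]

variable (G) in
/-- The object `X ⊗^rev Y = ⊕ X_g ⊗ g⁻¹(Y)`. -/
noncomputable def tens (X Y : C) : C := ⨁ fun g : G => comp X g ⊗ (act g⁻¹).obj Y

/-- The inclusion `X_g ⊗ g⁻¹(Y) ⟶ X ⊗^rev Y`. -/
noncomputable def ti (X Y : C) (g : G) : comp X g ⊗ (act g⁻¹).obj Y ⟶ tens G X Y :=
  biproduct.ι (fun g : G => comp X g ⊗ (act g⁻¹).obj Y) g

/-- The projection `X ⊗^rev Y ⟶ X_g ⊗ g⁻¹(Y)`. -/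
noncomputable def tp (X Y : C) (g : G) : tens G X Y ⟶ comp X g ⊗ (act g⁻¹).obj Y :=
  biproduct.π (fun g : G => comp X g ⊗ (act g⁻¹).obj Y) g

@[simp] lemma ti_tp (X Y : C) (g : G) : ti X Y g ≫ tp X Y g = 𝟙 _ :=
  biproduct.ι_π_self _ _

lemma ti_tp_ne (X Y : C) {g h : G} (hne : g ≠ h) : ti X Y g ≫ tp X Y h = 0 :=
  biproduct.ι_π_ne _ hne

lemma ti_ext {X Y T : C} {f f' : tens G X Y ⟶ T} (h : ∀ g : G, ti X Y g ≫ f = ti X Y g ≫ f') :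
    f = f' :=
  biproduct.hom_ext' _ _ h

lemma sum_tp_ti (X Y : C) : ∑ g : G, tp X Y g ≫ ti X Y g = 𝟙 (tens G X Y) :=
  ti_ext fun g => by
    rw [Preadditive.comp_sum, Finset.sum_eq_single g]
    · rw [reassoc_of% ti_tp, Category.comp_id]
    · intro h _ hne
      rw [reassoc_of% (ti_tp_ne X Y hne.symm), zero_comp]
    · simp

/-- For `W` in `C_g`, the morphism `W ⊗ g⁻¹(V) ⟶ X ⊗^rev Y` given by morphisms
`W ⟶ X` and `V ⟶ Y`. -/
noncomputable def into {g : G} {W : C} (_ : deg g W) {X V Y : C} (f : W ⟶ X) (f' : V ⟶ Y) :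
    W ⊗ (act g⁻¹).obj V ⟶ tens G X Y :=
  (f ≫ prj X g ⊗ₘ (act g⁻¹).map f') ≫ ti X Y g

/-- For `W` in `C_g`, the morphism `X ⊗^rev Y ⟶ W ⊗ g⁻¹(V)` given by morphisms
`X ⟶ W` and `Y ⟶ V`. -/
noncomputable def outof {g : G} {W : C} (_ : deg g W) {X V Y : C} (f : X ⟶ W) (f' : Y ⟶ V) :
    tens G X Y ⟶ W ⊗ (act g⁻¹).obj V :=
  tp X Y g ≫ (inc X g ≫ f ⊗ₘ (act g⁻¹).map f')

variable (G) in
/-- The tensor product in `C^rev` of morphisms. -/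
noncomputable def tensMap {X X' Y Y' : C} (f : X ⟶ X') (f' : Y ⟶ Y') :
    tens G X Y ⟶ tens G X' Y' :=
  ∑ g : G, tp X Y g ≫ (inc X g ≫ f ≫ prj X' g ⊗ₘ (act g⁻¹).map f') ≫ ti X' Y' g

lemma tensor_into {g : G} {W W' X V V' Y : C} (hW : deg g W) (hW' : deg g W')
    (a : W' ⟶ W) (b : V' ⟶ V) (f : W ⟶ X) (f' : V ⟶ Y) :
    (a ⊗ₘ (act g⁻¹).map b) ≫ into hW f f' = into hW' (a ≫ f) (b ≫ f') := by
  simp only [into, MonoidalCategory.tensorHom_comp_tensorHom_assoc, Functor.map_comp,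
    Category.assoc]

lemma whiskerRight_into {g : G} {W W' X V Y : C} (hW : deg g W) (hW' : deg g W')
    (a : W' ⟶ W) (f : W ⟶ X) (f' : V ⟶ Y) :
    a ▷ _ ≫ into hW f f' = into hW' (a ≫ f) f' := by
  simpa using tensor_into hW hW' a (𝟙 V) f f'

lemma whiskerLeft_into {g : G} {W X V V' Y : C} (hW : deg g W)
    (b : V' ⟶ V) (f : W ⟶ X) (f' : V ⟶ Y) :
    W ◁ (act g⁻¹).map b ≫ into hW f f' = into hW f (b ≫ f') := by
  simpa using tensor_into hW hW (𝟙 W) b f f'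

lemma ti_tensMap {X X' Y Y' : C} (f : X ⟶ X') (f' : Y ⟶ Y') (g : G) :
    ti X Y g ≫ tensMap G f f' =
      (inc X g ≫ f ≫ prj X' g ⊗ₘ (act g⁻¹).map f') ≫ ti X' Y' g := by
  rw [tensMap, Preadditive.comp_sum, Finset.sum_eq_single g]
  · rw [reassoc_of% ti_tp]
  · intro h _ hne
    rw [reassoc_of% (ti_tp_ne X Y hne.symm), zero_comp]
  · simp

lemma into_tensMap {g : G} {W X X' V Y Y' : C} (hW : deg g W)
    (f : W ⟶ X) (f' : V ⟶ Y) (a : X ⟶ X') (b : Y ⟶ Y') :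
    into hW f f' ≫ tensMap G a b = into hW (f ≫ a) (f' ≫ b) := by
  have := comp_prj_inc hW f
  simp only [into, Category.assoc, ti_tensMap, MonoidalCategory.tensorHom_comp_tensorHom_assoc,
    Functor.map_comp, reassoc_of% this]

lemma into_outof {g : G} {W W' X V V' Y : C} (hW : deg g W) (hW' : deg g W')
    (f : W ⟶ X) (f' : V ⟶ Y) (a : X ⟶ W') (b : Y ⟶ V') :
    into hW f f' ≫ outof hW' a b = (f ≫ a ⊗ₘ (act g⁻¹).map (f' ≫ b)) := by
  have := comp_prj_inc hW f
  simp only [into, outof, Category.assoc, reassoc_of% ti_tp, MonoidalCategory.tensorHom_comp_tensorHom,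
    Functor.map_comp, reassoc_of% this]

lemma into_outof_ne {g h : G} {W W' X V V' Y : C} (hW : deg g W) (hW' : deg h W')
    (hne : g ≠ h) (f : W ⟶ X) (f' : V ⟶ Y) (a : X ⟶ W') (b : Y ⟶ V') :
    into hW f f' ≫ outof hW' a b = 0 := by
  simp [into, outof, reassoc_of% (ti_tp_ne _ _ hne)]

lemma into_outof_zero {g h : G} {W W' X V V' Y : C} (hW : deg g W) (hW' : deg h W')
    (f : W ⟶ X) (f' : V ⟶ Y) (a : X ⟶ W') (b : Y ⟶ V') (hz : f ≫ a = 0) :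
    into hW f f' ≫ outof hW' a b = 0 := by
  by_cases hgh : g = h
  · subst hgh
    simp [into_outof, hz]
  · exact into_outof_ne hW hW' hgh f f' a b

lemma into_inc (X Y : C) (g : G) : into (deg_comp X g) (inc X g) (𝟙 Y) = ti X Y g := by
  simp [into]

lemma outof_prj (X Y : C) (g : G) : outof (deg_comp X g) (prj X g) (𝟙 Y) = tp X Y g := by
  simp [outof]

lemma tens_ext {X Y T : C} {f f' : tens G X Y ⟶ T}
    (h : ∀ g : G, into (deg_comp X g) (inc X g) (𝟙 Y) ≫ f =
      into (deg_comp X g) (inc X g) (𝟙 Y) ≫ f') : f = f' :=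
  ti_ext fun g => by simpa only [into_inc] using h g

lemma tens_ext₂ {X Y T : C} {f f' : tens G X Y ⟶ T}
    (h : ∀ g h : G, into (deg_comp X g) (inc X g) (inc Y h) ≫ f =
      into (deg_comp X g) (inc X g) (inc Y h) ≫ f') : f = f' :=
  tens_ext fun g => map_component_ext (G := G) (act g⁻¹ ⋙ tensorLeft (comp X g)) fun l => by
    change _ ◁ (act g⁻¹).map _ ≫ _ = _ ◁ (act g⁻¹).map _ ≫ _
    rw [reassoc_of% whiskerLeft_into, reassoc_of% whiskerLeft_into, Category.comp_id, h]

lemma deg_tens {g h l : G} (e : h * g = l) {W V : C} (hW : deg g W) (hV : deg h V) :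
    deg l (W ⊗ (act g⁻¹).obj V) := by
  have := IsBraidedCrossed.deg_tensor hW (IsBraidedCrossed.deg_act g⁻¹ hV)
  subst e
  simpa [mul_assoc] using this

/-- The isomorphism `(W ⊗ g⁻¹(V)) ⊗ (hg)⁻¹(U) ⟶ W ⊗ g⁻¹(V ⊗ h⁻¹(U))`. -/
noncomputable def assocCore {g h l : G} (e : h * g = l) (W V U : C) :
    (W ⊗ (act g⁻¹).obj V) ⊗ (act l⁻¹).obj U ≅ W ⊗ (act g⁻¹).obj (V ⊗ (act h⁻¹).obj U) :=
  α_ _ _ _ ≪≫ whiskerLeftIso W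
    (whiskerLeftIso _ (asIso (γ (show g⁻¹ * h⁻¹ = l⁻¹ by rw [← e, mul_inv_rev]) U)).symm ≪≫
      asIso (μ g⁻¹ V ((act h⁻¹).obj U)))

/-- The inclusion of `(X_g ⊗ g⁻¹(Y_h)) ⊗ (hg)⁻¹(Z)` in `(X ⊗^rev Y) ⊗^rev Z`. -/
noncomputable def intoL (X Y Z : C) (g h : G) :
    (comp X g ⊗ (act g⁻¹).obj (comp Y h)) ⊗ (act (h * g)⁻¹).obj Z ⟶ tens G (tens G X Y) Z :=
  into (deg_tens rfl (deg_comp X g) (deg_comp Y h)) (into (deg_comp X g) (inc X g) (inc Y h)) (𝟙 Z)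

/-- The projection of `(X ⊗^rev Y) ⊗^rev Z` to `(X_g ⊗ g⁻¹(Y_h)) ⊗ (hg)⁻¹(Z)`. -/
noncomputable def outofL (X Y Z : C) (g h : G) :
    tens G (tens G X Y) Z ⟶ (comp X g ⊗ (act g⁻¹).obj (comp Y h)) ⊗ (act (h * g)⁻¹).obj Z :=
  outof (deg_tens rfl (deg_comp X g) (deg_comp Y h))
    (outof (deg_comp X g) (prj X g) (prj Y h)) (𝟙 Z)

/-- The inclusion of `X_g ⊗ g⁻¹(Y_h ⊗ h⁻¹(Z))` in `X ⊗^rev (Y ⊗^rev Z)`. -/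
noncomputable def intoR (X Y Z : C) (g h : G) :
    comp X g ⊗ (act g⁻¹).obj (comp Y h ⊗ (act h⁻¹).obj Z) ⟶ tens G X (tens G Y Z) :=
  into (deg_comp X g) (inc X g) (into (deg_comp Y h) (inc Y h) (𝟙 Z))

/-- The projection of `X ⊗^rev (Y ⊗^rev Z)` to `X_g ⊗ g⁻¹(Y_h ⊗ h⁻¹(Z))`. -/
noncomputable def outofR (X Y Z : C) (g h : G) :
    tens G X (tens G Y Z) ⟶ comp X g ⊗ (act g⁻¹).obj (comp Y h ⊗ (act h⁻¹).obj Z) :=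
  outof (deg_comp X g) (prj X g) (outof (deg_comp Y h) (prj Y h) (𝟙 Z))

/-- The associativity constraint of `C^rev`, given on the summand `X_g, Y_h` by `assocCore`. -/
noncomputable def assocHom (X Y Z : C) : tens G (tens G X Y) Z ⟶ tens G X (tens G Y Z) :=
  ∑ g : G, ∑ h : G, outofL X Y Z g h ≫ (assocCore rfl _ _ _).hom ≫ intoR X Y Z g h

/-- The inverse of `assocHom`. -/
noncomputable def assocInv (X Y Z : C) : tens G X (tens G Y Z) ⟶ tens G (tens G X Y) Z :=
  ∑ g : G, ∑ h : G, outofR X Y Z g h ≫ (assocCore rfl _ _ _).inv ≫ intoL X Y Z g h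

lemma assocCore_hom {g h l : G} (e : h * g = l) (W V U : C) :
    (assocCore e W V U).hom = (α_ _ _ _).hom ≫ W ◁ ((act g⁻¹).obj V ◁
      inv (γ (show g⁻¹ * h⁻¹ = l⁻¹ by rw [← e, mul_inv_rev]) U) ≫ μ g⁻¹ V ((act h⁻¹).obj U)) := by
  simp [assocCore]

lemma assocCore_natural {g h l : G} (e : h * g = l) {W V U W' V' U' : C} (a : W ⟶ W')
    (b : V ⟶ V') (c : U ⟶ U') :
    ((a ⊗ₘ (act g⁻¹).map b) ⊗ₘ (act l⁻¹).map c) ≫ (assocCore e W' V' U').hom =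
      (assocCore e W V U).hom ≫ (a ⊗ₘ (act g⁻¹).map (b ⊗ₘ (act h⁻¹).map c)) := by
  simp only [assocCore_hom, MonoidalCategory.associator_naturality_assoc, Category.assoc]
  rw [← id_tensorHom W', ← id_tensorHom W, MonoidalCategory.tensorHom_comp_tensorHom,
    MonoidalCategory.tensorHom_comp_tensorHom, Category.comp_id, Category.id_comp,
    Category.assoc, ← IsAction.μ_natural, ← id_tensorHom, ← id_tensorHom,
    MonoidalCategory.tensorHom_comp_tensorHom_assoc,
    MonoidalCategory.tensorHom_comp_tensorHom_assoc, Category.comp_id, Category.id_comp,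
    inv_γ_natural]

lemma assocCore_natural_inv {g h l : G} (e : h * g = l) {W V U W' V' U' : C}
    (a : W ⟶ W') (b : V ⟶ V') (c : U ⟶ U') :
    (a ⊗ₘ (act g⁻¹).map (b ⊗ₘ (act h⁻¹).map c)) ≫ (assocCore e W' V' U').inv =
      (assocCore e W V U).inv ≫ ((a ⊗ₘ (act g⁻¹).map b) ⊗ₘ (act l⁻¹).map c) := by
  rw [Iso.comp_inv_eq, Category.assoc, assocCore_natural, Iso.inv_hom_id_assoc]

/-- Coherence of `assocCore`: the pentagon. -/
lemma assocCore_pentagon {g h k hg kh khg : G} (e₁ : h * g = hg) (e₂ : k * h = kh)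
    (e₃ : k * hg = khg) (e₄ : kh * g = khg) (W V U T : C) :
    (assocCore e₁ W V U).hom ▷ (act khg⁻¹).obj T ≫ (assocCore e₄ W (V ⊗ (act h⁻¹).obj U) T).hom ≫
        W ◁ (act g⁻¹).map (assocCore e₂ V U T).hom =
      (assocCore e₃ (W ⊗ (act g⁻¹).obj V) U T).hom ≫
        (assocCore e₁ W V (U ⊗ (act k⁻¹).obj T)).hom := by
  have f₁ : g⁻¹ * h⁻¹ = hg⁻¹ := by rw [← e₁, mul_inv_rev]
  have f₂ : h⁻¹ * k⁻¹ = kh⁻¹ := by rw [← e₂, mul_inv_rev]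
  have f₃ : hg⁻¹ * k⁻¹ = khg⁻¹ := by rw [← e₃, mul_inv_rev]
  have f₄ : g⁻¹ * kh⁻¹ = khg⁻¹ := by rw [← e₄, mul_inv_rev]
  have key : ((act g⁻¹).obj V ◁ inv (γ f₁ U) ≫ μ g⁻¹ V ((act h⁻¹).obj U)) ▷ (act khg⁻¹).obj T ≫
      ((act g⁻¹).obj (V ⊗ (act h⁻¹).obj U) ◁ inv (γ f₄ T) ≫ μ g⁻¹ _ _) ≫
      (act g⁻¹).map ((α_ _ _ _).hom ≫ V ◁ ((act h⁻¹).obj U ◁ inv (γ f₂ T) ≫ μ h⁻¹ _ _)) =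
      (α_ _ _ _).hom ≫ (act g⁻¹).obj V ◁ ((act hg⁻¹).obj U ◁ inv (γ f₃ T) ≫ μ hg⁻¹ _ _ ≫
        inv (γ f₁ _)) ≫ μ g⁻¹ _ _ := by
    have e₅ := inv_γ_associativity f₁ f₂ f₃ f₄ T
    simp only [μ_inv_γ, Functor.map_comp, comp_whiskerRight, whiskerLeft_comp, Category.assoc]
    rw [← whisker_exchange_assoc, reassoc_of% IsAction.μ_associativity, ← reassoc_of% μ_natural_right,
      ← μ_natural_right, ← whiskerLeft_comp_assoc _ (μ _ _ _), ← μ_natural_right,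
      whiskerLeft_comp_assoc, associator_naturality_right_assoc,
      associator_naturality_middle_assoc]
    simp only [← whiskerLeft_comp_assoc, Category.assoc, e₅,
      MonoidalCategory.tensorHom_def]
    simp only [whiskerLeft_comp_assoc, whisker_exchange_assoc]
  simp only [assocCore_hom]
  rw [comp_whiskerRight, Category.assoc, Category.assoc, associator_naturality_middle_assoc,
    ← whiskerLeft_comp, ← whiskerLeft_comp, key, whiskerLeft_comp, Category.assoc,
    associator_naturality_right_assoc, pentagon_assoc]
  simp

/-- Coherence of `assocCore`: the triangle. -/
lemma assocCore_triangle {g : G} (e : 1 * g = g) (W U : C) :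
    (assocCore e W (𝟙_ C) U).hom ≫ W ◁ (act g⁻¹).map (𝟙_ C ◁ inv (ι inv_one U) ≫ (λ_ U).hom) =
      (W ◁ inv (ε g⁻¹) ≫ (ρ_ W).hom) ▷ (act g⁻¹).obj U := by
  have e₁ : inv (γ (show g⁻¹ * (1 : G)⁻¹ = g⁻¹ by simp) U) ≫ (act g⁻¹).map (inv (ι inv_one U)) =
      𝟙 _ := by
    rw [Functor.map_inv, ← IsIso.inv_comp]
    simp only [IsAction.γ_right_unitality (inv_one (G := G)) (show g⁻¹ * (1 : G)⁻¹ = g⁻¹ by simp) U,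
      IsIso.inv_id]
  have e₂ : μ g⁻¹ (𝟙_ C) U ≫ (act g⁻¹).map (λ_ U).hom = inv (ε g⁻¹) ▷ _ ≫ (λ_ _).hom := by
    rw [← IsAction.μ_left_unitality]
    simp
  rw [assocCore_hom, Category.assoc, ← whiskerLeft_comp, Functor.map_comp, Category.assoc,
    ← reassoc_of% μ_natural_right, e₂, ← whiskerLeft_comp_assoc, e₁]
  simp

/-- Compatibility of the associativity constraint with the maps `into`. -/
lemma into_assocHom {g h l : G} (e : h * g = l) {X Y Z W V U : C} (hW : deg g W)
    (hV : deg h V) (hl : deg l (W ⊗ (act g⁻¹).obj V)) (a : W ⟶ X) (b : V ⟶ Y) (c : U ⟶ Z) :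
    into hl (into hW a b) c ≫ assocHom X Y Z =
      (assocCore e W V U).hom ≫ into hW a (into hV b c) := by
  subst e
  rw [assocHom, Preadditive.comp_sum, Finset.sum_eq_single g]
  · rw [Preadditive.comp_sum, Finset.sum_eq_single h]
    · rw [outofL, intoR, reassoc_of% into_outof, into_outof, reassoc_of% assocCore_natural,
        tensor_into (deg_comp X g) hW, tensor_into (deg_comp Y h) hV]
      simp only [Category.assoc, comp_prj_inc hW, comp_prj_inc hV, Category.comp_id]
    · intro h' _ hne
      rw [outofL, ← Category.assoc, into_outof_zero, zero_comp]
      rw [into_outof, comp_prj_eq_zero hV _ hne.symm]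
      simp
    · simp
  · intro g' _ hne
    rw [Preadditive.comp_sum]
    refine Finset.sum_eq_zero fun h' _ => ?_
    rw [outofL, ← Category.assoc, into_outof_zero, zero_comp]
    exact into_outof_ne _ _ hne.symm _ _ _ _
  · simp

lemma into_assocInv {g h l : G} (e : h * g = l) {X Y Z W V U : C} (hW : deg g W)
    (hV : deg h V) (hl : deg l (W ⊗ (act g⁻¹).obj V)) (a : W ⟶ X) (b : V ⟶ Y) (c : U ⟶ Z) :
    into hW a (into hV b c) ≫ assocInv X Y Z =
      (assocCore e W V U).inv ≫ into hl (into hW a b) c := by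
  subst e
  rw [assocInv, Preadditive.comp_sum, Finset.sum_eq_single g]
  · rw [Preadditive.comp_sum, Finset.sum_eq_single h]
    · rw [outofR, intoL, reassoc_of% into_outof, into_outof, reassoc_of% assocCore_natural_inv,
        tensor_into _ hl, tensor_into _ hW]
      simp only [Category.assoc, comp_prj_inc hW, comp_prj_inc hV, Category.comp_id]
    · intro h' _ hne
      rw [outofR, reassoc_of% into_outof, into_outof_ne _ _ hne.symm]
      simp
    · simp
  · intro g' _ hne
    rw [Preadditive.comp_sum]
    refine Finset.sum_eq_zero fun h' _ => ?_
    rw [outofR, ← Category.assoc, into_outof_ne _ _ hne.symm, zero_comp]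
  · simp

lemma into_add {g : G} {W X V Y : C} (hW : deg g W) (f₁ f₂ : W ⟶ X) (f' : V ⟶ Y) :
    into hW (f₁ + f₂) f' = into hW f₁ f' + into hW f₂ f' := by
  simp only [into, Preadditive.add_comp, MonoidalPreadditive.add_tensor]

lemma into_zero {g : G} {W X V Y : C} (hW : deg g W) (f' : V ⟶ Y) :
    into hW (0 : W ⟶ X) f' = 0 := by
  simp [into]

lemma sum_outof_into (X Y : C) :
    ∑ g : G, ∑ h : G, outof (deg_comp X g) (prj X g) (prj Y h) ≫
      into (deg_comp X g) (inc X g) (inc Y h) = 𝟙 (tens G X Y) := by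
  rw [← sum_tp_ti]
  refine Finset.sum_congr rfl fun g _ => ?_
  simp only [outof, into, inc_prj, id_tensorHom, Category.assoc, ← whiskerLeft_comp_assoc,
    ← Functor.map_comp]
  rw [← Preadditive.comp_sum, ← Preadditive.sum_comp, ← whiskerLeft_sum,
    ← Functor.map_sum, sum_prj_inc]
  simp

/-- Additive induction on morphisms from a homogeneous object to `X ⊗^rev Y`. -/
lemma hom_induction {l : G} {V X Y : C} (hV : deg l V) {p : (V ⟶ tens G X Y) → Prop}
    (zero : p 0) (add : ∀ a b, p a → p b → p (a + b))
    (into : ∀ (g h : G), h * g = l → ∀ u : V ⟶ comp X g ⊗ (act g⁻¹).obj (comp Y h),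
      p (u ≫ into (deg_comp X g) (inc X g) (inc Y h))) (t : V ⟶ tens G X Y) : p t := by
  rw [← Category.comp_id t, ← sum_outof_into]
  simp only [Preadditive.comp_sum]
  refine Finset.sum_induction _ p add zero fun g _ =>
    Finset.sum_induction _ p add zero fun h _ => ?_
  by_cases e : h * g = l
  · rw [← Category.assoc]
    exact into g h e _
  · have hz : t ≫ outof (deg_comp X g) (prj X g) (prj Y h) = 0 :=
      IsBraidedCrossed.deg_orthogonal (Ne.symm e) hV
        (deg_tens rfl (deg_comp X g) (deg_comp Y h)) _
    rw [← Category.assoc, hz, zero_comp]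
    exact zero

lemma tens_ext₃ {X Y Z T : C} {f f' : tens G (tens G X Y) Z ⟶ T}
    (h : ∀ (g h l : G) (e : h * g = l),
      into (deg_tens e (deg_comp X g) (deg_comp Y h))
        (into (deg_comp X g) (inc X g) (inc Y h)) (𝟙 Z) ≫ f =
      into (deg_tens e (deg_comp X g) (deg_comp Y h))
        (into (deg_comp X g) (inc X g) (inc Y h)) (𝟙 Z) ≫ f') : f = f' := by
  refine tens_ext fun l => ?_
  refine hom_induction (deg_comp _ l) (p := fun t => into (deg_comp _ l) t (𝟙 Z) ≫ f =
    into (deg_comp _ l) t (𝟙 Z) ≫ f') ?_ ?_ ?_ _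
  · rw [into_zero, zero_comp, zero_comp]
  · intro a b ha hb
    rw [into_add, Preadditive.add_comp, Preadditive.add_comp, ha, hb]
  · intro a b e u
    rw [← whiskerRight_into (deg_tens e (deg_comp X a) (deg_comp Y b))]
    simp only [Category.assoc, h a b l e]

lemma tens_ext₄ {X Y Z U T : C} {f f' : tens G (tens G (tens G X Y) Z) U ⟶ T}
    (h : ∀ (g h k l m : G) (e : h * g = l) (e' : k * l = m),
      into (deg_tens e' (deg_tens e (deg_comp X g) (deg_comp Y h)) (deg_comp Z k))
        (into (deg_tens e (deg_comp X g) (deg_comp Y h))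
          (into (deg_comp X g) (inc X g) (inc Y h)) (inc Z k)) (𝟙 U) ≫ f =
      into (deg_tens e' (deg_tens e (deg_comp X g) (deg_comp Y h)) (deg_comp Z k))
        (into (deg_tens e (deg_comp X g) (deg_comp Y h))
          (into (deg_comp X g) (inc X g) (inc Y h)) (inc Z k)) (𝟙 U) ≫ f') : f = f' := by
  refine tens_ext₃ fun l k m e' => ?_
  refine hom_induction (deg_comp _ l)
    (p := fun t => into (deg_tens e' (deg_comp _ l) (deg_comp Z k))
      (into (deg_comp _ l) t (inc Z k)) (𝟙 U) ≫ f =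
      into (deg_tens e' (deg_comp _ l) (deg_comp Z k))
        (into (deg_comp _ l) t (inc Z k)) (𝟙 U) ≫ f') ?_ ?_ ?_ _
  · rw [into_zero, into_zero, zero_comp, zero_comp]
  · intro a b ha hb
    rw [into_add, into_add, Preadditive.add_comp, Preadditive.add_comp, ha, hb]
  · intro a b e u
    have hd := deg_tens e (deg_comp X a) (deg_comp Y b)
    rw [← whiskerRight_into hd, ← whiskerRight_into (deg_tens e' hd (deg_comp Z k))]
    simp only [Category.assoc, h a b k l m e e']

lemma tens_extR {X Y Z T : C} {f f' : tens G X (tens G Y Z) ⟶ T}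
    (h : ∀ g h : G, into (deg_comp X g) (inc X g) (into (deg_comp Y h) (inc Y h) (𝟙 Z)) ≫ f =
      into (deg_comp X g) (inc X g) (into (deg_comp Y h) (inc Y h) (𝟙 Z)) ≫ f') : f = f' := by
  refine tens_ext fun g => ?_
  have e : (comp X g) ◁ (act g⁻¹).map (𝟙 (tens G Y Z)) = 𝟙 _ := by simp
  rw [← Category.id_comp (into _ _ _ ≫ f), ← Category.id_comp (into _ _ _ ≫ f'), ← e,
    ← sum_tp_ti Y Z, Functor.map_sum, whiskerLeft_sum, Preadditive.sum_comp, Preadditive.sum_comp]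
  refine Finset.sum_congr rfl fun l _ => ?_
  have := h g l
  rw [into_inc] at this
  rw [sum_tp_ti, reassoc_of% whiskerLeft_into, reassoc_of% whiskerLeft_into, Category.comp_id,
    ← whiskerLeft_into, Category.assoc, Category.assoc, this]

variable (G) in
/-- The left unit constraint of `C^rev`. -/
noncomputable def leftU (X : C) : tens G (𝟙_ C) X ≅ X where
  hom := outof IsBraidedCrossed.deg_unit (𝟙 _) (𝟙 X) ≫ 𝟙_ C ◁ inv (ι inv_one X) ≫ (λ_ X).hom
  inv := (λ_ X).inv ≫ 𝟙_ C ◁ ι inv_one X ≫ into IsBraidedCrossed.deg_unit (𝟙 _) (𝟙 X)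
  hom_inv_id := tens_ext fun g => by
    obtain rfl | hne := eq_or_ne g 1
    · rw [Category.assoc, reassoc_of% into_outof]
      simp [whiskerRight_into _ (deg_comp (𝟙_ C) (1 : G))]
    · have hz : inc (𝟙_ C) g = 0 :=
        IsBraidedCrossed.deg_orthogonal hne (deg_comp _ g) IsBraidedCrossed.deg_unit _
      rw [hz, into_zero, zero_comp, zero_comp]
  inv_hom_id := by simp [reassoc_of% into_outof]

lemma into_leftU {g : G} (e : g = 1) {W V X : C} (hW : deg g W) (f : W ⟶ 𝟙_ C)
    (f' : V ⟶ X) :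
    into hW f f' ≫ (leftU G X).hom =
      W ◁ inv (ι (show g⁻¹ = 1 by simp [e]) V) ≫ f ▷ V ≫ (λ_ V).hom ≫ f' := by
  subst e
  rw [leftU]
  dsimp only
  rw [reassoc_of% into_outof]
  have := IsAction.ι_natural (inv_one (G := G)) f'
  have e : (act (1 : G)⁻¹).map f' ≫ inv (ι inv_one X) = inv (ι inv_one V) ≫ f' := by
    rw [IsIso.eq_inv_comp, ← reassoc_of% this, IsIso.hom_inv_id, Category.comp_id]
  rw [Category.comp_id, Category.comp_id, MonoidalCategory.tensorHom_def', Category.assoc,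
    whisker_exchange_assoc, ← whiskerLeft_comp_assoc, e, whiskerLeft_comp_assoc,
    whisker_exchange_assoc, leftUnitor_naturality]

variable (G) in
/-- The right unit constraint of `C^rev`. -/
noncomputable def rightHom (X : C) : tens G X (𝟙_ C) ⟶ X :=
  ∑ g : G, outof (deg_comp X g) (prj X g) (𝟙 _) ≫ comp X g ◁ inv (ε g⁻¹) ≫ (ρ_ _).hom ≫ inc X g

variable (G) in
/-- The inverse of `rightHom`. -/
noncomputable def rightInv (X : C) : X ⟶ tens G X (𝟙_ C) :=
  ∑ g : G, prj X g ≫ (ρ_ _).inv ≫ comp X g ◁ ε g⁻¹ ≫ into (deg_comp X g) (inc X g) (𝟙 _)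

lemma into_rightHom {g : G} {W X : C} (hW : deg g W) (f : W ⟶ X) :
    into hW f (𝟙 _) ≫ rightHom G X = W ◁ inv (ε g⁻¹) ≫ (ρ_ _).hom ≫ f := by
  rw [rightHom, Preadditive.comp_sum, Finset.sum_eq_single g]
  · rw [reassoc_of% into_outof]
    simp [← whisker_exchange_assoc, comp_prj_inc hW]
  · intro h _ hne
    rw [← Category.assoc, into_outof_ne _ _ hne.symm, zero_comp]
  · simp

lemma into_rightHom' {g : G} {W V X : C} (hW : deg g W) (f : W ⟶ X) (f' : V ⟶ 𝟙_ C) :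
    into hW f f' ≫ rightHom G X = W ◁ (act g⁻¹).map f' ≫ W ◁ inv (ε g⁻¹) ≫ (ρ_ _).hom ≫ f := by
  rw [← into_rightHom hW, reassoc_of% whiskerLeft_into, Category.comp_id]

lemma comp_rightInv {g : G} {W X : C} (hW : deg g W) (f : W ⟶ X) :
    f ≫ rightInv G X = (ρ_ _).inv ≫ W ◁ ε g⁻¹ ≫ into hW f (𝟙 _) := by
  rw [rightInv, Preadditive.comp_sum, Finset.sum_eq_single g]
  · rw [← Category.assoc, rightUnitor_inv_naturality_assoc, ← whisker_exchange_assoc,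
      whiskerRight_into (deg_comp X g) hW, Category.assoc, comp_prj_inc hW]
  · intro h _ hne
    rw [← Category.assoc, comp_prj_eq_zero hW f hne.symm, zero_comp]
  · simp

variable (G) in
/-- The right unit constraint of `C^rev`. -/
@[simps] noncomputable def rightU (X : C) : tens G X (𝟙_ C) ≅ X where
  hom := rightHom G X
  inv := rightInv G X
  hom_inv_id := tens_ext fun g => by
    rw [reassoc_of% into_rightHom, comp_rightInv (deg_comp X g)]
    simp
  inv_hom_id := map_component_ext (G := G) (𝟭 C) fun g => by
    change inc X g ≫ _ = inc X g ≫ _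
    rw [reassoc_of% (comp_rightInv (deg_comp X g)), into_rightHom]
    simp

variable (G) in
/-- The associativity constraint of `C^rev`. -/
@[simps] noncomputable def assoc (X Y Z : C) : tens G (tens G X Y) Z ≅ tens G X (tens G Y Z) where
  hom := assocHom X Y Z
  inv := assocInv X Y Z
  hom_inv_id := tens_ext₃ fun g h l e => by
    have hd := deg_tens e (deg_comp X g) (deg_comp Y h)
    rw [reassoc_of% (into_assocHom e (deg_comp X g) (deg_comp Y h) hd),
      into_assocInv e (deg_comp X g) (deg_comp Y h) hd, Iso.hom_inv_id_assoc, Category.comp_id]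
  inv_hom_id := tens_extR fun g h => by
    have hd := deg_tens rfl (deg_comp X g) (deg_comp Y h)
    rw [reassoc_of% (into_assocInv rfl (deg_comp X g) (deg_comp Y h) hd),
      into_assocHom rfl (deg_comp X g) (deg_comp Y h) hd, Iso.inv_hom_id_assoc, Category.comp_id]

variable (G) in
lemma tensMap_id (X Y : C) : tensMap G (𝟙 X) (𝟙 Y) = 𝟙 (tens G X Y) :=
  tens_ext fun g => by rw [into_tensMap, Category.comp_id, Category.comp_id, Category.comp_id]

variable (G) in
lemma tensMap_comp {X₁ Y₁ Z₁ X₂ Y₂ Z₂ : C} (f₁ : X₁ ⟶ Y₁) (f₂ : X₂ ⟶ Y₂) (g₁ : Y₁ ⟶ Z₁)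
    (g₂ : Y₂ ⟶ Z₂) : tensMap G f₁ f₂ ≫ tensMap G g₁ g₂ = tensMap G (f₁ ≫ g₁) (f₂ ≫ g₂) :=
  tens_ext fun g => by
    rw [reassoc_of% into_tensMap, into_tensMap, into_tensMap, Category.assoc, Category.assoc]

variable (G) in
lemma assocHom_naturality {X₁ X₂ X₃ Y₁ Y₂ Y₃ : C} (f₁ : X₁ ⟶ Y₁) (f₂ : X₂ ⟶ Y₂)
    (f₃ : X₃ ⟶ Y₃) : tensMap G (tensMap G f₁ f₂) f₃ ≫ assocHom Y₁ Y₂ Y₃ =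
      assocHom X₁ X₂ X₃ ≫ tensMap G f₁ (tensMap G f₂ f₃) :=
  tens_ext₃ fun g h l e => by
    have hd := deg_tens e (deg_comp X₁ g) (deg_comp X₂ h)
    rw [reassoc_of% into_tensMap, into_tensMap, into_assocHom e (deg_comp X₁ g) (deg_comp X₂ h) hd,
      reassoc_of% (into_assocHom e (deg_comp X₁ g) (deg_comp X₂ h) hd), into_tensMap, into_tensMap]

variable (G) in
lemma leftU_naturality {X Y : C} (f : X ⟶ Y) :
    tensMap G (𝟙 (𝟙_ C)) f ≫ (leftU G Y).hom = (leftU G X).hom ≫ f :=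
  tens_ext fun g => by
    obtain rfl | hne := eq_or_ne g 1
    · rw [reassoc_of% into_tensMap, into_leftU rfl, reassoc_of% (into_leftU (G := G) rfl)]
      simp
    · have hz : inc (𝟙_ C) g = 0 :=
        IsBraidedCrossed.deg_orthogonal hne (deg_comp _ g) IsBraidedCrossed.deg_unit _
      rw [hz, into_zero, zero_comp, zero_comp]

variable (G) in
lemma rightHom_naturality {X Y : C} (f : X ⟶ Y) :
    tensMap G f (𝟙 (𝟙_ C)) ≫ rightHom G Y = rightHom G X ≫ f :=
  tens_ext fun g => by
    rw [reassoc_of% into_tensMap, Category.comp_id, into_rightHom, reassoc_of% into_rightHom]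

variable (G) in
lemma rev_triangle (X Y : C) :
    assocHom X (𝟙_ C) Y ≫ tensMap G (𝟙 X) (leftU G Y).hom = tensMap G (rightHom G X) (𝟙 Y) :=
  tens_ext₃ fun g h l e => by
    have hd := deg_tens e (deg_comp X g) (deg_comp (𝟙_ C) h)
    obtain rfl | hne := eq_or_ne h 1
    · obtain rfl : g = l := by simpa using e
      rw [reassoc_of% (into_assocHom e (deg_comp X g) (deg_comp (𝟙_ C) 1) hd), into_tensMap,
        into_tensMap, into_leftU rfl]
      have e₁ := into_rightHom' (deg_comp X g) (inc X g) (inc (𝟙_ C) (1 : G))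
      rw [e₁]
      have e₄ := whiskerLeft_into (deg_comp X g) (comp (𝟙_ C) (1 : G) ◁
        inv (ι (inv_one (G := G)) Y) ≫ inc (𝟙_ C) (1 : G) ▷ Y ≫ (λ_ Y).hom) (inc X g) (𝟙 Y)
      simp only [Category.comp_id] at e₄ ⊢
      rw [← e₄]
      have e₂ := whiskerRight_into (Y := Y) (deg_comp X g) hd (comp X g ◁ (act g⁻¹).map
        (inc (𝟙_ C) (1 : G)) ≫ comp X g ◁ inv (ε g⁻¹) ≫ (ρ_ _).hom) (inc X g) (𝟙 Y)
      simp only [Category.assoc] at e₂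
      rw [← e₂, ← Category.assoc]
      congr 1
      rw [comp_whiskerRight, ← assocCore_triangle e]
      have e₃ := assocCore_natural e (𝟙 (comp X g)) (inc (𝟙_ C) (1 : G)) (𝟙 Y)
      simp only [CategoryTheory.Functor.map_id, id_tensorHom, tensorHom_id] at e₃
      rw [reassoc_of% e₃, ← whiskerLeft_comp, ← Functor.map_comp, whisker_exchange_assoc]
    · have hz : inc (𝟙_ C) h = 0 :=
        IsBraidedCrossed.deg_orthogonal hne (deg_comp _ h) IsBraidedCrossed.deg_unit _
      have hz' : into (deg_comp X g) (inc X g) (0 : comp (𝟙_ C) h ⟶ 𝟙_ C) = 0 := by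
        simp [into]
      rw [hz, hz', into_zero, zero_comp, zero_comp]

variable (G) in
lemma rev_pentagon (W X Y Z : C) :
    tensMap G (assocHom W X Y) (𝟙 Z) ≫ assocHom W (tens G X Y) Z ≫
        tensMap G (𝟙 W) (assocHom X Y Z) =
      assocHom (tens G W X) Y Z ≫ assocHom W X (tens G Y Z) :=
  tens_ext₄ fun g h k l m e e' => by
    have hW := deg_comp W g
    have hX := deg_comp X h
    have hY := deg_comp Y k
    have h₁ := deg_tens e hW hX
    have h₂ := deg_tens e' h₁ hY
    have h₃ := deg_tens rfl hX hY
    have f : k * h * g = m := by rw [mul_assoc, e, e']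
    have h₄ := deg_tens f hW h₃
    rw [reassoc_of% into_tensMap, into_assocHom e hW hX h₁, ← whiskerRight_into h₄ h₂,
      Category.assoc, reassoc_of% (into_assocHom f hW h₃ h₄), into_tensMap, Category.comp_id,
      into_assocHom rfl hX hY h₃, reassoc_of% (into_assocHom e' h₁ hY h₂),
      into_assocHom e hW hX h₁]
    rw [← whiskerLeft_into, reassoc_of% (assocCore_pentagon e rfl e' f), Category.comp_id]

end Monoidal

section Instances

variable {G : Type*} [Group G] [Fintype G] {C : Type*} [Category C] [Preadditive C]
  [HasFiniteBiproducts C] [MonoidalCategory C] [MonoidalPreadditive C] [CrossedData G C]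
  [IsBraidedCrossed G C]

noncomputable instance : MonoidalCategoryStruct (Rev G C) where
  tensorObj X Y := tens G (C := C) X Y
  tensorUnit := 𝟙_ C
  tensorHom f f' := tensMap G (C := C) f f'
  whiskerLeft X _ _ f := tensMap G (C := C) (𝟙 X) f
  whiskerRight f X := tensMap G (C := C) f (𝟙 X)
  associator X Y Z := assoc G (C := C) X Y Z
  leftUnitor X := leftU G (C := C) X
  rightUnitor X := rightU G (C := C) X

noncomputable instance : MonoidalCategory (Rev G C) :=
  MonoidalCategory.ofTensorHom
    (id_tensorHom_id := tensMap_id G (C := C))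
    (id_tensorHom := fun _ _ _ _ => rfl)
    (tensorHom_id := fun _ _ => rfl)
    (tensorHom_comp_tensorHom := tensMap_comp G (C := C))
    (associator_naturality := assocHom_naturality G (C := C))
    (leftUnitor_naturality := leftU_naturality G (C := C))
    (rightUnitor_naturality := rightHom_naturality G (C := C))
    (pentagon := rev_pentagon G (C := C))
    (triangle := rev_triangle G (C := C))

end Instances
end Rev
end GCrossed

namespace GCrossed
open CrossedData
namespace Rev
section Crossed

variable {G : Type*} [Group G] [Fintype G] {C : Type*} [Category C] [Preadditive C]
  [HasFiniteBiproducts C] [MonoidalCategory C] [MonoidalPreadditive C] [CrossedData G C]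
  [IsBraidedCrossed G C]

/-- The tensor structure `k(X) ⊗^rev k(Y) ⟶ k(X ⊗^rev Y)` of the action on `C^rev`; on the
summand `X_g` it is
`k(X_g) ⊗ (kgk⁻¹)⁻¹(k(Y)) ≅ k(X_g) ⊗ k(g⁻¹(Y)) ⟶ k(X_g ⊗ g⁻¹(Y))`. -/
noncomputable def actμ (k : G) (X Y : C) :
    tens G ((act k).obj X) ((act k).obj Y) ⟶ (act k).obj (tens G X Y) :=
  ∑ g : G, outof (IsBraidedCrossed.deg_act k (deg_comp X g)) ((act k).map (prj X g)) (𝟙 _) ≫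
    (act k).obj (comp X g) ◁ (γ (show (k * g * k⁻¹)⁻¹ * k = k * g⁻¹ by group) Y ≫
      inv (γ (rfl : k * g⁻¹ = k * g⁻¹) Y)) ≫
    μ k (comp X g) ((act g⁻¹).obj Y) ≫ (act k).map (ti X Y g)

/-- The crossed braiding of `C^rev` for `X` in `C_a`: on the summand `Y_h` it is the inverse of
the crossed braiding
`c : a⁻¹(Y_h) ⊗ m⁻¹(X) ⟶ m(m⁻¹(X)) ⊗ a⁻¹(Y_h) ≅ X ⊗ a⁻¹(Y_h)`, where `m = a⁻¹ha` is
the degree of `a⁻¹(Y_h)`. -/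
noncomputable def crossed {a : G} {X : C} (hX : deg a X) (Y : C) :
    tens G X Y ⟶ tens G ((act a⁻¹).obj Y) X :=
  outof hX (𝟙 X) (𝟙 Y) ≫ ∑ h : G, X ◁ (act a⁻¹).map (prj Y h) ≫
    (ι rfl X ≫ inv (γ (mul_inv_cancel (a⁻¹ * h * a⁻¹⁻¹)) X)) ▷ (act a⁻¹).obj (comp Y h) ≫
    inv (cb (IsBraidedCrossed.deg_act a⁻¹ (deg_comp Y h))
      ((act (a⁻¹ * h * a⁻¹⁻¹)⁻¹).obj X)) ≫
    into (IsBraidedCrossed.deg_act a⁻¹ (deg_comp Y h)) ((act a⁻¹).map (inc Y h)) (𝟙 X)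

/-- The structure of `C^rev`: the action of `G` on `C^rev` is that of `C`,
`(C^rev)_g = C_{g⁻¹}`, and the crossed braiding is `crossed`. -/
noncomputable instance : CrossedData G (Rev G C) where
  act g := (act g : C ⥤ C)
  μ k X Y := actμ (C := C) k X Y
  ε g := (ε g : 𝟙_ C ⟶ (act g).obj (𝟙_ C))
  γ e X := γ (C := C) e X
  ι e X := ι (C := C) e X
  deg g := (deg g⁻¹ : ObjectProperty C)
  cb {g X} hX Y := crossed (C := C) hX Y ≫
    tensMap G (C := C) (eqToHom (by rw [inv_inv])) (𝟙 (X : C))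

end Crossed
end Rev
end GCrossed

namespace GCrossed
open CrossedData

section BimodMonoidal

variable {B : Type*} [Category B] [MonoidalCategory B] [HasCoequalizers B]
  [∀ X : B, PreservesColimitsOfSize.{0, 0} (tensorLeft X)]
  [∀ X : B, PreservesColimitsOfSize.{0, 0} (tensorRight X)] (A : Mon B)

/-- The monoidal category of `A`-bimodules, with tensor product `⊗_A`. -/
noncomputable instance : MonoidalCategoryStruct (Bimod A A) where
  tensorObj M N := M.tensorBimod N
  tensorUnit := Bimod.regular A
  whiskerLeft M _ _ f := Bimod.whiskerLeft M f
  whiskerRight f N := Bimod.whiskerRight f N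
  associator := Bimod.associatorBimod
  leftUnitor := Bimod.leftUnitorBimod
  rightUnitor := Bimod.rightUnitorBimod

noncomputable instance : MonoidalCategory (Bimod A A) where
  tensorHom_def _ _ := rfl
  id_tensorHom_id _ _ := by
    change Bimod.whiskerRight _ _ ≫ Bimod.whiskerLeft _ _ = _
    rw [Bimod.whiskerLeft_id_bimod, Bimod.id_whiskerRight_bimod, Category.comp_id]
    rfl
  tensorHom_comp_tensorHom f₁ f₂ g₁ g₂ := by
    change (Bimod.whiskerRight _ _ ≫ Bimod.whiskerLeft _ _) ≫
      Bimod.whiskerRight _ _ ≫ Bimod.whiskerLeft _ _ =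
      Bimod.whiskerRight _ _ ≫ Bimod.whiskerLeft _ _
    rw [Bimod.comp_whiskerRight_bimod, Bimod.whiskerLeft_comp_bimod, Category.assoc,
      ← Category.assoc (Bimod.whiskerLeft _ f₂), Bimod.whisker_exchange_bimod]
    simp only [Category.assoc]
  whiskerLeft_id _ _ := Bimod.whiskerLeft_id_bimod
  id_whiskerRight _ _ := Bimod.id_whiskerRight_bimod
  associator_naturality {_ X₂ X₃ Y₁ Y₂ _} f₁ f₂ f₃ := by
    have e₁ : Bimod.whiskerRight (Bimod.whiskerRight f₁ X₂) X₃ ≫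
        (Bimod.associatorBimod Y₁ X₂ X₃).hom = (Bimod.associatorBimod _ _ _).hom ≫
        Bimod.whiskerRight f₁ (X₂.tensorBimod X₃) := by
      rw [Bimod.whiskerRight_comp_bimod, Iso.hom_inv_id_assoc]
    have e₂ : Bimod.whiskerRight (Bimod.whiskerLeft Y₁ f₂) X₃ ≫
        (Bimod.associatorBimod Y₁ Y₂ X₃).hom = (Bimod.associatorBimod _ _ _).hom ≫
        Bimod.whiskerLeft Y₁ (Bimod.whiskerRight f₂ X₃) := by
      rw [Bimod.whisker_assoc_bimod, Category.assoc, Category.assoc, Iso.inv_hom_id,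
        Category.comp_id]
    have e₃ : Bimod.whiskerLeft (Y₁.tensorBimod Y₂) f₃ ≫
        (Bimod.associatorBimod Y₁ Y₂ _).hom = (Bimod.associatorBimod _ _ _).hom ≫
        Bimod.whiskerLeft Y₁ (Bimod.whiskerLeft Y₂ f₃) := by
      rw [Bimod.comp_whiskerLeft_bimod, Category.assoc, Category.assoc, Iso.inv_hom_id,
        Category.comp_id]
    change (Bimod.whiskerRight (Bimod.whiskerRight f₁ X₂ ≫ Bimod.whiskerLeft Y₁ f₂) X₃ ≫
      Bimod.whiskerLeft (Y₁.tensorBimod Y₂) f₃) ≫ _ = _ ≫ Bimod.whiskerRight f₁ _ ≫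
      Bimod.whiskerLeft Y₁ (Bimod.whiskerRight f₂ X₃ ≫ Bimod.whiskerLeft Y₂ f₃)
    change _ ≫ (Bimod.associatorBimod Y₁ Y₂ _).hom = (Bimod.associatorBimod _ _ _).hom ≫ _
    rw [Bimod.comp_whiskerRight_bimod, Bimod.whiskerLeft_comp_bimod, Category.assoc,
      Category.assoc, e₃, reassoc_of% e₂, reassoc_of% e₁]
  leftUnitor_naturality f := by
    have := Bimod.id_whiskerLeft_bimod f
    change Bimod.whiskerLeft _ f ≫ (Bimod.leftUnitorBimod _).hom =
      (Bimod.leftUnitorBimod _).hom ≫ f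
    rw [this]
    simp
  rightUnitor_naturality f := by
    have := Bimod.whiskerRight_id_bimod f
    change Bimod.whiskerRight f _ ≫ (Bimod.rightUnitorBimod _).hom =
      (Bimod.rightUnitorBimod _).hom ≫ f
    rw [this]
    simp
  pentagon := Bimod.pentagon_bimod
  triangle := Bimod.triangle_bimod

end BimodMonoidal

section BimodLinear

variable {B : Type*} [Category B] [Preadditive B] [MonoidalCategory B] [MonoidalPreadditive B]
  {A : Mon B}

section
variable (X : B) {Y Z : B} (f f' : Y ⟶ Z) (n : ℕ) (m : ℤ)
lemma whiskerLeft_neg : X ◁ (-f) = -(X ◁ f) := (tensorLeft X).map_neg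
lemma neg_whiskerRight : (-f) ▷ X = -(f ▷ X) := (tensorRight X).map_neg
lemma whiskerLeft_sub : X ◁ (f - f') = X ◁ f - X ◁ f' := (tensorLeft X).map_sub
lemma sub_whiskerRight : (f - f') ▷ X = f ▷ X - f' ▷ X := (tensorRight X).map_sub
lemma whiskerLeft_nsmul : X ◁ (n • f) = n • X ◁ f := (tensorLeft X).map_nsmul
lemma nsmul_whiskerRight : (n • f) ▷ X = n • f ▷ X := (tensorRight X).map_nsmul
lemma whiskerLeft_zsmul : X ◁ (m • f) = m • X ◁ f := (tensorLeft X).map_zsmul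
lemma zsmul_whiskerRight : (m • f) ▷ X = m • f ▷ X := (tensorRight X).map_zsmul
end

variable (M N : Bimod A A)

instance : Add (M ⟶ N) := ⟨fun f f' => ⟨f.hom + f'.hom, by simp, by simp⟩⟩
instance : Zero (M ⟶ N) := ⟨⟨0, by simp, by simp⟩⟩
instance : Neg (M ⟶ N) := ⟨fun f => ⟨-f.hom, by simp [whiskerLeft_neg], by simp [neg_whiskerRight]⟩⟩
instance : Sub (M ⟶ N) := ⟨fun f f' =>
  ⟨f.hom - f'.hom, by simp [whiskerLeft_sub], by simp [sub_whiskerRight]⟩⟩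
instance : SMul ℕ (M ⟶ N) := ⟨fun n f =>
  ⟨n • f.hom, by simp [whiskerLeft_nsmul], by simp [nsmul_whiskerRight]⟩⟩
instance : SMul ℤ (M ⟶ N) := ⟨fun n f =>
  ⟨n • f.hom, by simp [whiskerLeft_zsmul], by simp [zsmul_whiskerRight]⟩⟩

lemma bimod_hom_injective : Function.Injective (fun f : M ⟶ N => f.hom) :=
  fun _ _ h => Bimod.Hom.ext h

instance : AddCommGroup (M ⟶ N) :=
  (bimod_hom_injective M N).addCommGroup _ rfl (fun _ _ => rfl) (fun _ => rfl) (fun _ _ => rfl)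
    (fun _ _ => rfl) (fun _ _ => rfl)

instance : Preadditive (Bimod A A) where
  add_comp _ _ _ f f' g := by
    apply Bimod.hom_ext
    change (f.hom + f'.hom) ≫ g.hom = f.hom ≫ g.hom + f'.hom ≫ g.hom
    exact Preadditive.add_comp _ _ _ f.hom f'.hom g.hom
  comp_add _ _ _ f g g' := by
    apply Bimod.hom_ext
    change f.hom ≫ (g.hom + g'.hom) = f.hom ≫ g.hom + f.hom ≫ g'.hom
    exact Preadditive.comp_add _ _ _ f.hom g.hom g'.hom

variable {k : Type*} [Field k] [Linear k B] [MonoidalLinear k B]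

instance : SMul k (M ⟶ N) := ⟨fun n f => ⟨n • f.hom, by simp, by simp⟩⟩

instance : Module k (M ⟶ N) :=
  (bimod_hom_injective M N).module k ⟨⟨fun f : M ⟶ N => f.hom, rfl⟩, fun _ _ => rfl⟩
    (fun _ _ => rfl)

instance : Linear k (Bimod A A) where
  smul_comp _ _ _ r f g := by
    apply Bimod.hom_ext
    change (r • f.hom) ≫ g.hom = r • f.hom ≫ g.hom
    exact Linear.smul_comp _ _ _ r f.hom g.hom
  comp_smul _ _ _ f r g := by
    apply Bimod.hom_ext
    change f.hom ≫ (r • g.hom) = r • f.hom ≫ g.hom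
    exact Linear.comp_smul _ _ _ f.hom r g.hom

end BimodLinear

section TensorOver

variable {B : Type*} [Category B] [MonoidalCategory B] [HasCoequalizers B] {A : Mon B}
  (M N : Bimod A A)

/-- The projection `M ⊗ N ⟶ M ⊗_A N`. -/
noncomputable def tπ : M.X ⊗ N.X ⟶ Bimod.TensorBimod.X M N :=
  coequalizer.π (M.actRight ▷ N.X) ((α_ _ _ _).hom ≫ (M.X ◁ N.actLeft))

lemma tπ_condition : M.actRight ▷ N.X ≫ tπ M N = (α_ _ _ _).hom ≫ M.X ◁ N.actLeft ≫ tπ M N := by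
  exact (coequalizer.condition (M.actRight ▷ N.X) ((α_ _ _ _).hom ≫ (M.X ◁ N.actLeft))).trans
    (Category.assoc _ _ _)

variable {M N} in
lemma tπ_ext {T : B} {f f' : Bimod.TensorBimod.X M N ⟶ T} (h : tπ M N ≫ f = tπ M N ≫ f') :
    f = f' :=
  coequalizer.hom_ext h

variable {M N} in
/-- The morphism out of `M ⊗_A N` induced by an `A`-balanced morphism out of `M ⊗ N`. -/
noncomputable def tdesc {T : B} (f : M.X ⊗ N.X ⟶ T)
    (h : M.actRight ▷ N.X ≫ f = (α_ _ _ _).hom ≫ M.X ◁ N.actLeft ≫ f) :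
    Bimod.TensorBimod.X M N ⟶ T :=
  coequalizer.desc f (by rw [h, Category.assoc])

@[simp] lemma tπ_tdesc {T : B} (f : M.X ⊗ N.X ⟶ T)
    (h : M.actRight ▷ N.X ≫ f = (α_ _ _ _).hom ≫ M.X ◁ N.actLeft ≫ f) :
    tπ M N ≫ tdesc f h = f :=
  coequalizer.π_desc _ _

variable [∀ X : B, PreservesColimitsOfSize.{0, 0} (tensorLeft X)]
  [∀ X : B, PreservesColimitsOfSize.{0, 0} (tensorRight X)]

lemma tπ_actLeft : A.X ◁ tπ M N ≫ Bimod.TensorBimod.actLeft M N =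
    (α_ _ _ _).inv ≫ M.actLeft ▷ N.X ≫ tπ M N :=
  Bimod.TensorBimod.whiskerLeft_π_actLeft M N

lemma tπ_actRight : tπ M N ▷ A.X ≫ Bimod.TensorBimod.actRight M N =
    (α_ _ _ _).hom ≫ M.X ◁ N.actRight ≫ tπ M N :=
  Bimod.TensorBimod.π_tensor_id_actRight M N

variable {M N} in
lemma left_tπ_ext {X T : B} {f f' : X ⊗ Bimod.TensorBimod.X M N ⟶ T}
    (h : X ◁ tπ M N ≫ f = X ◁ tπ M N ≫ f') : f = f' :=
  (cancel_epi ((tensorLeft X).map (coequalizer.π _ _))).1 h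

variable {M N} in
lemma right_tπ_ext {X T : B} {f f' : Bimod.TensorBimod.X M N ⊗ X ⟶ T}
    (h : tπ M N ▷ X ≫ f = tπ M N ▷ X ≫ f') : f = f' :=
  (cancel_epi ((tensorRight X).map (coequalizer.π _ _))).1 h

end TensorOver

section DeEquivariantization

variable {B : Type*} [Category B] [MonoidalCategory B] [BraidedCategory B]

/-- Modules over a commutative algebra `A` in a braided category, viewed as the
`A`-bimodules `M` whose right action is `M ⊗ A ≅ A ⊗ M ⟶ M`, the isomorphism being the
inverse of the braiding of `A` and `M`. -/
def IsModule (A : Mon B) : ObjectProperty (Bimod A A) := fun M =>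
  M.actRight = (β_ A.X M.X).inv ≫ M.actLeft

variable (G : Type*) [Group G] (B)

/-- A commutative algebra `A` in a braided category with an action `t` of the group `G`,
`t_{gh} = t_h ∘ t_g`, by algebra automorphisms (for functions on `G`, the action by right
translations). -/
structure GAlgebra where
  A : Mon B
  comm : (β_ A.X A.X).hom ≫ MonObj.mul = MonObj.mul (X := A.X)
  t : G → (A ⟶ A)
  t_one : t 1 = 𝟙 A
  t_mul : ∀ g h : G, t (g * h) = t g ≫ t h

variable {G B} (R : GAlgebra B G)

/-- The de-equivariantization as a category: the category of `A`-modules in `B`. -/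
abbrev DeEquiv : Type _ := (IsModule R.A).FullSubcategory

namespace DeEquiv

variable {R}

/-- The underlying object of an `A`-module. -/
abbrev X (M : DeEquiv R) : B := M.obj.X

/-- The action `A ⊗ M ⟶ M`. -/
abbrev actL (M : DeEquiv R) : R.A.X ⊗ M.X ⟶ M.X := M.obj.actLeft

/-- The action `M ⊗ A ⟶ M`. -/
abbrev actR (M : DeEquiv R) : M.X ⊗ R.A.X ⟶ M.X := M.obj.actRight

/-- A morphism of `A`-modules. -/
def ofLeft {M N : DeEquiv R} (f : M.X ⟶ N.X) (h : M.actL ≫ f = (R.A.X ◁ f) ≫ N.actL) : M ⟶ N :=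
  ObjectProperty.homMk
    { hom := f
      left_act_hom := h
      right_act_hom := by
        rw [M.property, N.property, Category.assoc, h]
        simp }

end DeEquiv

section Monoidal

variable [HasCoequalizers B]
  [∀ X : B, PreservesColimitsOfSize.{0, 0} (tensorLeft X)]
  [∀ X : B, PreservesColimitsOfSize.{0, 0} (tensorRight X)]

instance : (IsModule R.A).IsMonoidal where
  prop_unit := by
    change MonObj.mul = (β_ R.A.X R.A.X).inv ≫ MonObj.mul
    rw [Iso.eq_inv_comp, R.comm]
  prop_tensor M N hM hN := by
    change Bimod.TensorBimod.actRight M N = (β_ R.A.X (Bimod.TensorBimod.X M N)).inv ≫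
      Bimod.TensorBimod.actLeft M N
    rw [IsModule] at hM hN
    have c := tπ_condition M N
    refine right_tπ_ext ?_
    rw [hM] at c
    rw [tπ_actRight, BraidedCategory.braiding_inv_naturality_left_assoc, tπ_actLeft,
      BraidedCategory.braiding_tensor_right_inv, hN, whiskerLeft_comp]
    simp only [comp_whiskerRight, Category.assoc, Iso.hom_inv_id_assoc] at c ⊢
    rw [c]
    simp

namespace DeEquiv

section Twist

variable {A : Mon B} (s : A ⟶ A) (M N : Bimod A A)

/-- The bimodule `M` with the actions of `A` composed with an endomorphism of `A`. -/
abbrev twistBimod : Bimod A A where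
  X := M.X
  actLeft := s.hom ▷ M.X ≫ M.actLeft
  one_actLeft := by
    rw [← comp_whiskerRight_assoc, IsMonHom.one_hom, Bimod.one_actLeft]
  left_assoc := by
    rw [← comp_whiskerRight_assoc, IsMonHom.mul_hom, MonoidalCategory.tensorHom_def,
      comp_whiskerRight_assoc, comp_whiskerRight_assoc, M.left_assoc]
    simp only [whiskerLeft_comp, Category.assoc, whisker_assoc, Iso.inv_hom_id_assoc,
      associator_naturality_left_assoc]
    rw [← whisker_exchange_assoc, ← whisker_exchange_assoc]
  actRight := M.X ◁ s.hom ≫ M.actRight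
  actRight_one := by
    rw [← whiskerLeft_comp_assoc, IsMonHom.one_hom, Bimod.actRight_one]
  right_assoc := by
    rw [← whiskerLeft_comp_assoc, IsMonHom.mul_hom, MonoidalCategory.tensorHom_def',
      whiskerLeft_comp_assoc, whiskerLeft_comp_assoc, M.right_assoc]
    simp only [comp_whiskerRight, Category.assoc, associator_inv_naturality_middle_assoc,
      associator_inv_naturality_right_assoc, whisker_exchange_assoc]
  middle_assoc := by
    simp only [comp_whiskerRight, Category.assoc, whiskerLeft_comp, whisker_exchange_assoc]
    rw [← associator_naturality_left_assoc, ← whisker_exchange_assoc, M.middle_assoc,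
      associator_naturality_right_assoc]

variable {M N} in
/-- The twist of a morphism of bimodules. -/
def twistMap (f : M ⟶ N) : twistBimod s M ⟶ twistBimod s N where
  hom := f.hom
  left_act_hom := by
    change (s.hom ▷ M.X ≫ M.actLeft) ≫ f.hom = A.X ◁ f.hom ≫ s.hom ▷ N.X ≫ N.actLeft
    rw [Category.assoc, Bimod.Hom.left_act_hom, whisker_exchange_assoc]
  right_act_hom := by
    change (M.X ◁ s.hom ≫ M.actRight) ≫ f.hom = f.hom ▷ A.X ≫ N.X ◁ s.hom ≫ N.actRight
    rw [Category.assoc, Bimod.Hom.right_act_hom, whisker_exchange_assoc]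

lemma twist_balanced : (M.X ◁ s.hom ≫ M.actRight) ▷ N.X ≫ tπ M N =
    (α_ _ _ _).hom ≫ M.X ◁ (s.hom ▷ N.X ≫ N.actLeft) ≫ tπ M N := by
  have := tπ_condition M N
  simp [this]

/-- The morphism `s(M) ⊗_A s(N) ⟶ s(M ⊗_A N)` induced by the identity of `M ⊗ N`. -/
noncomputable def tensorTwist :
    Bimod.TensorBimod.X (twistBimod s M) (twistBimod s N) ⟶ Bimod.TensorBimod.X M N :=
  tdesc (M := twistBimod s M) (N := twistBimod s N) (tπ M N) (twist_balanced s M N)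

lemma tπ_tensorTwist : tπ (twistBimod s M) (twistBimod s N) ≫ tensorTwist s M N = tπ M N :=
  tπ_tdesc (twistBimod s M) (twistBimod s N) _ (twist_balanced s M N)

lemma tensorTwist_linear :
    Bimod.TensorBimod.actLeft (twistBimod s M) (twistBimod s N) ≫ tensorTwist s M N =
      A.X ◁ tensorTwist s M N ≫ s.hom ▷ _ ≫ Bimod.TensorBimod.actLeft M N := by
  refine left_tπ_ext ?_
  have e := tπ_actLeft (twistBimod s M) (twistBimod s N)
  rw [reassoc_of% e, tπ_tensorTwist, ← whiskerLeft_comp_assoc, tπ_tensorTwist,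
    whisker_exchange_assoc, tπ_actLeft]
  simp

lemma mul_twist : MonObj.mul ≫ s.hom = A.X ◁ s.hom ≫ s.hom ▷ A.X ≫ MonObj.mul := by
  rw [IsMonHom.mul_hom, MonoidalCategory.tensorHom_def', Category.assoc]

lemma twist_comp {s s' s'' : A ⟶ A} (h : s'' = s ≫ s') :
    (s.hom ▷ M.X ≫ s'.hom ▷ M.X ≫ M.actLeft) ≫ 𝟙 M.X =
      A.X ◁ 𝟙 M.X ≫ s''.hom ▷ M.X ≫ M.actLeft := by
  rw [h]
  simp

lemma twist_id {s : A ⟶ A} (h : s = 𝟙 A) :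
    M.actLeft ≫ 𝟙 M.X = A.X ◁ 𝟙 M.X ≫ s.hom ▷ M.X ≫ M.actLeft := by
  rw [h]
  simp

variable {M N}

/-- If `M` is of degree `s` then the braiding `M ⊗ N ⟶ s(N) ⊗ M` is `A`-balanced. -/
lemma braiding_balanced (hM : IsModule A M) (hN : IsModule A N) {s' : A ⟶ A} (hs : s' ≫ s = 𝟙 A)
    (h : (β_ M.X A.X).hom ≫ M.actLeft = M.X ◁ s.hom ≫ (β_ A.X M.X).inv ≫ M.actLeft) :
    M.actRight ▷ N.X ≫ (β_ M.X N.X).hom ≫ tπ (twistBimod s N) M =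
      (α_ _ _ _).hom ≫ M.X ◁ N.actLeft ≫ (β_ M.X N.X).hom ≫ tπ (twistBimod s N) M := by
  have hs' : s'.hom ≫ s.hom = 𝟙 A.X := by rw [← Mon.comp_hom', hs]; rfl
  rw [IsModule] at hM hN
  have hN' : N.actLeft = (β_ A.X N.X).hom ≫ N.actRight := by rw [hN, Iso.hom_inv_id_assoc]
  have hM' : M.actRight = (β_ M.X A.X).hom ≫ s'.hom ▷ M.X ≫ M.actLeft := by
    rw [← BraidedCategory.braiding_naturality_right_assoc, h, ← hM, ← whiskerLeft_comp_assoc, hs',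
      whiskerLeft_id, Category.id_comp]
  have c : N.X ◁ M.actLeft ≫ tπ (twistBimod s N) M = (α_ _ _ _).inv ≫
      (N.X ◁ s.hom) ▷ M.X ≫ N.actRight ▷ M.X ≫ tπ (twistBimod s N) M := by
    rw [Iso.eq_inv_comp, ← comp_whiskerRight_assoc]
    exact (tπ_condition (twistBimod s N) M).symm
  have e : N.X ◁ s'.hom ▷ M.X ≫ N.X ◁ s.hom ▷ M.X = 𝟙 _ := by
    rw [← whiskerLeft_comp, ← comp_whiskerRight, hs', id_whiskerRight, whiskerLeft_id]
  rw [BraidedCategory.braiding_naturality_left_assoc, hM', hN', whiskerLeft_comp_assoc,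
    whiskerLeft_comp_assoc, c, ← associator_inv_naturality_middle_assoc, reassoc_of% e,
    whiskerLeft_comp_assoc, BraidedCategory.braiding_naturality_right_assoc,
    BraidedCategory.braiding_tensor_left_hom, BraidedCategory.braiding_tensor_right_hom]
  simp

lemma braiding_linear (hN : IsModule A N) :
    M.actLeft ▷ N.X ≫ (β_ M.X N.X).hom ≫ tπ (twistBimod s N) M =
      (α_ _ _ _).hom ≫ A.X ◁ (β_ M.X N.X).hom ≫ (α_ _ _ _).inv ≫
        (s.hom ▷ N.X ≫ N.actLeft) ▷ M.X ≫ tπ (twistBimod s N) M := by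
  rw [IsModule] at hN
  have hN' : N.actLeft = (β_ A.X N.X).hom ≫ N.actRight := by rw [hN, Iso.hom_inv_id_assoc]
  have c : N.X ◁ M.actLeft ≫ tπ (twistBimod s N) M = (α_ _ _ _).inv ≫
      (N.X ◁ s.hom) ▷ M.X ≫ N.actRight ▷ M.X ≫ tπ (twistBimod s N) M := by
    rw [Iso.eq_inv_comp, ← comp_whiskerRight_assoc]
    exact (tπ_condition (twistBimod s N) M).symm
  rw [BraidedCategory.braiding_naturality_left_assoc, c, hN',
    BraidedCategory.braiding_naturality_left_assoc, BraidedCategory.braiding_tensor_left_hom]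
  simp

/-- The morphism `M ⊗_A N ⟶ s(N) ⊗_A M` induced by the braiding, for `M` of degree `s`. -/
noncomputable def tensorBraiding (hM : IsModule A M) (hN : IsModule A N) {s' : A ⟶ A}
    (hs : s' ≫ s = 𝟙 A)
    (h : (β_ M.X A.X).hom ≫ M.actLeft = M.X ◁ s.hom ≫ (β_ A.X M.X).inv ≫ M.actLeft) :
    Bimod.TensorBimod.X M N ⟶ Bimod.TensorBimod.X (twistBimod s N) M :=
  tdesc ((β_ M.X N.X).hom ≫ tπ (twistBimod s N) M) (braiding_balanced s hM hN hs h)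

lemma tensorBraiding_linear (hM : IsModule A M) (hN : IsModule A N) {s' : A ⟶ A}
    (hs : s' ≫ s = 𝟙 A)
    (h : (β_ M.X A.X).hom ≫ M.actLeft = M.X ◁ s.hom ≫ (β_ A.X M.X).inv ≫ M.actLeft) :
    Bimod.TensorBimod.actLeft M N ≫ tensorBraiding s hM hN hs h =
      A.X ◁ tensorBraiding s hM hN hs h ≫ Bimod.TensorBimod.actLeft (twistBimod s N) M := by
  refine left_tπ_ext ?_
  have e := tπ_actLeft (twistBimod s N) M
  rw [reassoc_of% tπ_actLeft, tensorBraiding, tπ_tdesc, ← whiskerLeft_comp_assoc, tπ_tdesc,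
    braiding_linear s hN, whiskerLeft_comp_assoc, e]
  simp

end Twist

variable {R}

/-- The `A`-module `g(M)`: the object `M` with the action of `A` composed with `t_g`. -/
def twist (g : G) (M : DeEquiv R) : DeEquiv R where
  obj := twistBimod (R.t g) M.obj
  property := by
    change M.X ◁ (R.t g).hom ≫ M.obj.actRight =
      (β_ R.A.X M.X).inv ≫ (R.t g).hom ▷ M.X ≫ M.obj.actLeft
    rw [M.property, BraidedCategory.braiding_inv_naturality_right_assoc]

/-- The action of `g` on the category of `A`-modules. -/
def actFunctor (g : G) : DeEquiv R ⥤ DeEquiv R where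
  obj M := twist g M
  map f := ObjectProperty.homMk (twistMap (R.t g) f.hom)

/-- The degree `g` component of the category of `A`-modules consists of the `M` such that
`A` acts on `M ⊗ A ≅ A ⊗ M` through the braiding in the same way as through the inverse of
the braiding composed with `t_g`. -/
def degree (g : G) : ObjectProperty (DeEquiv R) := fun M =>
  (β_ M.X R.A.X).hom ≫ M.actL = M.X ◁ (R.t g).hom ≫ (β_ R.A.X M.X).inv ≫ M.actL

/-- The tensor structure of `M ↦ g(M)`, induced by the identity of `M ⊗ N`. -/
noncomputable def twistμ (g : G) (M N : DeEquiv R) : twist g M ⊗ twist g N ⟶ twist g (M ⊗ N) :=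
  ofLeft (tensorTwist (R.t g) M.obj N.obj) (tensorTwist_linear (R.t g) M.obj N.obj)

/-- The unit constraint `A ⟶ g(A)` is `t_g`. -/
noncomputable def twistε (g : G) : 𝟙_ (DeEquiv R) ⟶ twist g (𝟙_ (DeEquiv R)) :=
  ofLeft (R.t g).hom (mul_twist (R.t g))

/-- `g(h(M)) = (gh)(M)`. -/
def twistγ {g h l : G} (e : g * h = l) (M : DeEquiv R) : twist g (twist h M) ⟶ twist l M :=
  ofLeft (𝟙 M.X) (twist_comp M.obj (by rw [← e, R.t_mul]))

/-- `M = 1(M)`. -/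
def twistι {u : G} (e : u = 1) (M : DeEquiv R) : M ⟶ twist u M :=
  ofLeft (𝟙 M.X) (twist_id M.obj (by rw [e, R.t_one]))

lemma inv_t (R : GAlgebra B G) (g : G) : R.t g⁻¹ ≫ R.t g = 𝟙 R.A := by
  rw [← R.t_mul, inv_mul_cancel, R.t_one]

/-- The crossed braiding `M ⊗_A N ⟶ g(N) ⊗_A M` is induced by the braiding of `M` and `N`. -/
noncomputable def twistBraiding {g : G} {M : DeEquiv R} (hM : degree g M) (N : DeEquiv R) :
    M ⊗ N ⟶ twist g N ⊗ M :=
  ofLeft (tensorBraiding (R.t g) M.property N.property (inv_t R g) hM)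
    (tensorBraiding_linear (R.t g) M.property N.property (inv_t R g) hM)

noncomputable instance : CrossedData G (DeEquiv R) where
  act := actFunctor
  μ := twistμ
  ε := twistε
  γ := twistγ
  ι := twistι
  deg := degree
  cb := twistBraiding

end DeEquiv

end Monoidal

end DeEquivariantization

end GCrossed

namespace GCrossed
open CrossedData

section FunctionAlgebra

variable (G : Type*) [Group G] [Fintype G] (C : Type*) [Category C] [Preadditive C]
  [HasFiniteBiproducts C] [MonoidalCategory C]

/-- The direct sum of copies of the unit object indexed by `G`, i.e. the functions on `G`. -/
noncomputable def funObj : C := ⨁ fun _ : G => 𝟙_ C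

variable {G}

/-- Evaluation at `x`. -/
noncomputable def ev (x : G) : funObj G C ⟶ 𝟙_ C := biproduct.π (fun _ : G => 𝟙_ C) x

/-- The function which is `1` at `x` and `0` elsewhere. -/
noncomputable def delta (x : G) : 𝟙_ C ⟶ funObj G C := biproduct.ι (fun _ : G => 𝟙_ C) x

variable {C}

/-- The morphism to the functions on `G` with given values. -/
noncomputable def tuple {T : C} (f : G → (T ⟶ 𝟙_ C)) : T ⟶ funObj G C := biproduct.lift f

lemma delta_ev (x : G) : delta C x ≫ ev C x = 𝟙 _ := biproduct.ι_π_self _ _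

lemma delta_ev_ne {x y : G} (h : x ≠ y) : delta C x ≫ ev C y = 0 := biproduct.ι_π_ne _ h

@[simp] lemma tuple_ev {T : C} (f : G → (T ⟶ 𝟙_ C)) (x : G) : tuple f ≫ ev C x = f x :=
  biproduct.lift_π _ _

lemma fun_ext {T : C} {f f' : T ⟶ funObj G C} (h : ∀ x, f ≫ ev C x = f' ≫ ev C x) : f = f' :=
  biproduct.hom_ext _ _ h

lemma sum_ev_delta : ∑ x : G, ev C x ≫ delta C x = 𝟙 (funObj G C) :=
  fun_ext fun y => by
    rw [Preadditive.sum_comp, Finset.sum_eq_single y]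
    · rw [Category.assoc, delta_ev, Category.comp_id, Category.id_comp]
    · intro x _ hne
      rw [Category.assoc, delta_ev_ne hne, comp_zero]
    · simp

lemma delta_whisker_ext [MonoidalPreadditive C] {Y T : C} {f f' : funObj G C ⊗ Y ⟶ T}
    (h : ∀ x : G, delta C x ▷ Y ≫ f = delta C x ▷ Y ≫ f') : f = f' := by
  rw [← Category.id_comp f, ← Category.id_comp f', ← id_whiskerRight, ← sum_ev_delta,
    sum_whiskerRight, Preadditive.sum_comp, Preadditive.sum_comp]
  simp only [comp_whiskerRight, Category.assoc, h]

variable [CrossedData G C]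

/-- The equivariant structure of the functions on `G`: `G` acts by left translations. -/
noncomputable def funV [IsAction G C] (g : G) :
    (act g).obj (funObj G C) ≅ funObj G C where
  hom := tuple fun x => (act g).map (ev C (g⁻¹ * x)) ≫ inv (ε g)
  inv := ∑ x : G, ev C (g * x) ≫ ε g ≫ (act g).map (delta C x)
  hom_inv_id := by
    rw [Preadditive.comp_sum, ← (act g).map_id, ← sum_ev_delta, Functor.map_sum]
    refine Finset.sum_congr rfl fun x _ => ?_
    rw [← Category.assoc, tuple_ev]
    simp
  inv_hom_id := fun_ext fun y => by
    rw [Preadditive.sum_comp, Preadditive.sum_comp, Finset.sum_eq_single (g⁻¹ * y)]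
    · simp only [Category.assoc, tuple_ev, ← Functor.map_comp_assoc, delta_ev]
      simp
    · intro x _ hne
      simp only [Category.assoc, tuple_ev, ← Functor.map_comp_assoc, delta_ev_ne hne]
      simp
    · simp

variable (G C)

/-- The functions on `G` as an equivariant object. -/
noncomputable def funEq [IsAction G C] : Equivariant G C where
  obj := funObj G C
  v := funV
  v_mul {g h l} e := fun_ext fun x => by
    have := IsAction.γ_ε (C := C) e
    have e' : γ e (𝟙_ C) ≫ inv (ε l) = (act g).map (inv (ε h)) ≫ inv (ε g) := by
      rw [IsIso.comp_inv_eq, ← this]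
      simp
    simp only [funV, Category.assoc, tuple_ev, ← Functor.map_comp_assoc]
    rw [← reassoc_of% IsAction.γ_natural e, e', Functor.map_comp_assoc]
    subst e
    simp [mul_assoc]

variable {G C}

variable [IsAction G C]

lemma funV_comm {T : C} {g : G} (w : (act g).obj T ⟶ T) (f : T ⟶ funObj G C)
    (h : ∀ x, (act g).map (f ≫ ev C (g⁻¹ * x)) ≫ inv (ε g) = w ≫ f ≫ ev C x) :
    (act g).map f ≫ (funV g).hom = w ≫ f :=
  fun_ext fun x => by
    rw [Category.assoc, funV, tuple_ev, ← Functor.map_comp_assoc, h, Category.assoc]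

lemma inv_ε_mul (g : G) : μ g (𝟙_ C) (𝟙_ C) ≫ (act g).map (λ_ (𝟙_ C)).hom ≫ inv (ε g) =
    (inv (ε g) ⊗ₘ inv (ε g)) ≫ (λ_ (𝟙_ C)).hom := by
  have := IsAction.μ_left_unitality g (𝟙_ C)
  rw [← cancel_epi (ε g ▷ _), reassoc_of% this]
  simp [MonoidalCategory.tensorHom_def]

section Structure

variable (G C)

/-- The constant function `1`. -/
noncomputable def funOne : 𝟙_ C ⟶ funObj G C := tuple fun _ => 𝟙 _

/-- The pointwise product of functions. -/
noncomputable def funMul : funObj G C ⊗ funObj G C ⟶ funObj G C :=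
  tuple fun x => (ev C x ⊗ₘ ev C x) ≫ (λ_ _).hom

variable {G}

/-- Right translation of functions on `G`: `δ_y` is mapped to `δ_{yg}`. -/
noncomputable def funT (g : G) : funObj G C ⟶ funObj G C := tuple fun x => ev C (x * g⁻¹)

variable {C}

@[simp] lemma funOne_ev (x : G) : funOne G C ≫ ev C x = 𝟙 _ := tuple_ev _ _
@[simp] lemma funMul_ev (x : G) : funMul G C ≫ ev C x = (ev C x ⊗ₘ ev C x) ≫ (λ_ _).hom :=
  tuple_ev _ _
@[simp] lemma funT_ev (g x : G) : funT C g ≫ ev C x = ev C (x * g⁻¹) := tuple_ev _ _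

lemma funOne_mul : funOne G C ▷ funObj G C ≫ funMul G C = (λ_ _).hom :=
  fun_ext fun x => by
    rw [Category.assoc, funMul_ev, MonoidalCategory.tensorHom_def, Category.assoc,
      ← comp_whiskerRight_assoc, funOne_ev]
    simp

lemma funMul_one : funObj G C ◁ funOne G C ≫ funMul G C = (ρ_ _).hom :=
  fun_ext fun x => by
    rw [Category.assoc, funMul_ev, MonoidalCategory.tensorHom_def', Category.assoc,
      ← whiskerLeft_comp_assoc, funOne_ev]
    simp [unitors_equal]

lemma funMul_assoc : funMul G C ▷ funObj G C ≫ funMul G C =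
    (α_ _ _ _).hom ≫ funObj G C ◁ funMul G C ≫ funMul G C :=
  fun_ext fun x => by
    simp only [Category.assoc, funMul_ev]
    rw [← tensorHom_id, ← id_tensorHom, MonoidalCategory.tensorHom_comp_tensorHom_assoc,
      MonoidalCategory.tensorHom_comp_tensorHom_assoc, funMul_ev, Category.id_comp]
    have e₁ : ((ev C x ⊗ₘ ev C x) ≫ (λ_ _).hom ⊗ₘ ev C x) =
        ((ev C x ⊗ₘ ev C x) ⊗ₘ ev C x) ≫ (λ_ _).hom ▷ 𝟙_ C := by
      rw [← tensorHom_id, MonoidalCategory.tensorHom_comp_tensorHom, Category.comp_id]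
    have e₂ : (ev C x ⊗ₘ (ev C x ⊗ₘ ev C x) ≫ (λ_ _).hom) =
        (ev C x ⊗ₘ (ev C x ⊗ₘ ev C x)) ≫ 𝟙_ C ◁ (λ_ _).hom := by
      rw [← id_tensorHom, MonoidalCategory.tensorHom_comp_tensorHom, Category.comp_id]
    rw [e₁, e₂, Category.assoc, Category.assoc, ← associator_naturality_assoc, triangle_assoc,
      ← unitors_equal]

lemma funOne_T (g : G) : funOne G C ≫ funT C g = funOne G C :=
  fun_ext fun x => by simp

lemma funMul_T (g : G) : funMul G C ≫ funT C g = (funT C g ⊗ₘ funT C g) ≫ funMul G C :=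
  fun_ext fun x => by simp [MonoidalCategory.tensorHom_comp_tensorHom_assoc]

lemma funT_one : funT C (1 : G) = 𝟙 _ := fun_ext fun x => by simp

lemma funT_mul (g h : G) : funT C (g * h) = funT C g ≫ funT C h :=
  fun_ext fun x => by simp [mul_assoc]

lemma funOne_comm (g : G) : (act g).map (funOne G C) ≫ (funV g).hom = inv (ε g) ≫ funOne G C :=
  funV_comm _ _ fun x => by simp

lemma funMul_comm (g : G) : (act g).map (funMul G C) ≫ (funV g).hom =
    (Equivariant.tensV (funV g) (funV g)).hom ≫ funMul G C :=
  funV_comm _ _ fun x => by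
    rw [funMul_ev, funMul_ev, ← cancel_epi (μ g _ _), reassoc_of% Equivariant.μ_tensV,
      MonoidalCategory.tensorHom_comp_tensorHom_assoc, funV, tuple_ev,
      Functor.map_comp_assoc, ← reassoc_of% IsAction.μ_natural, inv_ε_mul,
      MonoidalCategory.tensorHom_comp_tensorHom_assoc]

lemma funT_comm (g h : G) : (act g).map (funT C h) ≫ (funV g).hom = (funV g).hom ≫ funT C h :=
  funV_comm _ _ fun x => by simp [funV, mul_assoc]

end Structure

variable (G C) in
/-- The algebra of functions on `G` in the equivariantization, with pointwise product. -/
noncomputable def funAlg : Mon (Equivariant G C) where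
  X := funEq G C
  mon :=
    { one := ⟨funOne G C, funOne_comm⟩
      mul := ⟨funMul G C, funMul_comm⟩
      one_mul := Equivariant.hom_ext funOne_mul
      mul_one := Equivariant.hom_ext funMul_one
      mul_assoc := Equivariant.hom_ext funMul_assoc }

variable (C) in
/-- Right translation by `g` as an automorphism of the algebra of functions. -/
noncomputable def funTranslate (g : G) : funAlg G C ⟶ funAlg G C :=
  Mon.Hom.mk' (⟨funT C g, fun h => funT_comm h g⟩ : funEq G C ⟶ funEq G C)
    (Equivariant.hom_ext (funOne_T g)) (Equivariant.hom_ext (funMul_T g))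

end FunctionAlgebra

section Commutative

variable {G : Type*} [Group G] [Fintype G] {C : Type*} [Category C] [Preadditive C]
  [HasFiniteBiproducts C] [MonoidalCategory C] [MonoidalPreadditive C] [CrossedData G C]
  [IsBraidedCrossed G C]

lemma delta_braidHom (x : G) : delta C x ▷ funObj G C ≫
    Equivariant.braidHom (funObj G C) (fun g : G => funV g) =
      (λ_ _).hom ≫ (ρ_ _).inv ≫ funObj G C ◁ delta C x := by
  have h := congrArg Equivariant.Hom.hom (braiding_rightUnitor (funEq G C))
  have h₁ : Equivariant.braidHom (𝟙_ C) (fun g : G => funV g) ≫ (ρ_ (funObj G C)).hom =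
    (λ_ (funObj G C)).hom := h
  have h₂ := Equivariant.whisker_braidHom (fun g : G => funV (C := C) g)
    (IsBraidedCrossed.deg_unit (G := G)) (𝟙 (𝟙_ C))
  rw [Equivariant.whisker_braidHom _ (IsBraidedCrossed.deg_unit (G := G)), ← h₁]
  rw [id_whiskerRight, Category.id_comp, whiskerLeft_id, Category.comp_id] at h₂
  rw [h₂]
  simp

lemma funMul_braidHom :
    Equivariant.braidHom (funObj G C) (fun g : G => funV g) ≫ funMul G C = funMul G C :=
  delta_whisker_ext fun y => fun_ext fun x => by
    have e₁ : funObj G C ◁ delta C y ≫ (ev C x ⊗ₘ ev C x) = (ev C x ⊗ₘ delta C y ≫ ev C x) := by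
      rw [← id_tensorHom, MonoidalCategory.tensorHom_comp_tensorHom, Category.id_comp]
    have e₂ : delta C y ▷ funObj G C ≫ (ev C x ⊗ₘ ev C x) = (delta C y ≫ ev C x ⊗ₘ ev C x) := by
      rw [← tensorHom_id, MonoidalCategory.tensorHom_comp_tensorHom, Category.id_comp]
    simp only [Category.assoc, funMul_ev]
    rw [reassoc_of% delta_braidHom, reassoc_of% e₁, reassoc_of% e₂]
    by_cases e : y = x
    · subst e
      have e₃ : (ρ_ (𝟙_ C)).inv ≫ (λ_ (𝟙_ C)).hom = 𝟙 _ := by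
        rw [unitors_equal, Iso.inv_hom_id]
      simp [delta_ev, e₃]
    · simp [delta_ev_ne e]

lemma funAlg_comm : (β_ (funEq G C) (funEq G C)).hom ≫ MonObj.mul (X := (funAlg G C).X) =
    MonObj.mul (X := (funAlg G C).X) :=
  Equivariant.hom_ext funMul_braidHom

end Commutative

section BraidedReverse

/-- The reverse of a braided category: the same monoidal category with the inverse braiding. -/
def BraidedRev (B : Type*) : Type _ := B

section

variable (B : Type*) [Category B]

instance : Category (BraidedRev B) := inferInstanceAs (Category B)

instance [Preadditive B] : Preadditive (BraidedRev B) := inferInstanceAs (Preadditive B)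

instance {k : Type*} [Field k] [Preadditive B] [Linear k B] : Linear k (BraidedRev B) :=
  inferInstanceAs (Linear k B)

instance [MonoidalCategory B] : MonoidalCategory (BraidedRev B) :=
  inferInstanceAs (MonoidalCategory B)

instance [MonoidalCategory B] [BraidedCategory B] : BraidedCategory (BraidedRev B) :=
  reverseBraiding B

end

variable (G : Type*) [Group G] [Fintype G] (C : Type*) [Category C] [Preadditive C]
  [HasFiniteBiproducts C] [MonoidalCategory C] [MonoidalPreadditive C] [CrossedData G C]
  [IsBraidedCrossed G C]

/-- The algebra of functions on `G` in the reverse `(C^G)^rev`, with its right translations. -/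
noncomputable def revFunctions : GAlgebra (BraidedRev (Equivariant G C)) G where
  A := (funAlg G C : Mon (Equivariant G C))
  comm := by
    change (β_ (funEq G C) (funEq G C)).inv ≫ MonObj.mul (X := (funAlg G C).X) =
      MonObj.mul (X := (funAlg G C).X)
    exact (Iso.inv_comp_eq _).2 funAlg_comm.symm
  t := (funTranslate C : G → (funAlg G C ⟶ funAlg G C))
  t_one := Mon.Hom.ext (Equivariant.hom_ext funT_one)
  t_mul g h := Mon.Hom.ext (Equivariant.hom_ext (funT_mul g h))

end BraidedReverse

section Fusion

variable {k D : Type*} [Field k] [Category D] [Preadditive D] [Linear k D] [MonoidalCategory D]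

lemma IsFusion.hasCoequalizers (h : IsFusion k D) : HasCoequalizers D := by
  obtain ⟨a, -⟩ := h.abelian
  infer_instance

lemma IsFusion.preserves_left (h : IsFusion k D) (X : D) :
    PreservesColimitsOfSize.{0, 0} (tensorLeft X) := by
  obtain ⟨a⟩ := h.rigid
  exact (tensorLeftAdjunction (ᘁX) X).leftAdjoint_preservesColimits

lemma IsFusion.preserves_right (h : IsFusion k D) (X : D) :
    PreservesColimitsOfSize.{0, 0} (tensorRight X) := by
  obtain ⟨a⟩ := h.rigid
  exact (tensorRightAdjunction X Xᘁ).leftAdjoint_preservesColimits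

end Fusion
end GCrossed

namespace GCrossed
open CrossedData

section BraidedReverseInstances

variable (B : Type*) [Category B] [Preadditive B] [MonoidalCategory B]

instance [MonoidalPreadditive B] : MonoidalPreadditive (BraidedRev B) :=
  inferInstanceAs (MonoidalPreadditive B)

instance {k : Type*} [Field k] [Linear k B] [MonoidalPreadditive B] [MonoidalLinear k B] :
    MonoidalLinear k (BraidedRev B) :=
  inferInstanceAs (MonoidalLinear k B)

instance {k G C : Type*} [Field k] [Group G] [Category C] [Preadditive C] [Linear k C]
    [MonoidalCategory C] [CrossedData G C] [IsAction G C] [∀ g : G, (act g : C ⥤ C).Linear k]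
    [MonoidalPreadditive C] [MonoidalLinear k C] : MonoidalLinear k (Equivariant G C) where
  whiskerLeft_smul X _ _ r f := Equivariant.hom_ext (MonoidalLinear.whiskerLeft_smul X.obj r f.hom)
  smul_whiskerRight r _ _ f X :=
    Equivariant.hom_ext (MonoidalLinear.smul_whiskerRight r f.hom X.obj)

instance [HasCoequalizers B] : HasCoequalizers (BraidedRev B) :=
  inferInstanceAs (HasCoequalizers B)

instance [h : ∀ X : B, PreservesColimitsOfSize.{0, 0} (tensorLeft X)] (X : BraidedRev B) :
    PreservesColimitsOfSize.{0, 0} (tensorLeft X) :=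
  h X

instance [h : ∀ X : B, PreservesColimitsOfSize.{0, 0} (tensorRight X)] (X : BraidedRev B) :
    PreservesColimitsOfSize.{0, 0} (tensorRight X) :=
  h X

end BraidedReverseInstances

section Canonical

variable (G : Type*) [Group G] [Fintype G] (C : Type*) [Category C] [Preadditive C]
  [HasFiniteBiproducts C] [MonoidalCategory C] [MonoidalPreadditive C] [CrossedData G C]
  [IsBraidedCrossed G C]

/-- The identity functor `(C^rev)^G ⥤ (C^G)^rev`: the underlying category and the action of `G`
are the same on both sides. -/
def revIdentity : Equivariant G (Rev G C) ⥤ BraidedRev (Equivariant G C) where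
  obj X := (⟨X.obj, X.v, X.v_mul⟩ : Equivariant G C)
  map f := (⟨f.hom, f.comm⟩ : Equivariant.Hom (G := G) (C := C) _ _)

variable {G C}

/-- The morphism `X ⊗^rev Y = ⊕ X_g ⊗ g⁻¹(Y) ⟶ ⊕ X_g ⊗ Y = X ⊗ Y` given on the summands by
`id ⊗ v_{g⁻¹}`, where `v` is the equivariant structure of `Y`. -/
noncomputable def revTensor (X Y : Equivariant G (Rev G C)) :
    Rev.tens G (C := C) X.obj Y.obj ⟶ MonoidalCategoryStruct.tensorObj (C := C) X.obj Y.obj :=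
  ∑ g : G, Rev.tp (C := C) X.obj Y.obj g ≫
    MonoidalCategoryStruct.tensorHom (C := C) (inc (C := C) X.obj g) (Y.v g⁻¹).hom

/-- The morphism of `C` underlying a morphism of `(C^G)^rev`. -/
def BraidedRev.hom {X Y : BraidedRev (Equivariant G C)} (f : X ⟶ Y) :
    Equivariant.obj (G := G) (C := C) X ⟶ Equivariant.obj (G := G) (C := C) Y :=
  Equivariant.Hom.hom (G := G) (C := C) f

end Canonical

section CrossedFunctor

variable (G : Type*) [Group G] {C D : Type*} [Category C] [MonoidalCategory C] [CrossedData G C]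
  [Category D] [MonoidalCategory D] [CrossedData G D]

/-- The structure of a braided `G`-crossed functor on a tensor functor `F`: `F` preserves and
reflects degrees, and it comes with natural isomorphisms `η_g : F ∘ g ≅ g ∘ F`, which are
isomorphisms of tensor functors, are compatible with the constraints of the
two actions, and are such that `F` is compatible with the crossed braidings. -/
structure CrossedStructure (F : C ⥤ D) [F.Monoidal] where
  deg_iff : ∀ (g : G) (X : C), deg g X ↔ deg g (F.obj X)
  η : ∀ (g : G) (X : C), F.obj ((act g).obj X) ≅ (act g).obj (F.obj X)
  η_natural : ∀ (g : G) {X Y : C} (f : X ⟶ Y),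
    F.map ((act g).map f) ≫ (η g Y).hom = (η g X).hom ≫ (act g).map (F.map f)
  η_γ : ∀ {g h l : G} (e : g * h = l) (X : C), F.map (γ e X) ≫ (η l X).hom =
    (η g ((act h).obj X)).hom ≫ (act g).map (η h X).hom ≫ γ e (F.obj X)
  η_ι : ∀ {u : G} (e : u = 1) (X : C), F.map (ι e X) ≫ (η u X).hom = ι e (F.obj X)
  η_μ : ∀ (g : G) (X Y : C),
    Functor.LaxMonoidal.μ F ((act g).obj X) ((act g).obj Y) ≫ F.map (μ g X Y) ≫
        (η g (X ⊗ Y)).hom =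
      ((η g X).hom ⊗ₘ (η g Y).hom) ≫ μ g (F.obj X) (F.obj Y) ≫
        (act g).map (Functor.LaxMonoidal.μ F X Y)
  η_ε : ∀ g : G, Functor.LaxMonoidal.ε F ≫ F.map (ε g) ≫ (η g (𝟙_ C)).hom =
    ε g ≫ (act g).map (Functor.LaxMonoidal.ε F)
  cb_compat : ∀ {g : G} {X : C} (hX : deg g X) (Y : C),
    Functor.LaxMonoidal.μ F X Y ≫ F.map (cb hX Y) =
      cb ((deg_iff g X).1 hX) (F.obj Y) ≫ (η g Y).inv ▷ F.obj X ≫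
        Functor.LaxMonoidal.μ F ((act g).obj Y) X

/-- There is a braided `G`-crossed equivalence between `C` and `D`: a `k`-linear tensor
equivalence which is a braided `G`-crossed functor. -/
def CrossedEquivalent (k : Type*) [Field k] (C D : Type*) [Category C] [Preadditive C]
    [Linear k C] [MonoidalCategory C] [CrossedData G C] [Category D] [Preadditive D]
    [Linear k D] [MonoidalCategory D] [CrossedData G D] : Prop :=
  ∃ (F : C ⥤ D) (_ : F.Additive) (_ : F.Monoidal),
    F.IsEquivalence ∧ F.Linear k ∧ Nonempty (CrossedStructure G F)

end CrossedFunctor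

end GCrossed

open GCrossed

/-! The tensor product of C^rev is the opposite tensor product in disguise. For X of degree g, the
crossed braiding of X with g⁻¹(Y), followed by g(g⁻¹(Y)) ≅ Y, is an isomorphism X ⊗ g⁻¹(Y) ≅ Y ⊗ X
(`flip`). Summed over the components of X it becomes X ⊗^rev Y ≅ Y ⊗ X (`Rev.toOp`). So the identity
functor compares C^rev with C carrying the opposite tensor product, inverted degrees and, as crossed
braiding, the inverse of `flip`. For this structure (`TensorOp`) each axiom is the mirror image of
an axiom of C. All structure maps match (`Rev.opStructure`, with `Rev.crossed_toOp` as the main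
point), so a general transport theorem (`CrossedStructure.isBraidedCrossed`) yields the axioms for
C^rev. Rigidity is transported in the same way.

For (a), the isomorphisms v of an equivariant Y identify g⁻¹(Y) with Y, which gives X ⊗^rev Y ≅ X ⊗
Y (`Rev.untwist`). Followed by the braiding of C^G this is exactly the map to Y ⊗ X above
(`Rev.untwist_braidHom`), because v_g ∘ g(v_{g⁻¹}) is the canonical isomorphism g(g⁻¹(Y)) ≅ Y. The
braiding of (C^rev)^G is made of inverse crossed braidings, which the map to the opposite tensor
product cancels. Hence it corresponds to the inverse braiding of C^G (`Rev.revBraiding_untwist`).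

For (b), a module over A = ⊕ 1 is an equivariant object M with orthogonal idempotents E_x, the
actions of the δ_x, which add up to the identity and satisfy g(E_x) = E_{gx} up to v
(`FunMod.map_idem`). So M is the sum of the x(M_1), where M_1 is the image of E_1. Thus M ↦ M_1 is
an equivalence (`FunMod.fiber`), and induction Y ↦ ⊕ x(Y) provides modules with prescribed fiber
(`FunMod.free`). Moving δ_x across a piece of degree h turns it into δ_{hx}, so δ_x acts from the
right on that piece as E_{hx} (`FunMod.comp_aR`). This formula governs the rest. Degree g means that
E_y = E_{hyg} on M_h, equivalently that M_1 has degree g⁻¹ (`FunMod.deg_iff_fiber`). In M ⊗_A N, on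
M_h ⊗ N, the idempotent E_x of N may be replaced by E_{hx} of M (`FunMod.comp_tp`). Hence the fiber
at 1 is the sum over h of (M_1)_h ⊗ h⁻¹(N_1), which is M_1 ⊗^rev N_1 (`FunMod.fibμ`). Right
translation by g replaces M_1 by the image of E_g, which is g(M_1) (`FunMod.fibη`). The braiding of
modules comes from the inverse braiding of C^G and becomes the crossed braiding of C^rev by the
computation of (a) (`FunMod.fib_braiding`). Transport along the fiber functor gives the axioms and
the fusion property for modules, and its quasi-inverse is the required equivalence
(`CrossedStructure.symm`).

The tensor product over A can be handled in C because the forgetful functor from C^G reflects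
colimits and also preserves them, being left adjoint to induction (`Equivariant.forgetAdjunction`).
-/

namespace GCrossed
open CrossedData

/-! ### Transport of braided crossed structures along an equivalence -/

namespace CrossedStructure

section Map

variable {G : Type*} [Group G] {C D : Type*} [Category C] [MonoidalCategory C] [CrossedData G C]
  [Category D] [MonoidalCategory D] [CrossedData G D] {F : C ⥤ D} [F.Monoidal]
  (s : CrossedStructure G F)

/-- The constraints of `F` and the `η` are invertible, so each compatibility in `CrossedStructure`
can be solved for the `F`-image of a structure map. The six formulas obtained in this way are the
rewriting rules which turn an equation of `C`, after the faithful functor `F` is applied, into an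
equation of `D`. -/
lemma map_act (g : G) {X Y : C} (f : X ⟶ Y) :
    F.map ((act g).map f) = (s.η g X).hom ≫ (act g).map (F.map f) ≫ (s.η g Y).inv := by
  rw [← reassoc_of% s.η_natural, Iso.hom_inv_id, Category.comp_id]

lemma map_γ {g h l : G} (e : g * h = l) (X : C) : F.map (γ e X) =
    (s.η g ((act h).obj X)).hom ≫ (act g).map (s.η h X).hom ≫ γ e (F.obj X) ≫ (s.η l X).inv := by
  have := s.η_γ e X
  rw [← Category.assoc _ (γ _ _), ← Category.assoc _ (_ ≫ γ _ _), Iso.eq_comp_inv, this]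

lemma map_ι {u : G} (e : u = 1) (X : C) : F.map (ι e X) = ι e (F.obj X) ≫ (s.η u X).inv := by
  rw [Iso.eq_comp_inv, s.η_ι]

lemma map_μ (g : G) (X Y : C) : F.map (μ g X Y) =
    Functor.OplaxMonoidal.δ F _ _ ≫ ((s.η g X).hom ⊗ₘ (s.η g Y).hom) ≫ μ g (F.obj X) (F.obj Y) ≫
        (act g).map (Functor.LaxMonoidal.μ F X Y) ≫ (s.η g (X ⊗ Y)).inv := by
  rw [← reassoc_of% s.η_μ, Iso.hom_inv_id, Category.comp_id, Functor.Monoidal.δ_μ_assoc]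

lemma map_ε (g : G) : F.map (ε g : 𝟙_ C ⟶ _) =
    Functor.OplaxMonoidal.η F ≫ ε g ≫ (act g).map (Functor.LaxMonoidal.ε F) ≫
      (s.η g (𝟙_ C)).inv := by
  rw [← reassoc_of% s.η_ε, Iso.hom_inv_id, Category.comp_id, Functor.Monoidal.η_ε_assoc]

lemma map_cb {g : G} {X : C} (hX : deg g X) (Y : C) : F.map (cb hX Y) =
    Functor.OplaxMonoidal.δ F X Y ≫ cb ((s.deg_iff g X).1 hX) (F.obj Y) ≫
      (s.η g Y).inv ▷ F.obj X ≫ Functor.LaxMonoidal.μ F ((act g).obj Y) X := by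
  rw [← s.cb_compat, Functor.Monoidal.δ_μ_assoc]

end Map

section Transport

variable {G : Type*} [Group G] {C D : Type*} [Category C] [MonoidalCategory C]
  [CrossedData G C] [Category D] [MonoidalCategory D] [CrossedData G D]
  [Preadditive C] [Preadditive D] {F : C ⥤ D} [F.Monoidal] [F.Additive] [F.IsEquivalence]
  (s : CrossedStructure G F)

include s

lemma map_inv_μ [IsAction G C] [IsAction G D] (g : G) (X Y : C) :
    F.map (inv (CrossedData.μ g X Y)) =
      (s.η g (X ⊗ Y)).hom ≫ (act g).map (Functor.OplaxMonoidal.δ F X Y) ≫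
        inv (CrossedData.μ g (F.obj X) (F.obj Y)) ≫ ((s.η g X).inv ⊗ₘ (s.η g Y).inv) ≫
          Functor.LaxMonoidal.μ F _ _ := by
  rw [F.map_inv, IsIso.inv_eq_of_hom_inv_id]
  rw [s.map_μ]
  simp only [Category.assoc, Iso.inv_hom_id_assoc, ← Functor.map_comp_assoc,
    Functor.Monoidal.μ_δ, CategoryTheory.Functor.map_id, Category.id_comp, IsIso.hom_inv_id_assoc,
    tensorHom_comp_tensorHom_assoc, Iso.hom_inv_id, id_tensorHom_id, Functor.Monoidal.δ_μ]

open Functor.Monoidal Functor.LaxMonoidal Functor.OplaxMonoidal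

/-- `F` is faithful and reflects isomorphisms. Under `F` the structure maps of `C` become those of
`D` conjugated by `η` and the constraints of `F`; these cancel in pairs and leave the same axiom in
`D`. -/
theorem isAction [IsAction G D] : IsAction G C where
  act_additive g := ⟨fun {X Y f f'} => F.map_injective <| by
    simp only [s.map_act, F.map_add, Functor.map_add, Preadditive.comp_add, Preadditive.add_comp]⟩
  act_equivalence g := by
    -- Both `F` and the action of `g` on `D` are equivalences, so the action of `g` on `C` is one by
    -- two-out-of-three.
    let i : act g ⋙ F ≅ F ⋙ act g :=
      NatIso.ofComponents (fun X => s.η g X) (fun f => s.η_natural g f)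
    have : (act g ⋙ F).IsEquivalence := Functor.isEquivalence_of_iso i.symm
    exact Functor.isEquivalence_of_comp_right (act g) F
  μ_iso g X Y := by
    have : IsIso (F.map (CrossedData.μ g X Y)) := by rw [s.map_μ]; infer_instance
    exact isIso_of_reflects_iso _ F
  ε_iso g := by
    have : IsIso (F.map (CrossedData.ε g : 𝟙_ C ⟶ _)) := by rw [s.map_ε]; infer_instance
    exact isIso_of_reflects_iso _ F
  γ_iso e X := by
    have : IsIso (F.map (γ e X)) := by rw [s.map_γ]; infer_instance
    exact isIso_of_reflects_iso _ F
  ι_iso e X := by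
    have : IsIso (F.map (ι e X)) := by rw [s.map_ι]; infer_instance
    exact isIso_of_reflects_iso _ F
  μ_natural g X X' Y Y' f f' := F.map_injective <| by
    rw [F.map_comp, F.map_comp, s.map_act, s.map_μ, s.map_μ, map_tensor, map_tensor, s.map_act,
      s.map_act]
    simp only [Category.assoc, μ_δ_assoc,
      Iso.inv_hom_id_assoc, ← Functor.map_comp_assoc]
    rw [tensorHom_comp_tensorHom_assoc]
    simp only [Category.assoc, Iso.inv_hom_id, Category.comp_id]
    rw [← tensorHom_comp_tensorHom_assoc, reassoc_of% IsAction.μ_natural]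
    simp only [Functor.map_comp, Category.assoc]
  μ_associativity g X Y Z := F.map_injective <| by
    have e := IsAction.μ_associativity g (F.obj X) (F.obj Y) (F.obj Z)
    have e₁ : (s.η g (X ⊗ Y)).inv ▷ F.obj ((act g).obj Z) ≫
        ((s.η g (X ⊗ Y)).hom ⊗ₘ (s.η g Z).hom) = _ ◁ (s.η g Z).hom := by
      simp [MonoidalCategory.tensorHom_def]
    have e₂ : F.obj ((act g).obj X) ◁ (s.η g (Y ⊗ Z)).inv ≫
        ((s.η g X).hom ⊗ₘ (s.η g (Y ⊗ Z)).hom) = (s.η g X).hom ▷ _ := by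
      simp [MonoidalCategory.tensorHom_def']
    simp only [F.map_comp, s.map_act, s.map_μ, map_associator, map_whiskerLeft, map_whiskerRight,
      Category.assoc, μ_δ_assoc, Iso.inv_hom_id_assoc, ← Functor.map_comp_assoc, comp_whiskerRight,
      whiskerLeft_comp, whiskerLeft_μ_δ_assoc, reassoc_of% e₁, reassoc_of% e₂]
    simp only [Functor.map_comp, Category.assoc]
    rw [← whisker_exchange_assoc ((act g).map _), reassoc_of% μ_natural_left,
      ← Functor.map_comp_assoc (act g) (_ ▷ _)]
    rw [← comp_whiskerRight, μ_δ, id_whiskerRight, CategoryTheory.Functor.map_id, Category.id_comp,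
      ← whisker_exchange_assoc (CrossedData.μ _ _ _), reassoc_of% e,
      ← reassoc_of% μ_natural_right, ← tensorHom_def_assoc, associator_naturality_assoc,
      tensorHom_def'_assoc (s.η g X).hom]
    simp only [whisker_exchange_assoc]
  μ_left_unitality g X := F.map_injective <| by
    have e := IsAction.μ_left_unitality g (F.obj X)
    have e₁ : (s.η g (𝟙_ C)).inv ▷ F.obj ((act g).obj X) ≫
        ((s.η g (𝟙_ C)).hom ⊗ₘ (s.η g X).hom) = _ ◁ (s.η g X).hom := by
      simp [MonoidalCategory.tensorHom_def]
    simp only [F.map_comp, s.map_act, s.map_μ, s.map_ε, map_leftUnitor, map_whiskerRight,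
      Category.assoc, μ_δ_assoc, Iso.inv_hom_id_assoc, ← Functor.map_comp_assoc, comp_whiskerRight,
      reassoc_of% e₁]
    rw [← whisker_exchange_assoc, reassoc_of% μ_natural_left, ← Functor.map_comp_assoc,
      ← comp_whiskerRight_assoc (Functor.LaxMonoidal.ε F), ε_η, id_whiskerRight, Category.id_comp, ← whisker_exchange_assoc,
      reassoc_of% e]
    simp
  μ_right_unitality g X := F.map_injective <| by
    have e := IsAction.μ_right_unitality g (F.obj X)
    have e₁ : F.obj ((act g).obj X) ◁ (s.η g (𝟙_ C)).inv ≫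
        ((s.η g X).hom ⊗ₘ (s.η g (𝟙_ C)).hom) = (s.η g X).hom ▷ _ := by
      simp [MonoidalCategory.tensorHom_def']
    simp only [F.map_comp, s.map_act, s.map_μ, s.map_ε, map_rightUnitor, map_whiskerLeft,
      Category.assoc, μ_δ_assoc, Iso.inv_hom_id_assoc, ← Functor.map_comp_assoc, whiskerLeft_comp,
      reassoc_of% e₁]
    rw [whisker_exchange_assoc, reassoc_of% μ_natural_right, ← Functor.map_comp_assoc,
      ← whiskerLeft_comp_assoc _ (Functor.LaxMonoidal.ε F), ε_η, whiskerLeft_id, Category.id_comp, whisker_exchange_assoc,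
      reassoc_of% e]
    simp
  γ_natural e X Y f := F.map_injective <| by
    simp only [F.map_comp, s.map_act, s.map_γ, Category.assoc, Iso.inv_hom_id_assoc,
      ← Functor.map_comp_assoc, ← reassoc_of% IsAction.γ_natural e, Iso.inv_hom_id, Category.comp_id]
  ι_natural e X Y f := F.map_injective <| by
    simp only [F.map_comp, s.map_act, s.map_ι, reassoc_of% IsAction.ι_natural e, Category.assoc, Iso.inv_hom_id_assoc]
  γ_μ {g h l} e X Y := F.map_injective <| by
    simp only [F.map_comp, s.map_act, s.map_μ, s.map_γ, map_tensor, Category.assoc, μ_δ_assoc, Iso.inv_hom_id_assoc, tensorHom_comp_tensorHom_assoc, Iso.inv_hom_id, Category.comp_id]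
    rw [← tensorHom_comp_tensorHom_assoc, ← tensorHom_comp_tensorHom_assoc, reassoc_of% IsAction.γ_μ e]
    simp only [← Functor.map_comp_assoc, Category.assoc, Iso.inv_hom_id, Category.comp_id, μ_δ_assoc]
    simp only [Functor.map_comp, Category.assoc]
    rw [← reassoc_of% IsAction.μ_natural, reassoc_of% IsAction.γ_natural]
  γ_ε {g h l} e := F.map_injective <| by
    simp only [F.map_comp, s.map_act, s.map_ε, s.map_γ, Category.assoc, Iso.inv_hom_id_assoc,
      ← Functor.map_comp_assoc, Iso.inv_hom_id, Category.comp_id, ε_η_assoc]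
    rw [Functor.map_comp_assoc, reassoc_of% IsAction.γ_natural, reassoc_of% IsAction.γ_ε e]
  ι_μ e X Y := F.map_injective <| by
    simp only [F.map_comp, s.map_ι, s.map_μ, map_tensor, Category.assoc, μ_δ_assoc, tensorHom_comp_tensorHom_assoc, Iso.inv_hom_id, Category.comp_id]
    rw [reassoc_of% IsAction.ι_μ, ← reassoc_of% IsAction.ι_natural, δ_μ_assoc]
  ι_ε e := F.map_injective <| by
    rw [s.map_ε, s.map_ι, ← IsAction.ι_ε e, ← reassoc_of% IsAction.ι_natural, η_ε_assoc]
  γ_associativity e₁ e₂ e₃ e₄ X := F.map_injective <| by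
    simp only [F.map_comp, s.map_act, s.map_γ, Category.assoc, Iso.inv_hom_id_assoc,
      ← Functor.map_comp_assoc, Iso.inv_hom_id, Category.comp_id]
    simp only [Functor.map_comp, Category.assoc]
    rw [reassoc_of% (IsAction.γ_associativity e₁ e₂ e₃ e₄), reassoc_of% IsAction.γ_natural]
  γ_left_unitality e e' X := F.map_injective <| by
    simp only [F.map_comp, s.map_γ, s.map_ι, Category.assoc, Iso.inv_hom_id_assoc]
    rw [← reassoc_of% IsAction.ι_natural, reassoc_of% (IsAction.γ_left_unitality e e'), Iso.hom_inv_id, F.map_id]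
  γ_right_unitality e e' X := F.map_injective <| by
    simp only [F.map_comp, s.map_act, s.map_γ, s.map_ι, Category.assoc, Iso.inv_hom_id_assoc, ← Functor.map_comp_assoc, Iso.inv_hom_id, Category.comp_id]
    rw [reassoc_of% (IsAction.γ_right_unitality e e'), Iso.hom_inv_id, F.map_id]

lemma deg_act [Fintype G] [IsBraidedCrossed G D] (g : G) {h : G} {X : C} (hX : deg h X) :
    deg (g * h * g⁻¹) ((act g).obj X) :=
  (s.deg_iff _ _).2 (IsBraidedCrossed.deg_iso _ (s.η g X).symm
    (IsBraidedCrossed.deg_act g ((s.deg_iff h X).1 hX)))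

/-- Stated for the image in `D`, since the second hexagon needs naturality of the crossed braiding
of `D` along the tensor constraint of `F`. -/
lemma deg_tensor [Fintype G] [IsBraidedCrossed G D] {g h : G} {X Y : C} (hX : deg g X)
    (hY : deg h Y) : deg (g * h) (F.obj (X ⊗ Y)) :=
  IsBraidedCrossed.deg_iso _ (μIso F X Y)
    (IsBraidedCrossed.deg_tensor ((s.deg_iff g X).1 hX) ((s.deg_iff h Y).1 hY))

/-- A category which is equivalent to a braided `G`-crossed category, compatibly with all
structure maps, is a braided `G`-crossed category. -/
theorem isBraidedCrossed [Fintype G] [IsBraidedCrossed G D] : IsBraidedCrossed G C where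
  toIsAction := s.isAction
  deg_iso g X Y i h := (s.deg_iff g Y).2 (IsBraidedCrossed.deg_iso g (F.mapIso i)
    ((s.deg_iff g X).1 h))
  deg_orthogonal {g h X Y} e hX hY f := F.map_injective <| by
    rw [IsBraidedCrossed.deg_orthogonal e ((s.deg_iff g X).1 hX) ((s.deg_iff h Y).1 hY) (F.map f),
      F.map_zero]
  deg_decomposition X := by
    -- The summands of `F(X)` are lifted by essential surjectivity, the inclusions and projections
    -- by fullness.
    obtain ⟨Y, i, p, hd, hip, hs⟩ := IsBraidedCrossed.deg_decomposition (G := G) (F.obj X)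
    refine ⟨fun g => F.objPreimage (Y g), fun g => F.preimage ((F.objObjPreimageIso (Y g)).hom ≫ i g),
      fun g => F.preimage (p g ≫ (F.objObjPreimageIso (Y g)).inv), fun g => ?_, fun g => ?_, ?_⟩
    · exact (s.deg_iff _ _).2 (IsBraidedCrossed.deg_iso g (F.objObjPreimageIso (Y g)).symm (hd g))
    · apply F.map_injective
      simp [reassoc_of% hip]
    · apply F.map_injective
      simp [hs]
  deg_unit := (s.deg_iff _ _).2 (IsBraidedCrossed.deg_iso 1 (εIso F)
    IsBraidedCrossed.deg_unit)
  deg_tensor hX hY := (s.deg_iff _ _).2 (s.deg_tensor hX hY)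
  deg_act g _ _ hX := s.deg_act g hX
  cb_iso hX Y := by
    have : IsIso (F.map (cb hX Y)) := by rw [s.map_cb]; infer_instance
    exact isIso_of_reflects_iso _ F
  cb_natural {g X X' Y Y'} hX hX' f f' := F.map_injective <| by
    rw [F.map_comp, F.map_comp, map_tensor, map_tensor, s.map_cb, s.map_cb, s.map_act]
    simp only [Category.assoc, μ_δ_assoc]
    rw [reassoc_of% (IsBraidedCrossed.cb_natural ((s.deg_iff g X).1 hX) ((s.deg_iff g X').1 hX'))]
    simp only [MonoidalCategory.tensorHom_def, Category.assoc, comp_whiskerRight]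
    simp only [← whisker_exchange_assoc, ← comp_whiskerRight_assoc, Iso.inv_hom_id_assoc]
  cb_action g h X hX Y := F.map_injective <| by
    have := s.isAction
    have e := IsBraidedCrossed.cb_action g ((s.deg_iff h X).1 hX) (F.obj Y)
    have e₁ := IsBraidedCrossed.cb_natural ((s.deg_iff _ _).1 (s.deg_act g hX))
      (IsBraidedCrossed.deg_act g ((s.deg_iff h X).1 hX)) (s.η g X).hom (s.η g Y).hom
    have e₂ : ((s.η g ((act h).obj Y)).inv ⊗ₘ (s.η g X).inv) ≫
        ((s.η g ((act h).obj Y)).hom ≫ (act g).map (s.η h Y).hom ≫ γ rfl (F.obj Y) ≫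
          (s.η (g * h) Y).inv) ▷ F.obj ((act g).obj X) =
        (act g).map (s.η h Y).hom ▷ _ ≫ γ rfl (F.obj Y) ▷ _ ≫
          ((s.η (g * h) Y).inv ⊗ₘ (s.η g X).inv) := by
      rw [tensorHom_def', tensorHom_def', Category.assoc, ← comp_whiskerRight, Iso.inv_hom_id_assoc]
      simp only [whisker_exchange_assoc, comp_whiskerRight]
    have e₃ : (act g).map ((s.η h Y).inv ▷ F.obj X) ≫
        inv (CrossedData.μ g (F.obj ((act h).obj Y)) (F.obj X)) ≫ (act g).map (s.η h Y).hom ▷ _ = inv (CrossedData.μ g _ (F.obj X)) := by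
      rw [← cancel_epi (CrossedData.μ g _ _), ← reassoc_of% (μ_natural_left g (s.η h Y).inv),
        IsIso.hom_inv_id_assoc, ← comp_whiskerRight, ← Functor.map_comp, Iso.inv_hom_id]
      simp
    simp only [F.map_comp, s.map_act, s.map_μ, s.map_cb, s.map_inv_μ, map_whiskerRight, s.map_γ,
      Category.assoc, Iso.inv_hom_id_assoc, μ_δ_assoc, reassoc_of% e₂]
    simp only [← Functor.map_comp_assoc, μ_δ_assoc, Category.assoc, μ_δ]
    rw [Category.comp_id, Functor.map_comp_assoc, reassoc_of% e₃, reassoc_of% e, reassoc_of% e₁,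
      ← comp_whiskerRight_assoc, Iso.inv_hom_id_assoc]
    simp only [MonoidalCategory.tensorHom_def, comp_whiskerRight, Category.assoc,
      whisker_exchange_assoc]
    simp only [← whiskerLeft_comp_assoc, Iso.hom_inv_id, whiskerLeft_id,
      Category.id_comp]
  cb_hexagon₁ {g X} hX Y Z := F.map_injective <| by
    have := s.isAction
    have e := IsBraidedCrossed.cb_hexagon₁ ((s.deg_iff g X).1 hX) (F.obj Y) (F.obj Z)
    simp only [F.map_comp, map_associator, map_whiskerLeft, map_whiskerRight, s.map_cb, Category.assoc, μ_δ_assoc, s.map_inv_μ]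
    simp only [comp_whiskerRight, Category.assoc, whiskerRight_μ_δ_assoc, whiskerLeft_comp,
      whiskerLeft_μ_δ_assoc]
    have e₁ : (s.η g (Y ⊗ Z)).inv ▷ F.obj X ≫ (s.η g (Y ⊗ Z)).hom ▷ F.obj X = 𝟙 _ := by
      simp [← comp_whiskerRight]
    have e₂ : (act g).map (Functor.LaxMonoidal.μ F Y Z) ▷ F.obj X ≫
        (act g).map (Functor.OplaxMonoidal.δ F Y Z) ▷ F.obj X = 𝟙 _ := by
      rw [← comp_whiskerRight, ← Functor.map_comp, μ_δ]
      simp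
    rw [reassoc_of% e₁, reassoc_of% cb_natural_right, reassoc_of% e₂,
      MonoidalCategory.tensorHom_def, comp_whiskerRight_assoc, associator_naturality_left_assoc,
      associator_naturality_middle_assoc, ← whisker_exchange_assoc,
      ← reassoc_of% e, associator_naturality_left_assoc]
  cb_hexagon₂ {g h X Y} hX hY Z := F.map_injective <| by
    have e := IsBraidedCrossed.cb_hexagon₂ ((s.deg_iff g X).1 hX) ((s.deg_iff h Y).1 hY) (F.obj Z)
    simp only [F.map_comp, map_associator, map_associator_inv, map_whiskerLeft, map_whiskerRight, s.map_cb, Category.assoc, μ_δ_assoc, s.map_γ]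
    simp only [comp_whiskerRight, Category.assoc, whiskerRight_μ_δ_assoc, whiskerLeft_comp,
      whiskerLeft_μ_δ_assoc]
    have e₁ : (s.η g ((act h).obj Z)).inv ▷ F.obj (X ⊗ Y) ≫
        (s.η g ((act h).obj Z)).hom ▷ F.obj (X ⊗ Y) = 𝟙 _ := by
      rw [← comp_whiskerRight, Iso.inv_hom_id, id_whiskerRight]
    have e₂ : (act g).map (s.η h Z).inv ▷ F.obj (X ⊗ Y) ≫
        (act g).map (s.η h Z).hom ▷ F.obj (X ⊗ Y) = 𝟙 _ := by
      rw [← comp_whiskerRight, ← Functor.map_comp, Iso.inv_hom_id]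
      simp
    rw [associator_naturality_left_assoc, ← whisker_exchange_assoc, reassoc_of% e₁,
      associator_inv_naturality_middle_assoc, ← comp_whiskerRight_assoc (_ ◁ _), cb_natural_right,
      comp_whiskerRight_assoc, associator_naturality_left_assoc, ← whisker_exchange_assoc,
      reassoc_of% e₂, whisker_exchange_assoc, ← reassoc_of% e,
      ← reassoc_of% (cb_natural_left (IsBraidedCrossed.deg_tensor ((s.deg_iff g X).1 hX)
        ((s.deg_iff h Y).1 hY)) (s.deg_tensor hX hY) (Functor.LaxMonoidal.μ F X Y) (F.obj Z)),
      ← comp_whiskerRight_assoc, δ_μ, id_whiskerRight, Category.id_comp]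

end Transport
-- The inverse of a braided crossed equivalence
section Symm

variable {G : Type*} [Group G] [Fintype G] {C D : Type*} [Category C] [MonoidalCategory C]
  [CrossedData G C] [Category D] [MonoidalCategory D] [CrossedData G D]
  [Preadditive D] [IsBraidedCrossed G D]
  (E : C ≌ D) [E.functor.Monoidal] [E.inverse.Monoidal] [E.IsMonoidal]
  (s : CrossedStructure G E.functor)

open Functor.Monoidal Functor.LaxMonoidal Functor.OplaxMonoidal

/-- The isomorphism `E⁻¹(g(X)) ≅ g(E⁻¹(X))`. -/
def symmη (g : G) (X : D) : E.inverse.obj ((act g).obj X) ≅ (act g).obj (E.inverse.obj X) :=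
  E.inverse.mapIso ((act g).mapIso (E.counitIso.app X).symm ≪≫ (s.η g _).symm) ≪≫
    (E.unitIso.app _).symm

lemma counit_natural {X Y : D} (f : X ⟶ Y) :
    E.functor.map (E.inverse.map f) ≫ E.counit.app Y = E.counit.app X ≫ f :=
  E.counit.naturality f

/-- The triangle identity removes the unit of the adjunction. Only this characterization of `symmη`,
and its inverse form, is used below. -/
lemma map_symmη (g : G) (X : D) : E.functor.map (symmη E s g X).hom ≫ (s.η g _).hom ≫
    (act g).map (E.counit.app X) = E.counit.app _ := by
  simp [symmη]

lemma map_symmη_inv (g : G) (X : D) : E.functor.map (symmη E s g X).inv ≫ E.counit.app _ =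
    (s.η g _).hom ≫ (act g).map (E.counit.app X) := by
  rw [← map_symmη E s, ← E.functor.map_comp_assoc, Iso.inv_hom_id, E.functor.map_id,
    Category.id_comp]

lemma counit_μ (X Y : D) : E.functor.map (Functor.LaxMonoidal.μ E.inverse X Y) ≫ E.counit.app _ =
    Functor.OplaxMonoidal.δ E.functor _ _ ≫ (E.counit.app X ⊗ₘ E.counit.app Y) :=
  E.toAdjunction.map_μ_comp_counit_app_tensor X Y

lemma counit_ε : E.functor.map (Functor.LaxMonoidal.ε E.inverse) ≫ E.counit.app _ =
    Functor.OplaxMonoidal.η E.functor :=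
  E.toAdjunction.map_ε_comp_counit_app_unit

/-- `E` is faithful and the added morphism is invertible. Each compatibility of the inverse can thus
be compared in `D` with target g(X), where `map_symmη`, `counit_μ` and `counit_ε` eliminate the
inverse functor. -/
lemma symm_ext {g : G} {X : D} {T : C} {f f' : T ⟶ (act g).obj (E.inverse.obj X)}
    (h : E.functor.map f ≫ (s.η g _).hom ≫ (act g).map (E.counit.app X) =
      E.functor.map f' ≫ (s.η g _).hom ≫ (act g).map (E.counit.app X)) : f = f' :=
  E.functor.map_injective ((cancel_mono ((s.η g _).hom ≫ (act g).map (E.counit.app X))).1 h)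

/-- The inverse of a braided `G`-crossed equivalence. -/
def symm : CrossedStructure G E.inverse where
  deg_iff g X := by
    rw [s.deg_iff]
    exact ⟨IsBraidedCrossed.deg_iso g (E.counitIso.app X).symm,
      IsBraidedCrossed.deg_iso g (E.counitIso.app X)⟩
  η := symmη E s
  η_natural g X Y f := symm_ext E s <| by
    rw [E.functor.map_comp, E.functor.map_comp, s.map_act]
    simp only [Category.assoc, Iso.inv_hom_id_assoc]
    rw [map_symmη, counit_natural, ← (act g).map_comp, counit_natural, (act g).map_comp,
      reassoc_of% map_symmη]
  η_γ {g h l} e X := symm_ext E s <| by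
    simp only [E.functor.map_comp, s.map_act, s.map_γ, Category.assoc, Iso.inv_hom_id_assoc]
    rw [map_symmη, counit_natural, ← IsAction.γ_natural, ← Functor.map_comp_assoc,
      ← Functor.map_comp_assoc, Category.assoc, map_symmη, reassoc_of% map_symmη]
    rfl
  η_ι e X := symm_ext E s <| by
    simp only [E.functor.map_comp, s.map_ι, Category.assoc, Iso.inv_hom_id_assoc]
    rw [map_symmη, counit_natural, ← IsAction.ι_natural]
    rfl
  η_μ g X Y := symm_ext E s <| by
    simp only [E.functor.map_comp, Category.assoc]
    rw [map_symmη, counit_natural, reassoc_of% counit_μ, s.map_μ, s.map_act]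
    simp only [Category.assoc, Iso.inv_hom_id_assoc, ← Functor.map_comp, counit_μ, μ_δ_assoc]
    rw [← IsAction.μ_natural, map_tensor]
    simp only [Category.assoc, tensorHom_comp_tensorHom_assoc, μ_δ_assoc, map_symmη]
    rfl
  η_ε g := symm_ext E s <| by
    simp only [E.functor.map_comp, Category.assoc]
    rw [map_symmη, counit_natural, reassoc_of% counit_ε, s.map_ε, s.map_act]
    simp only [Category.assoc, Iso.inv_hom_id_assoc, ← Functor.map_comp, counit_ε, ε_η]
    simp
  cb_compat {g X} hX Y := E.functor.map_injective <| by
    rw [← cancel_mono (E.counit.app _)]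
    have hX' : deg g (E.functor.obj (E.inverse.obj X)) :=
      IsBraidedCrossed.deg_iso g (E.counitIso.app X).symm hX
    simp only [E.functor.map_comp, Category.assoc]
    rw [counit_natural, reassoc_of% counit_μ, counit_μ, map_whiskerRight, s.map_cb]
    simp only [Category.assoc, μ_δ_assoc]
    rw [IsBraidedCrossed.cb_natural hX' hX]
    simp only [MonoidalCategory.tensorHom_def, ← comp_whiskerRight_assoc, map_symmη_inv,
      Iso.inv_hom_id_assoc]
    rfl

end Symm

end CrossedStructure
-- Cancelling g against its inverse
section Cancel

variable {G : Type*} [Group G] {C : Type*} [Category C] [Preadditive C]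
  [MonoidalCategory C] [CrossedData G C] [IsAction G C]

/-- The isomorphism `a(g(X)) ≅ X` for `ag = 1`. -/
noncomputable def cancel {a g : G} (e : a * g = 1) (X : C) : (act a).obj ((act g).obj X) ≅ X :=
  asIso (γ e X) ≪≫ (asIso (ι (rfl : (1 : G) = 1) X)).symm

lemma cancel_hom {a g : G} (e : a * g = 1) (X : C) : (cancel e X).hom = γ e X ≫ inv (ι (rfl : (1 : G) = 1) X) :=
  rfl

lemma cancel_hom_ι {a g : G} (e : a * g = 1) (X : C) : (cancel e X).hom ≫ ι (rfl : (1 : G) = 1) X = γ e X := by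
  simp [cancel]

lemma cancel_natural {a g : G} (e : a * g = 1) {X Y : C} (f : X ⟶ Y) :
    (act a).map ((act g).map f) ≫ (cancel e Y).hom = (cancel e X).hom ≫ f := by
  rw [← cancel_mono (ι (rfl : (1 : G) = 1) Y), Category.assoc, Category.assoc, cancel_hom_ι, IsAction.γ_natural,
    IsAction.ι_natural, ← Category.assoc, cancel_hom_ι]

lemma γ_one {u h : G} (e : u = 1) (e' : u * h = h) (X : C) :
    γ e' X = inv (ι e ((act h).obj X)) := by
  rw [← cancel_epi (ι e _), IsAction.γ_left_unitality e, IsIso.hom_inv_id]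

lemma one_γ {u h : G} (e : u = 1) (e' : h * u = h) (X : C) :
    γ e' X = inv ((act h).map (ι e X)) := by
  rw [← cancel_epi ((act h).map (ι e _)), IsAction.γ_right_unitality e, IsIso.hom_inv_id]

/-- `cancel` for `a(b(h(g(X))))`. -/
lemma cancel_cancel {a b g h ab hg : G} (e₁ : a * g = 1) (e₂ : b * h = 1) (e₃ : a * b = ab)
    (e₄ : h * g = hg) (e₅ : ab * hg = 1) (X : C) :
    (act a).map (cancel e₂ ((act g).obj X)).hom ≫ (cancel e₁ X).hom =
      (act a).map ((act b).map (γ e₄ X)) ≫ γ e₃ _ ≫ (cancel e₅ X).hom := by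
  have e₆ : b * hg = g := by rw [← e₄, ← mul_assoc, e₂, one_mul]
  rw [← cancel_mono (ι (rfl : (1 : G) = 1) X)]
  simp only [Category.assoc, cancel_hom_ι]
  rw [← IsAction.γ_associativity e₃ e₆ e₅ e₁, cancel_hom, ← Functor.map_comp_assoc,
    IsAction.γ_associativity e₂ e₄ (one_mul g) e₆]
  rw [γ_one rfl]

/-- Compatibility of `cancel` with the action. -/
lemma map_cancel {k a g kak kg g' : G} (e₁ : a * g = 1) (e₂ : g' * k = kg) (e₃ : k * g = kg)
    (e₄ : kak * g' = 1) (ka : G) (e₅ : kak * k = ka) (e₆ : k * a = ka) (X : C) :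
    (act k).map (cancel e₁ X).hom =
      γ e₆ _ ≫ inv (γ e₅ _) ≫ (act kak).map (γ e₃ X ≫ inv (γ e₂ X)) ≫
        (cancel e₄ ((act k).obj X)).hom := by
  have e₇ : kak * kg = k := by rw [← e₂, ← mul_assoc, e₄, one_mul]
  have e₈ : ka * g = k := by rw [← e₆, mul_assoc, e₁, mul_one]
  have h₁ := IsAction.γ_associativity e₄ e₂ (one_mul k) e₇ X
  have h₂ := IsAction.γ_associativity e₅ e₃ e₈ e₇ X
  have h₃ := IsAction.γ_associativity e₆ e₁ e₈ (mul_one k) X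
  rw [γ_one rfl, ] at h₁
  rw [one_γ rfl] at h₃
  rw [cancel_hom, cancel_hom, ← h₁, Functor.map_comp, Functor.map_inv, h₃, ← Functor.map_comp_assoc,
    Category.assoc, IsIso.inv_hom_id, Category.comp_id, h₂, IsIso.inv_hom_id_assoc]

/-- Both γ and ι are monoidal transformations, hence so is `cancel`. This lemma and `ε_cancel` are
the two halves of that fact. -/
lemma μ_cancel {a g : G} (e : a * g = 1) (X Y : C) :
    (act a).map (μ g X Y) ≫ (cancel e (X ⊗ Y)).hom =
      inv (μ a _ _) ≫ ((cancel e X).hom ⊗ₘ (cancel e Y).hom) := by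
  rw [← cancel_mono (ι (rfl : (1 : G) = 1) (X ⊗ Y)), ← cancel_epi (μ a _ _), Category.assoc, Category.assoc,
    cancel_hom_ι, ← IsAction.γ_μ, IsIso.hom_inv_id_assoc, ← IsAction.ι_μ,
    tensorHom_comp_tensorHom_assoc, cancel_hom_ι, cancel_hom_ι]

lemma ε_cancel {a g : G} (e : a * g = 1) :
    ε a ≫ (act a).map (ε g) ≫ (cancel e (𝟙_ C)).hom = 𝟙 _ := by
  rw [← cancel_mono (ι (rfl : (1 : G) = 1) (𝟙_ C)), Category.assoc, Category.assoc, cancel_hom_ι,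
    IsAction.γ_ε, Category.id_comp, IsAction.ι_ε]

end Cancel

/-! ### The crossed braiding in the form X ⊗ g(Y) ≅ Y ⊗ X -/

section Flip

variable {G : Type*} [Group G] [Fintype G] {C : Type*} [Category C] [Preadditive C]
  [MonoidalCategory C] [CrossedData G C] [IsBraidedCrossed G C]

/-- The form `X ⊗ g(Y) ≅ Y ⊗ X` of the crossed braiding, for `X` of degree `g⁻¹`. -/
noncomputable def flip {a g : G} (e : a * g = 1) {X : C} (hX : deg a X) (Y : C) :
    X ⊗ (act g).obj Y ≅ Y ⊗ X :=
  asIso (cb hX ((act g).obj Y)) ≪≫ whiskerRightIso (cancel e Y) X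

variable {a g : G} (e : a * g = 1)

lemma flip_hom {X : C} (hX : deg a X) (Y : C) :
    (flip e hX Y).hom = cb hX ((act g).obj Y) ≫ (cancel e Y).hom ▷ X :=
  rfl

lemma flip_natural {X X' Y Y' : C} (hX : deg a X) (hX' : deg a X') (f : X ⟶ X') (f' : Y ⟶ Y') :
    (f ⊗ₘ (act g).map f') ≫ (flip e hX' Y').hom = (flip e hX Y).hom ≫ (f' ⊗ₘ f) := by
  rw [flip_hom, reassoc_of% (IsBraidedCrossed.cb_natural hX hX'), flip_hom, Category.assoc,
    MonoidalCategory.tensorHom_def', Category.assoc, ← comp_whiskerRight, cancel_natural,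
    MonoidalCategory.tensorHom_def, comp_whiskerRight, whisker_exchange_assoc, whisker_exchange]

lemma flip_natural_left {X X' Y : C} (hX : deg a X) (hX' : deg a X') (f : X ⟶ X') :
    f ▷ (act g).obj Y ≫ (flip e hX' Y).hom = (flip e hX Y).hom ≫ Y ◁ f := by
  simpa using flip_natural e hX hX' f (𝟙 Y)

/-- This is the first hexagon; the constraint μ is absorbed because `cancel` is monoidal. -/
lemma flip_tensor_right {X : C} (hX : deg a X) (Y Z : C) :
    X ◁ μ g Y Z ≫ (flip e hX (Y ⊗ Z)).hom = (α_ _ _ _).inv ≫ (flip e hX Y).hom ▷ _ ≫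
      (α_ _ _ _).hom ≫ Y ◁ (flip e hX Z).hom ≫ (α_ _ _ _).inv := by
  have h := IsBraidedCrossed.cb_hexagon₁ hX ((act g).obj Y) ((act g).obj Z)
  rw [flip_hom, reassoc_of% cb_natural_right, ← comp_whiskerRight, μ_cancel, comp_whiskerRight,
    Iso.eq_inv_comp, ← cancel_mono (α_ _ _ _).hom]
  simp only [Category.assoc, flip_hom, Iso.inv_hom_id, Category.comp_id,
    MonoidalCategory.tensorHom_def, comp_whiskerRight, whiskerLeft_comp]
  rw [associator_naturality_left_assoc, ← whisker_exchange_assoc, ← reassoc_of% h]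
  simp

/-- This is the second hexagon; the two successive cancellations are merged into one by
`cancel_cancel`. -/
lemma flip_tensor_left {b h ab hg : G} (e₂ : b * h = 1) (e₄ : h * g = hg) (e₃ : a * b = ab)
    (e₅ : ab * hg = 1) {X Y : C} (hX : deg a X) (hY : deg b Y) (hXY : deg ab (X ⊗ Y)) (Z : C) :
    (X ⊗ Y) ◁ γ e₄ Z ≫ (flip e₅ hXY Z).hom = (α_ _ _ _).hom ≫
      X ◁ (flip e₂ hY ((act g).obj Z)).hom ≫ (α_ _ _ _).inv ≫ (flip e hX Z).hom ▷ Y ≫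
        (α_ _ _ _).hom := by
  subst e₃
  rw [flip_hom, reassoc_of% cb_natural_right, ← comp_whiskerRight,
    IsBraidedCrossed.cb_hexagon₂ hX hY]
  simp only [Category.assoc, flip_hom, comp_whiskerRight, whiskerLeft_comp]
  rw [associator_inv_naturality_middle_assoc, ← comp_whiskerRight_assoc (_ ◁ _), cb_natural_right]
  simp only [associator_naturality_left]
  have h₁ := cancel_cancel e e₂ rfl e₄ e₅ Z
  rw [reassoc_of% IsAction.γ_natural] at h₁
  simp only [comp_whiskerRight, Category.assoc, associator_naturality_left_assoc]
  simp only [← comp_whiskerRight, h₁]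

/-- Compatibility of the crossed braiding with the action, combined with `map_cancel`. The products
in `G` enter as variables with equations, so that different expressions of one group element can be
substituted later. -/
lemma flip_act (k : G) {kg g' kak : G} (e₂ : g' * k = kg) (e₃ : k * g = kg) (e₄ : kak * g' = 1)
    {X : C} (hX : deg a X) (hX' : deg kak ((act k).obj X)) (Y : C) :
    μ k X ((act g).obj Y) ≫ (act k).map (flip e hX Y).hom =
      _ ◁ (γ e₃ Y ≫ inv (γ e₂ Y)) ≫ (flip e₄ hX' ((act k).obj Y)).hom ≫ μ k Y X := by
  -- The three equations force g' = kgk⁻¹ and g = a⁻¹, hence this value.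
  obtain rfl : kak = k * a * k⁻¹ := by
    rw [eq_inv_of_mul_eq_one_left e₄, eq_inv_of_mul_eq_one_left e, eq_mul_inv_of_mul_eq e₂, ← e₃]
    group
  simp only [flip_hom, Functor.map_comp, Category.assoc]
  rw [reassoc_of% cb_action', reassoc_of% cb_natural_right, ← μ_natural_left, map_cancel e e₂ e₃ e₄ _ (by group) rfl]
  simp only [← comp_whiskerRight_assoc, IsIso.inv_hom_id_assoc, IsIso.hom_inv_id_assoc]

lemma cb_tensor_left {b ab : G} (e₃ : a * b = ab) {X Y : C} (hX : deg a X) (hY : deg b Y)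
    (hXY : deg ab (X ⊗ Y)) (Z : C) :
    cb hXY Z = (α_ _ _ _).hom ≫ X ◁ cb hY Z ≫ (α_ _ _ _).inv ≫ cb hX ((act b).obj Z) ▷ Y ≫
        (α_ _ _ _).hom ≫ γ e₃ Z ▷ (X ⊗ Y) := by
  subst e₃
  exact IsBraidedCrossed.cb_hexagon₂ hX hY Z

/-- A consequence of the hexagons. Regard the braiding with the unit as a natural isomorphism d : Z
→ u(Z). The second hexagon for 1 ⊗ 1 ≅ 1 gives γ ∘ d_{u(X)} ∘ d_X = d_X, hence d_{u(X)} = ι.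
Naturality of d with respect to ι then gives d_X = ι. -/
lemma cb_unit_left {u : G} (e : u = 1) (h1 : deg u (𝟙_ C)) (X : C) :
    cb h1 X = (λ_ _).hom ≫ ι e X ≫ (ρ_ _).inv := by
  let d (Z : C) : Z ⟶ (act u).obj Z := (λ_ _).inv ≫ cb h1 Z ≫ (ρ_ _).hom
  have hd (Z : C) : cb h1 Z = (λ_ _).hom ≫ d Z ≫ (ρ_ _).inv := by simp [d]
  have e' : u * u = u := by rw [e, mul_one]
  have h11 : deg u (𝟙_ C ⊗ 𝟙_ C) := by
    simpa only [e'] using IsBraidedCrossed.deg_tensor h1 h1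
  have e₁ : d X ≫ d _ ≫ γ e' X = d X := by
    have h := cb_natural_left h11 h1 (λ_ (𝟙_ C)).hom X
    rw [cb_tensor_left e' h1 h1, hd, hd] at h
    rw [← cancel_mono (ρ_ _).inv, ← cancel_epi (λ_ X).hom, ← cancel_epi ((λ_ (𝟙_ C)).hom ▷ X)]
    simp only [Category.assoc]
    rw [h]
    simp
  have e₂ : d X ≫ (act u).map (ι e X) = ι e X ≫ d _ := by
    have h := cb_natural_right h1 (ι e X)
    have h' := leftUnitor_inv_naturality (ι e X)
    simp only [d, Category.assoc]
    rw [reassoc_of% h', reassoc_of% h, rightUnitor_naturality]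
  have hi (Z : C) : IsIso (d Z) := by dsimp only [d]; infer_instance
  have e₃ : d ((act u).obj X) = ι e _ := by
    rw [← cancel_mono (γ e' X), IsAction.γ_left_unitality, ← cancel_epi (d X), e₁,
      Category.comp_id]
  have e₄ : d X = ι e X := by
    rw [← cancel_mono ((act u).map (ι e X)), e₂, e₃, IsAction.ι_natural]
  rw [hd, e₄]

/-- The braiding with the unit amounts to an automorphism d of X. The first hexagon for two unit
objects says d = d ∘ d, so d is the identity. -/
lemma cb_unit_right {X : C} (hX : deg a X) :
    cb hX (𝟙_ C) = (ρ_ _).hom ≫ (λ_ _).inv ≫ ε a ▷ X  := by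
  let d : X ⟶ X := (ρ_ _).inv ≫ cb hX (𝟙_ C) ≫ inv (ε a) ▷ X ≫ (λ_ _).hom
  have hd : cb hX (𝟙_ C) = (ρ_ _).hom ≫ d ≫ (λ_ _).inv ≫ ε a ▷ X := by simp [d]
  have h := IsBraidedCrossed.cb_hexagon₁ hX (𝟙_ C) (𝟙_ C)
  have h' := cb_natural_right hX (λ_ (𝟙_ C)).hom
  have h₁ : d = d ≫ d := by
    -- Left unitality determines μ(1,1) by ε, which removes the inverse from the hexagon.
    have h₃ : inv (μ a (𝟙_ C) (𝟙_ C)) = (act a).map (λ_ (𝟙_ C)).hom ≫ (λ_ _).inv ≫ ε a ▷ _ := by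
      apply IsIso.inv_eq_of_hom_inv_id
      have := IsAction.μ_left_unitality a (𝟙_ C)
      rw [← cancel_epi (ε a ▷ _), reassoc_of% this]
      simp
    rw [h₃, comp_whiskerRight_assoc, ← reassoc_of% h', hd] at h
    have h₄ : (ρ_ X).hom ▷ 𝟙_ C ≫ (ρ_ X).hom ≫ d ≫ (λ_ X).inv ≫ (λ_ _).inv ≫
        (𝟙_ C) ◁ ε a ▷ X ≫ ε a ▷ _ = (ρ_ X).hom ▷ 𝟙_ C ≫ (ρ_ X).hom ≫ d ≫ d ≫ (λ_ X).inv ≫ (λ_ _).inv ≫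
        (𝟙_ C) ◁ ε a ▷ X ≫ ε a ▷ _ := by
      convert h using 1
      · simp
      · simp only [whiskerLeft_comp, comp_whiskerRight, Category.assoc, associator_naturality_left_assoc]
        rw [← whisker_exchange_assoc, ← whisker_exchange_assoc, ← whisker_exchange_assoc, ← whisker_exchange]
        simp
    rw [cancel_epi, cancel_epi] at h₄
    simpa only [cancel_mono, ← Category.assoc] using h₄
  have h₂ : d = 𝟙 X := by
    have : IsIso d := by dsimp only [d]; infer_instance
    rwa [← cancel_epi d, Category.comp_id, eq_comm]
  rw [hd, h₂, Category.id_comp]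

lemma flip_unit_left (e : a * g = 1) (e' : a = 1) (e'' : g = 1) (h1 : deg a (𝟙_ C)) (X : C) :
    (flip e h1 X).hom = _ ◁ inv (ι e'' X) ≫ (λ_ _).hom ≫ (ρ_ _).inv := by
  subst e' e''
  have h : (cancel e X).hom = inv ((act (1 : G)).map (ι (rfl : (1 : G) = 1) X)) ≫ inv (ι (rfl : (1 : G) = 1) X) := by
    rw [cancel_hom, one_γ]
  rw [flip_hom, cb_unit_left rfl h1, h]
  have h' : ι (rfl : (1 : G) = 1) ((act (1 : G)).obj X) = (act (1 : G)).map (ι rfl X) := by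
    rw [← cancel_epi (ι rfl X), IsAction.ι_natural]
  rw [Category.assoc, Category.assoc, ← rightUnitor_inv_naturality, h']
  simp

lemma flip_unit_right {X : C} (hX : deg a X) :
    X ◁ ε g ≫ (flip e hX (𝟙_ C)).hom = (ρ_ _).hom ≫ (λ_ _).inv := by
  rw [flip_hom, reassoc_of% cb_natural_right, cb_unit_right, Category.assoc, Category.assoc,
    ← comp_whiskerRight, ← comp_whiskerRight, ε_cancel, id_whiskerRight, Category.comp_id]

end Flip

/-! ### The opposite tensor product as a braided crossed category -/

/-- The category `C`, to be equipped with the opposite tensor product. -/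
def TensorOp (C : Type*) : Type _ := C

namespace TensorOp

instance (C : Type*) [Category C] : Category (TensorOp C) := inferInstanceAs (Category C)

instance (C : Type*) [Category C] [Preadditive C] : Preadditive (TensorOp C) :=
  inferInstanceAs (Preadditive C)

section

variable {C : Type*} [Category C] [MonoidalCategory C]

instance : MonoidalCategoryStruct (TensorOp C) where
  tensorObj X Y := tensorObj (C := C) Y X
  tensorUnit := 𝟙_ C
  tensorHom f f' := tensorHom (C := C) f' f
  whiskerLeft X _ _ f := whiskerRight (C := C) f X
  whiskerRight f X := whiskerLeft (C := C) X f
  associator X Y Z := (associator (C := C) Z Y X).symm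
  leftUnitor X := rightUnitor (C := C) X
  rightUnitor X := leftUnitor (C := C) X

instance : MonoidalCategory (TensorOp C) where
  tensorHom_def f f' := MonoidalCategory.tensorHom_def' (C := C) f' f
  id_tensorHom_id X Y := MonoidalCategory.id_tensorHom_id (C := C) Y X
  tensorHom_comp_tensorHom f f' g g' :=
    MonoidalCategory.tensorHom_comp_tensorHom (C := C) f' f g' g
  whiskerLeft_id X Y := MonoidalCategory.id_whiskerRight (C := C) Y X
  id_whiskerRight X Y := MonoidalCategory.whiskerLeft_id (C := C) Y X
  associator_naturality f₁ f₂ f₃ := MonoidalCategory.associator_inv_naturality (C := C) f₃ f₂ f₁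
  leftUnitor_naturality f := MonoidalCategory.rightUnitor_naturality (C := C) f
  rightUnitor_naturality f := MonoidalCategory.leftUnitor_naturality (C := C) f
  pentagon W X Y Z := by
    have h := MonoidalCategory.pentagon_inv (C := C) (W := Z) (X := Y) (Y := X) (Z := W)
    exact h
  triangle X Y := MonoidalCategory.triangle_assoc_comp_right (C := C) Y X

/-- Duals in `C` are duals on the other side in `TensorOp C`. -/
@[reducible] def exactPairing (X Y : C) (_ : ExactPairing X Y) : ExactPairing (C := TensorOp C) Y X where
  coevaluation' := ExactPairing.coevaluation (C := C) X Y
  evaluation' := ExactPairing.evaluation (C := C) X Y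
  coevaluation_evaluation' := ExactPairing.evaluation_coevaluation (C := C) X Y
  evaluation_coevaluation' := ExactPairing.coevaluation_evaluation (C := C) X Y

instance [R : RigidCategory C] : RigidCategory (TensorOp C) where
  rightDual X :=
    { rightDual := @HasLeftDual.leftDual C _ _ X (R.toLeftRigidCategory.leftDual X)
      exact := exactPairing (C := C) _ X (@HasLeftDual.exact C _ _ X (R.toLeftRigidCategory.leftDual X)) }
  leftDual X :=
    { leftDual := @HasRightDual.rightDual C _ _ X (R.toRightRigidCategory.rightDual X)
      exact := exactPairing (C := C) X _ (@HasRightDual.exact C _ _ X (R.toRightRigidCategory.rightDual X)) }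

end

section Crossed

variable {G : Type*} [Group G] [Fintype G] {C : Type*} [Category C] [Preadditive C]
  [MonoidalCategory C] [CrossedData G C] [IsBraidedCrossed G C]

/-- The crossed braiding must be a map Y ⊗ X → X ⊗ g(Y) of `C`. The inverse of `flip` is such a map
when X has degree g⁻¹ in `C`, which is why degrees are inverted. -/
noncomputable instance : CrossedData G (TensorOp C) where
  act g := (act g : C ⥤ C)
  μ g X Y := μ (C := C) g Y X
  ε g := ε (C := C) g
  γ e X := γ (C := C) e X
  ι e X := ι (C := C) e X
  deg g := (deg g⁻¹ : ObjectProperty C)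
  cb {g X} hX Y := (flip (C := C) (X := X) (inv_mul_cancel g) hX Y).inv

instance : IsAction G (TensorOp C) where
  act_additive g := by have h := IsAction.act_additive (C := C) g; exact h
  act_equivalence g := by have h := IsAction.act_equivalence (C := C) g; exact h
  μ_iso g X Y := by have h := IsAction.μ_iso (C := C) g Y X; exact h
  ε_iso g := by have h := IsAction.ε_iso (C := C) g; exact h
  γ_iso e X := by have h := IsAction.γ_iso (C := C) e X; exact h
  ι_iso e X := by have h := IsAction.ι_iso (C := C) e X; exact h
  μ_natural g X X' Y Y' f f' := by
    have h (X X' Y Y' : C) (f : X ⟶ X') (f' : Y ⟶ Y') := IsAction.μ_natural g f f'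
    exact h Y Y' X X' f' f
  μ_associativity g X Y Z := by
    change (act g : C ⥤ C).obj Z ◁ μ (C := C) g Y X ≫ μ (C := C) g Z (tensorObj (C := C) Y X) ≫
      (act g : C ⥤ C).map (associator (C := C) Z Y X).inv =
      (associator (C := C) _ _ _).inv ≫ whiskerRight (C := C) (μ (C := C) g Z Y) _ ≫
        μ (C := C) g (tensorObj (C := C) Z Y) X
    -- The associator is the inverse of that of `C`. Once both associators are moved across, the
    -- equation is the axiom of `C` read backwards.
    rw [Iso.eq_inv_comp, ← cancel_mono ((act g : C ⥤ C).map (associator (C := C) Z Y X).hom)]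
    simp only [Category.assoc, ← Functor.map_comp]
    erw [Iso.inv_hom_id, CategoryTheory.Functor.map_id, Category.comp_id]
    exact (IsAction.μ_associativity (C := C) g Z Y X).symm
  μ_left_unitality g X := IsAction.μ_right_unitality (C := C) g X
  μ_right_unitality g X := IsAction.μ_left_unitality (C := C) g X
  γ_natural e X Y f := by
    have h (X Y : C) (f : X ⟶ Y) := IsAction.γ_natural e f
    exact h X Y f
  ι_natural e X Y f := by
    have h (X Y : C) (f : X ⟶ Y) := IsAction.ι_natural e f
    exact h X Y f
  γ_μ e X Y := IsAction.γ_μ (C := C) e Y X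
  γ_ε e := IsAction.γ_ε (C := C) e
  ι_μ e X Y := IsAction.ι_μ (C := C) e Y X
  ι_ε e := IsAction.ι_ε (C := C) e
  γ_associativity e₁ e₂ e₃ e₄ X := IsAction.γ_associativity (C := C) e₁ e₂ e₃ e₄ X
  γ_left_unitality e e' X := IsAction.γ_left_unitality (C := C) e e' X
  γ_right_unitality e e' X := IsAction.γ_right_unitality (C := C) e e' X

end Crossed

end TensorOp

section Inverses

variable {G : Type*} [Group G] [Fintype G] {C : Type*} [Category C] [Preadditive C]
  [MonoidalCategory C] [CrossedData G C] [IsBraidedCrossed G C]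
variable {a g : G} (e : a * g = 1)

/-- This lemma and the next three invert the identities for `flip`. The outcome, unfolded, is the
list of axioms for the crossed braiding on the opposite tensor product. -/
lemma flip_inv_natural {X X' Y Y' : C} (hX : deg a X) (hX' : deg a X') (f : X ⟶ X')
    (f' : Y ⟶ Y') :
    (f' ⊗ₘ f) ≫ (flip e hX' Y').inv = (flip e hX Y).inv ≫ (f ⊗ₘ (act g).map f') := by
  rw [Iso.comp_inv_eq, Category.assoc, flip_natural e hX hX', Iso.inv_hom_id_assoc]

lemma flip_inv_act (k : G) {kg g' kak : G} (e₂ : g' * k = kg) (e₃ : k * g = kg)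
    (e₄ : kak * g' = 1) {X : C} (hX : deg a X) (hX' : deg kak ((act k).obj X)) (Y : C) :
    μ k Y X ≫ (act k).map (flip e hX Y).inv ≫ inv (μ k X ((act g).obj Y)) ≫ _ ◁ γ e₃ Y =
      (flip e₄ hX' ((act k).obj Y)).inv ≫ _ ◁ γ e₂ Y := by
  have h := flip_act e k e₂ e₃ e₄ hX hX' Y
  rw [← Functor.mapIso_inv, Iso.eq_inv_comp, ← cancel_mono (_ ◁ inv (γ e₂ Y))]
  simp only [Category.assoc, ← whiskerLeft_comp, IsIso.hom_inv_id, whiskerLeft_id]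
  rw [← cancel_epi (_ ◁ (γ e₃ Y ≫ inv (γ e₂ Y))), ← reassoc_of% h, ← Functor.mapIso_hom,
    Iso.hom_inv_id_assoc, IsIso.hom_inv_id_assoc, Category.comp_id]

lemma flip_inv_tensor_right {X : C} (hX : deg a X) (Y Z : C) :
    (α_ _ _ _).inv ≫ (flip e hX (Y ⊗ Z)).inv ≫ X ◁ inv (μ g Y Z) ≫ (α_ _ _ _).inv =
      Y ◁ (flip e hX Z).inv ≫ (α_ _ _ _).inv ≫ (flip e hX Y).inv ▷ _ := by
  have h := flip_tensor_right e hX Y Z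
  rw [← Iso.eq_comp_inv] at h
  rw [← cancel_mono (α_ _ _ _).hom, ← cancel_mono (X ◁ μ g Y Z)]
  simp only [Category.assoc, Iso.inv_hom_id, Category.comp_id, ← whiskerLeft_comp, IsIso.inv_hom_id, whiskerLeft_id]
  rw [h]
  simp

lemma flip_inv_tensor_left {b h ab hg : G} (e₂ : b * h = 1) (e₄ : h * g = hg) (e₃ : a * b = ab)
    (e₅ : ab * hg = 1) {X Y : C} (hX : deg a X) (hY : deg b Y) (hXY : deg ab (X ⊗ Y)) (Z : C) :
    (flip e₅ hXY Z).inv = (α_ _ _ _).inv ≫ (flip e hX Z).inv ▷ Y ≫ (α_ _ _ _).hom ≫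
      X ◁ (flip e₂ hY ((act g).obj Z)).inv ≫ (α_ _ _ _).inv ≫ (X ⊗ Y) ◁ γ e₄ Z := by
  rw [← cancel_mono (flip e₅ hXY Z).hom, Iso.inv_hom_id]
  simp only [Category.assoc]
  rw [flip_tensor_left e e₂ e₄ e₃ e₅ hX hY]
  simp

end Inverses

namespace TensorOp

variable {G : Type*} [Group G] [Fintype G] {C : Type*} [Category C] [Preadditive C]
  [MonoidalCategory C] [CrossedData G C] [IsBraidedCrossed G C]

instance : IsBraidedCrossed G (TensorOp C) where
  deg_iso g X Y i hX := by
    have h := IsBraidedCrossed.deg_iso (G := G) (C := C) g⁻¹ (X := X) (Y := Y)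
      ⟨i.hom, i.inv, i.hom_inv_id, i.inv_hom_id⟩ hX
    exact h
  deg_orthogonal {g h X Y} hne hX hY f := by
    have h := IsBraidedCrossed.deg_orthogonal (C := C) (X := X) (Y := Y) (inv_injective.ne hne)
      hX hY f
    exact h
  deg_decomposition X := by
    obtain ⟨Y, i, p, h₁, h₂, h₃⟩ := IsBraidedCrossed.deg_decomposition (G := G) (C := C) X
    refine ⟨fun g => Y g⁻¹, fun g => i g⁻¹, fun g => p g⁻¹, fun g => h₁ g⁻¹, fun g => h₂ g⁻¹, ?_⟩
    -- The components are reindexed by g ↦ g⁻¹.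
    exact (Equiv.sum_comp (Equiv.inv G) fun g => (p g ≫ i g : (X : C) ⟶ X)).trans h₃
  deg_unit := by
    have h := IsBraidedCrossed.deg_unit (G := G) (C := C)
    rw [← inv_one] at h
    exact h
  deg_tensor {g h X Y} hX hY := by
    have hX' : deg (C := C) g⁻¹ X := hX
    have hY' : deg (C := C) h⁻¹ Y := hY
    -- Inverting degrees and reversing the tensor product both reverse products in `G`, so the
    -- grading survives: h⁻¹g⁻¹ = (gh)⁻¹.
    have h₁ := IsBraidedCrossed.deg_tensor hY' hX'
    rw [← mul_inv_rev] at h₁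
    exact h₁
  deg_act g {h X} hX := by
    have hX' : deg (C := C) h⁻¹ X := hX
    have h₁ := IsBraidedCrossed.deg_act g hX'
    rw [show g * h⁻¹ * g⁻¹ = (g * h * g⁻¹)⁻¹ by group] at h₁
    exact h₁
  cb_iso {g X} hX Y := by
    have h : IsIso (flip (C := C) (X := X) (inv_mul_cancel g) hX Y).inv := inferInstance
    exact h
  cb_natural {g X X' Y Y'} hX hX' f f' := by
    have h := flip_inv_natural (C := C) (X := X) (X' := X') (inv_mul_cancel g) hX hX' f f'
    exact h
  cb_action k {h X} hX Y := by
    have h := flip_inv_act (C := C) (X := X) (inv_mul_cancel h) k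
      (show k * h * k⁻¹ * k = k * h by group) rfl (inv_mul_cancel (k * h * k⁻¹)) hX
      (by rw [show (k * h * k⁻¹)⁻¹ = k * h⁻¹ * k⁻¹ by group]
          have hX' : deg (C := C) h⁻¹ X := hX
          exact IsBraidedCrossed.deg_act k hX') Y
    exact h
  cb_hexagon₁ {g X} hX Y Z := by
    have h := flip_inv_tensor_right (C := C) (X := X) (inv_mul_cancel g) hX Z Y
    exact h
  cb_hexagon₂ {g h X Y} hX hY Z := by
    have h := flip_inv_tensor_left (C := C) (X := Y) (Y := X) (inv_mul_cancel h) (inv_mul_cancel g)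
      rfl (mul_inv_rev g h).symm (inv_mul_cancel (g * h)) hY hX
      (by have hX' : deg (C := C) g⁻¹ X := hX
          have hY' : deg (C := C) h⁻¹ Y := hY
          rw [mul_inv_rev]
          exact IsBraidedCrossed.deg_tensor hY' hX') Z
    exact h

end TensorOp

/-! ### Comparison of ⊗^rev with the opposite tensor product -/

namespace Rev

section Comparison

variable {G : Type*} [Group G] [Fintype G] {C : Type*} [Category C] [Preadditive C]
  [HasFiniteBiproducts C] [MonoidalCategory C] [MonoidalPreadditive C] [CrossedData G C]
  [IsBraidedCrossed G C]

variable (G) in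
/-- The isomorphism `X ⊗^rev Y ≅ Y ⊗ X` given by the crossed braiding. -/
noncomputable def toOp (X Y : C) : tens G X Y ⟶ Y ⊗ X :=
  ∑ g : G, outof (deg_comp X g) (prj X g) (𝟙 Y) ≫
    (flip (mul_inv_cancel g) (deg_comp X g) Y).hom ≫ Y ◁ inc X g

variable (G) in
/-- The inverse of `toOp`. -/
noncomputable def ofOp (X Y : C) : Y ⊗ X ⟶ tens G X Y :=
  ∑ g : G, Y ◁ prj X g ≫ (flip (mul_inv_cancel g) (deg_comp X g) Y).inv ≫
    into (deg_comp X g) (inc X g) (𝟙 Y)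

/-- On a homogeneous piece only one summand contributes, and naturality of `flip` removes the chosen
components. Together with `tens_ext` this reduces identities for `toOp` to identities for `flip`. -/
lemma into_toOp {g : G} {W X V Y : C} (hW : deg g W) (f : W ⟶ X) (f' : V ⟶ Y) :
    into hW f f' ≫ toOp G X Y = (flip (mul_inv_cancel g) hW V).hom ≫ (f' ⊗ₘ f) := by
  rw [toOp, Preadditive.comp_sum, Finset.sum_eq_single g]
  · rw [reassoc_of% into_outof, reassoc_of% (flip_natural _ hW), Category.comp_id, ← id_tensorHom,
      MonoidalCategory.tensorHom_comp_tensorHom, Category.comp_id, Category.assoc,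
      comp_prj_inc hW]
  · intro h _ hne
    rw [← Category.assoc, into_outof_ne _ _ hne.symm, zero_comp]
  · simp

lemma whisker_ofOp {g : G} {W X : C} (hW : deg g W) (f : W ⟶ X) (Y : C) :
    Y ◁ f ≫ ofOp G X Y = (flip (mul_inv_cancel g) hW Y).inv ≫ into hW f (𝟙 Y) := by
  rw [ofOp, Preadditive.comp_sum, Finset.sum_eq_single g]
  · have h := flip_inv_natural (mul_inv_cancel g) hW (deg_comp X g) (f ≫ prj X g) (𝟙 Y)
    rw [id_tensorHom] at h
    rw [← whiskerLeft_comp_assoc, reassoc_of% h, tensor_into _ hW, Category.assoc,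
      comp_prj_inc hW, Category.comp_id]
  · intro h _ hne
    rw [← whiskerLeft_comp_assoc, comp_prj_eq_zero hW f hne.symm]
    simp
  · simp

variable (G) in
/-- The isomorphism `X ⊗^rev Y ≅ Y ⊗ X` given by the crossed braiding. -/
@[simps] noncomputable def opIso (X Y : C) : tens G X Y ≅ Y ⊗ X where
  hom := toOp G X Y
  inv := ofOp G X Y
  hom_inv_id := tens_ext fun g => by
    rw [reassoc_of% into_toOp, id_tensorHom, whisker_ofOp (deg_comp X g), Iso.hom_inv_id_assoc,
      Category.comp_id]
  inv_hom_id := map_component_ext (G := G) (tensorLeft Y) fun g => by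
    change Y ◁ _ ≫ _ = Y ◁ _ ≫ _
    rw [reassoc_of% (whisker_ofOp (deg_comp X g)), into_toOp, Iso.inv_hom_id_assoc, id_tensorHom,
      Category.comp_id]

lemma tensMap_toOp {X X' Y Y' : C} (f : X ⟶ X') (f' : Y ⟶ Y') :
    tensMap G f f' ≫ toOp G X' Y' = toOp G X Y ≫ (f' ⊗ₘ f) :=
  tens_ext fun g => by
    rw [reassoc_of% into_tensMap, into_toOp, reassoc_of% into_toOp,
      MonoidalCategory.tensorHom_comp_tensorHom]

/-- On the summand of X_g and Y_h both sides reverse the order of three factors by flips; they agree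
by the two hexagons `flip_tensor_left` and `flip_tensor_right`. -/
lemma toOp_assoc (X Y Z : C) : toOp G (tens G X Y) Z ≫ Z ◁ toOp G X Y ≫ (α_ Z Y X).inv =
    assocHom X Y Z ≫ toOp G X (tens G Y Z) ≫ toOp G Y Z ▷ X :=
  tens_ext₃ fun g h l e => by
    have hW := deg_comp X g
    have hV := deg_comp Y h
    have hWV := deg_tens e hW hV
    have hVW : deg l (comp Y h ⊗ comp X g) := e ▸ IsBraidedCrossed.deg_tensor hV hW
    have e₁ : g⁻¹ * h⁻¹ = l⁻¹ := by rw [← e, mul_inv_rev]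
    have h₁ := flip_natural_left (mul_inv_cancel l) hWV hVW
      (flip (mul_inv_cancel g) hW (comp Y h)).hom (Y := Z)
    have h₂ := flip_tensor_left (mul_inv_cancel h) (mul_inv_cancel g) e₁ e (mul_inv_cancel l)
      hV hW hVW Z
    have h₃ := flip_tensor_right (mul_inv_cancel g) hW (comp Y h) ((act h⁻¹).obj Z)
    rw [reassoc_of% into_toOp, reassoc_of% (into_assocHom e hW hV hWV), reassoc_of% into_toOp,
      id_tensorHom, ← whiskerLeft_comp_assoc, into_toOp, whiskerLeft_comp_assoc, ← reassoc_of% h₁,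
      assocCore_hom, ← tensorHom_id (toOp G Y Z), MonoidalCategory.tensorHom_comp_tensorHom,
      into_toOp, Category.comp_id]
    simp only [whiskerLeft_comp, Category.assoc]
    rw [reassoc_of% h₃]
    -- The associator of C^rev contains γ⁻¹; precomposing with γ replaces (hg)⁻¹(Z) by g⁻¹(h⁻¹(Z)),
    -- the form in which the hexagon is stated.
    rw [← cancel_epi ((comp X g ⊗ (act g⁻¹).obj (comp Y h)) ◁ γ e₁ Z),
      whisker_exchange_assoc, reassoc_of% h₂]
    simp [MonoidalCategory.tensorHom_def]

lemma leftU_inv_toOp (X : C) : (leftU G X).inv ≫ toOp G (𝟙_ C) X = (ρ_ X).inv := by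
  rw [leftU]
  dsimp only
  rw [Category.assoc, Category.assoc, into_toOp,
    reassoc_of% (flip_unit_left (mul_inv_cancel (1 : G)) rfl inv_one), ← whiskerLeft_comp_assoc]
  simp

lemma rightInv_toOp (X : C) : rightInv G X ≫ toOp G X (𝟙_ C) = (λ_ X).inv :=
  map_component_ext (G := G) (𝟭 C) fun g => by
    change inc X g ≫ _ = inc X g ≫ _
    rw [reassoc_of% (comp_rightInv (deg_comp X g)), into_toOp, reassoc_of% flip_unit_right,
      Iso.inv_hom_id_assoc, id_tensorHom, leftUnitor_inv_naturality]

/-- Morphisms out of `k(X) ⊗^rev Y` agree if they agree on all `k(X_g) ⊗ (kgk⁻¹)⁻¹(Y)`. -/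
lemma tens_act_ext (k : G) {X Y T : C} {f f' : tens G ((act k).obj X) Y ⟶ T}
    (h : ∀ g : G, into (IsBraidedCrossed.deg_act k (deg_comp X g)) ((act k).map (inc X g)) (𝟙 Y) ≫ f =
      into (IsBraidedCrossed.deg_act k (deg_comp X g)) ((act k).map (inc X g)) (𝟙 Y) ≫ f') :
    f = f' := by
  refine tens_ext fun l => ?_
  have e : inc ((act k).obj X) l = ∑ g : G, inc ((act k).obj X) l ≫ (act k).map (prj X g) ≫
      (act k).map (inc X g) := by
    rw [← Preadditive.comp_sum]
    simp only [← Functor.map_comp]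
    rw [← Functor.map_sum, sum_prj_inc]
    simp
  -- k(X_g) has degree kgk⁻¹, so only g = k⁻¹lk meets the component of degree l.
  rw [e, ← Finset.sum_subset (Finset.subset_univ {k⁻¹ * l * k}) ?_, Finset.sum_singleton]
  · have hd : deg l ((act k).obj (comp X (k⁻¹ * l * k))) := by
      simpa [mul_assoc] using IsBraidedCrossed.deg_act k (deg_comp X (k⁻¹ * l * k))
    have := h (k⁻¹ * l * k)
    have e₁ {m n : G} (e₁ : m = n) (hm : deg m ((act k).obj (comp X (k⁻¹ * l * k))))
      (hn : deg n ((act k).obj (comp X (k⁻¹ * l * k))))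
      (this : into hm ((act k).map (inc X (k⁻¹ * l * k))) (𝟙 Y) ≫ f = into hm ((act k).map (inc X (k⁻¹ * l * k))) (𝟙 Y) ≫ f') :
      into hn ((act k).map (inc X (k⁻¹ * l * k))) (𝟙 Y) ≫ f = into hn ((act k).map (inc X (k⁻¹ * l * k))) (𝟙 Y) ≫ f' := by
      subst e₁
      exact this
    rw [← Category.assoc (inc ((act k).obj X) l), ← whiskerRight_into hd, Category.assoc,
      Category.assoc, e₁ (by group) _ hd (h (k⁻¹ * l * k))]
  · intro m _ hm
    have hz : inc ((act k).obj X) l ≫ (act k).map (prj X m) = 0 := by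
      refine IsBraidedCrossed.deg_orthogonal (G := G) ?_ (deg_comp _ l)
        (IsBraidedCrossed.deg_act k (deg_comp X m)) _
      rintro rfl
      simp [mul_assoc] at hm
    rw [reassoc_of% hz, zero_comp]

lemma into_actμ (k : G) {g : G} {W X V Y : C} (hW : deg g W) (f : W ⟶ X) (f' : V ⟶ Y) :
    into (IsBraidedCrossed.deg_act k hW) ((act k).map f) ((act k).map f') ≫ actμ k X Y =
      _ ◁ (γ (show (k * g * k⁻¹)⁻¹ * k = k * g⁻¹ by group) V ≫
        inv (γ (rfl : k * g⁻¹ = k * g⁻¹) V)) ≫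
      μ k W ((act g⁻¹).obj V) ≫ (act k).map (into hW f f') := by
  rw [actμ, Preadditive.comp_sum, Finset.sum_eq_single g]
  · have h₁ := IsAction.γ_natural (show (k * g * k⁻¹)⁻¹ * k = k * g⁻¹ by group) f'
    have h₂ := inv_γ_natural (rfl : k * g⁻¹ = k * g⁻¹) f'
    rw [reassoc_of% into_outof, Category.comp_id, MonoidalCategory.tensorHom_def', Category.assoc,
      whisker_exchange_assoc, ← whiskerLeft_comp_assoc, reassoc_of% h₁, h₂, ← Category.assoc (γ _ _),
      whiskerLeft_comp_assoc, ← whisker_exchange_assoc, ← (act k).map_comp, reassoc_of% μ_natural_right,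
      reassoc_of% μ_natural_left, ← Functor.map_comp, ← Functor.map_comp, into,
      MonoidalCategory.tensorHom_def, Category.assoc]
  · intro h _ hne
    rw [← Category.assoc, into_outof_ne, zero_comp]
    intro he
    exact hne (by simpa using he.symm)
  · simp

lemma actμ_toOp (k : G) (X Y : C) :
    actμ k X Y ≫ (act k).map (toOp G X Y) = toOp G ((act k).obj X) ((act k).obj Y) ≫ μ k Y X :=
  tens_act_ext k fun g => by
    have h := into_actμ k (deg_comp X g) (inc X g) (𝟙 Y)
    rw [(act k).map_id] at h
    rw [reassoc_of% h, ← Functor.map_comp, into_toOp, reassoc_of% into_toOp, Functor.map_comp,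
      reassoc_of% (flip_act (mul_inv_cancel g) k (show (k * g * k⁻¹)⁻¹ * k = k * g⁻¹ by group) rfl
        (mul_inv_cancel _) (deg_comp X g) (IsBraidedCrossed.deg_act k (deg_comp X g)))]
    rw [id_tensorHom, id_tensorHom, ← μ_natural_right]
    simp only [← whiskerLeft_comp_assoc, Category.assoc, IsIso.inv_hom_id_assoc, IsIso.hom_inv_id,
      whiskerLeft_id, Category.id_comp]

/-- `crossed` is built from inverse crossed braidings and `toOp` applies the same braidings, so they
cancel on every component of Y. What remains is the identification of X ⊗^rev Y with X ⊗ a⁻¹(Y). All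
comparisons of braidings below rest on this cancellation. -/
lemma crossed_toOp {a : G} {X : C} (hX : deg a X) (Y : C) :
    crossed hX Y ≫ toOp G ((act a⁻¹).obj Y) X = outof hX (𝟙 X) (𝟙 Y) := by
  rw [crossed, Category.assoc, Preadditive.sum_comp]
  have h (h : G) : X ◁ (act a⁻¹).map (prj Y h) ≫
    (ι rfl X ≫ inv (γ (mul_inv_cancel (a⁻¹ * h * a⁻¹⁻¹)) X)) ▷ (act a⁻¹).obj (comp Y h) ≫
    inv (cb (IsBraidedCrossed.deg_act a⁻¹ (deg_comp Y h))
      ((act (a⁻¹ * h * a⁻¹⁻¹)⁻¹).obj X)) ≫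
    into (IsBraidedCrossed.deg_act a⁻¹ (deg_comp Y h)) ((act a⁻¹).map (inc Y h)) (𝟙 X) ≫
      toOp G ((act a⁻¹).obj Y) X =
      X ◁ (act a⁻¹).map (prj Y h) ≫ X ◁ (act a⁻¹).map (inc Y h) := by
    rw [into_toOp, flip_hom, Category.assoc, IsIso.inv_hom_id_assoc, ← comp_whiskerRight_assoc,
      cancel_hom]
    simp
  simp only [Category.assoc, h, ← whiskerLeft_comp, ← Functor.map_comp]
  rw [← whiskerLeft_sum, ← Functor.map_sum, sum_prj_inc]
  simp

lemma toOp_eq_outof {a : G} {X : C} (hX : deg a X) (Y : C) :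
    toOp G X Y = outof hX (𝟙 X) (𝟙 Y) ≫ (flip (mul_inv_cancel a) hX Y).hom :=
  tens_ext fun g => by
    rw [into_toOp]
    obtain rfl | hne := eq_or_ne g a
    · rw [reassoc_of% into_outof, flip_natural _ (deg_comp X g)]
      simp
    · rw [IsBraidedCrossed.deg_orthogonal (G := G) hne (deg_comp X g) hX (inc X g), into_zero]
      simp

end Comparison

end Rev

/-! ### C^rev is a braided crossed fusion category -/

namespace Rev

section CrossedStructure

variable (G : Type*) [Group G] [Fintype G] (C : Type*) [Category C]

/-- The identity functor from `C^rev` to `C` with the opposite tensor product. -/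
def opFunctor : Rev G C ⥤ TensorOp C where
  obj X := (X : C)
  map f := f

instance : (opFunctor G C).IsEquivalence where
  faithful := ⟨fun h => h⟩
  full := ⟨fun f => ⟨f, rfl⟩⟩
  essSurj := ⟨fun X => ⟨(X : C), ⟨Iso.refl _⟩⟩⟩

variable [Preadditive C]

instance : (opFunctor G C).Additive where

variable [HasFiniteBiproducts C] [MonoidalCategory C] [MonoidalPreadditive C] [CrossedData G C]
  [IsBraidedCrossed G C]

/-- The comparison map leads from the tensor product of C^rev to the opposite one, which is the
oplax direction; the lax structure is recovered as its inverse. -/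
noncomputable instance : (opFunctor G C).OplaxMonoidal where
  η := 𝟙 (𝟙_ C)
  δ X Y := toOp G (C := C) X Y
  δ_natural_left {X Y} f X' := by
    have h (X Y X' : C) (f : X ⟶ Y) : toOp G X X' ≫ X' ◁ f = tensMap G f (𝟙 X') ≫ toOp G Y X' := by
      rw [tensMap_toOp, id_tensorHom]
    exact h X Y X' f
  δ_natural_right {X Y} X' f := by
    have h (X Y X' : C) (f : X ⟶ Y) : toOp G X' X ≫ f ▷ X' = tensMap G (𝟙 X') f ≫ toOp G X' Y := by
      rw [tensMap_toOp, tensorHom_id]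
    exact h X Y X' f
  oplax_associativity X Y Z := toOp_assoc (G := G) (C := C) X Y Z
  oplax_left_unitality X := by
    have h (X : C) : (ρ_ X).inv = (leftU G X).inv ≫ toOp G (𝟙_ C) X ≫ X ◁ 𝟙 (𝟙_ C) := by
      rw [whiskerLeft_id, Category.comp_id, leftU_inv_toOp]
    exact h X
  oplax_right_unitality X := by
    have h (X : C) : (λ_ X).inv = rightInv G X ≫ toOp G X (𝟙_ C) ≫ 𝟙 (𝟙_ C) ▷ X := by
      rw [id_whiskerRight, Category.comp_id, rightInv_toOp]
    exact h X

instance : IsIso (Functor.OplaxMonoidal.η (opFunctor G C)) :=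
  inferInstanceAs (IsIso (𝟙 (𝟙_ C)))

instance (X Y : Rev G C) : IsIso (Functor.OplaxMonoidal.δ (opFunctor G C) X Y) :=
  inferInstanceAs (IsIso (opIso G (C := C) X Y).hom)

noncomputable instance : (opFunctor G C).Monoidal := Functor.Monoidal.ofOplaxMonoidal _

variable {G C} in
lemma μ_opFunctor (X Y : Rev G C) :
    Functor.LaxMonoidal.μ (opFunctor G C) X Y = ofOp G (C := C) X Y := by
  have h : Functor.OplaxMonoidal.δ (opFunctor G C) X Y ≫ ofOp G (C := C) X Y = 𝟙 _ :=
    (opIso G (C := C) X Y).hom_inv_id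
  exact (cancel_epi (Functor.OplaxMonoidal.δ (opFunctor G C) X Y)).1
    ((Functor.Monoidal.δ_μ _ _ _).trans h.symm)

variable {G C} in
lemma ε_opFunctor : Functor.LaxMonoidal.ε (opFunctor G C) = 𝟙 (𝟙_ C) := by
  exact (cancel_epi (Functor.OplaxMonoidal.η (opFunctor G C))).1
    ((Functor.Monoidal.η_ε _).trans (Category.comp_id (𝟙 (𝟙_ C))).symm)

variable {G C} in
lemma actμ_ofOp (k : G) (X Y : C) : ofOp G ((act k).obj X) ((act k).obj Y) ≫ actμ k X Y =
    μ k Y X ≫ (act k).map (ofOp G X Y) := by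
  rw [← opIso_inv, ← opIso_inv, Iso.inv_comp_eq, ← Functor.mapIso_inv, ← Category.assoc,
    Iso.eq_comp_inv]
  exact actμ_toOp k X Y

variable {G C} in
-- Accounts for the transport between (g⁻¹)⁻¹(Y), where `crossed` ends, and g(Y), which the crossed
-- structure requires.
lemma flip_hom_inv_eqToHom {a b c : G} (eb : a * b = 1) (ec : a * c = 1) (h : b = c) {X : C} (hX : deg a X)
    (Y : C) : (flip eb hX Y).hom ≫ (flip ec hX Y).inv = X ◁ eqToHom (by rw [h]) := by
  subst h
  simp

variable {G C} in
lemma crossed_ofOp {a b : G} (e : a * b = 1) (h : a⁻¹ = b) {X : C} (hX : deg a X) (Y : C) :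
    ofOp G X Y ≫ crossed hX Y ≫ tensMap G (eqToHom (by rw [h])) (𝟙 X) =
      (flip e hX Y).inv ≫ ofOp G ((act b).obj Y) X := by
  rw [← opIso_inv, ← opIso_inv, Iso.inv_comp_eq, ← Category.assoc (opIso G X Y).hom,
    Iso.eq_comp_inv, opIso_hom, opIso_hom, Category.assoc, tensMap_toOp, ← Category.assoc (crossed hX Y),
    crossed_toOp, toOp_eq_outof hX, Category.assoc, flip_hom_inv_eqToHom _ _ h, id_tensorHom]

/-- `C^rev` and `C` with the opposite tensor product are isomorphic braided `G`-crossed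
categories. -/
noncomputable def opStructure : CrossedStructure G (opFunctor G C) where
  deg_iff g X := Iff.rfl
  η g X := Iso.refl _
  η_natural g X Y f := (Category.comp_id _).trans (Category.id_comp _).symm
  η_γ {g h l} e X := by
    change γ (C := C) e X ≫ 𝟙 _ = 𝟙 _ ≫ (act g).map (𝟙 _) ≫ γ (C := C) e X
    rw [CategoryTheory.Functor.map_id, Category.comp_id, Category.id_comp, Category.id_comp]
  η_ι e X := Category.comp_id _
  η_μ g X Y := by
    rw [μ_opFunctor, μ_opFunctor]
    have h (X Y : C) : ofOp G ((act g).obj X) ((act g).obj Y) ≫ actμ g X Y ≫ 𝟙 _ =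
        (𝟙 _ ⊗ₘ 𝟙 _) ≫ μ g Y X ≫ (act g).map (ofOp G X Y) := by
      rw [Category.comp_id, MonoidalCategory.id_tensorHom_id, Category.id_comp, actμ_ofOp]
    exact h X Y
  η_ε g := by
    rw [ε_opFunctor]
    have h : 𝟙 (𝟙_ C) ≫ ε (C := C) g ≫ 𝟙 _ = ε (C := C) g ≫ (act g : C ⥤ C).map (𝟙 _) := by
      rw [CategoryTheory.Functor.map_id, Category.id_comp]
    exact h
  cb_compat {g X} hX Y := by
    rw [μ_opFunctor, μ_opFunctor]
    have h (X Y : C) (hX : deg g⁻¹ X) :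
        ofOp G X Y ≫ crossed hX Y ≫ tensMap G (eqToHom (by rw [inv_inv])) (𝟙 X) =
          (flip (inv_mul_cancel g) hX Y).inv ≫ X ◁ 𝟙 _ ≫ ofOp G ((act g).obj Y) X := by
      rw [whiskerLeft_id, Category.id_comp, crossed_ofOp _ (inv_inv g)]
    exact h X Y hX

-- The axioms are pulled back from the opposite tensor product along the identity functor.
scoped instance isBraidedCrossed : IsBraidedCrossed G (Rev G C) := (opStructure G C).isBraidedCrossed

variable {C} in
lemma nonempty_rigid (h : Nonempty (RigidCategory C)) : Nonempty (RigidCategory (Rev G C)) := by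
  obtain ⟨h⟩ := h
  exact ⟨rigidCategoryOfEquivalence (F := opFunctor G C) (opFunctor G C).asEquivalence.toAdjunction⟩

end CrossedStructure

section Linear

variable {G : Type*} [Group G] [Fintype G] {C : Type*} [Category C] [Preadditive C]
  [HasFiniteBiproducts C] [MonoidalCategory C] [MonoidalPreadditive C] [CrossedData G C]
  [IsBraidedCrossed G C]

lemma tensMap_add_left {X X' Y Y' : C} (f₁ f₂ : X ⟶ X') (f' : Y ⟶ Y') :
    tensMap G (f₁ + f₂) f' = tensMap G f₁ f' + tensMap G f₂ f' := by
  simp only [tensMap, ← Finset.sum_add_distrib, Preadditive.add_comp, Preadditive.comp_add,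
    MonoidalPreadditive.add_tensor]

lemma tensMap_add_right {X X' Y Y' : C} (f : X ⟶ X') (f₁ f₂ : Y ⟶ Y') :
    tensMap G f (f₁ + f₂) = tensMap G f f₁ + tensMap G f f₂ := by
  simp only [tensMap, ← Finset.sum_add_distrib, Preadditive.add_comp, Preadditive.comp_add,
    MonoidalPreadditive.tensor_add, Functor.map_add]

instance : MonoidalPreadditive (Rev G C) where
  whiskerLeft_zero {X Y Z} := by
    have h (X Y Z : C) : tensMap G (𝟙 X) (0 : Y ⟶ Z) = 0 := by
      simpa using tensMap_add_right (G := G) (𝟙 X) (0 : Y ⟶ Z) 0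
    exact h X Y Z
  zero_whiskerRight {X Y Z} := by
    have h (X Y Z : C) : tensMap G (0 : Y ⟶ Z) (𝟙 X) = 0 := by
      simpa using tensMap_add_left (G := G) (0 : Y ⟶ Z) 0 (𝟙 X)
    exact h X Y Z
  whiskerLeft_add {X Y Z} f f' := by
    have h (X Y Z : C) (f f' : Y ⟶ Z) := tensMap_add_right (G := G) (𝟙 X) f f'
    exact h X Y Z f f'
  add_whiskerRight {X Y Z} f f' := by
    have h (X Y Z : C) (f f' : Y ⟶ Z) := tensMap_add_left (G := G) f f' (𝟙 X)
    exact h X Y Z f f'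

variable {k : Type*} [Field k] [Linear k C]

lemma actLinear [∀ g : G, (act g : C ⥤ C).Linear k] (g : G) : (act g : Rev G C ⥤ Rev G C).Linear k where
  map_smul {X Y} f r := by
    have h (X Y : C) (f : X ⟶ Y) : (act g).map (r • f) = r • (act g).map f := Functor.map_smul _ _ _
    exact h X Y f

variable [MonoidalLinear k C]

lemma tensMap_smul_left {X X' Y Y' : C} (r : k) (f : X ⟶ X') (f' : Y ⟶ Y') :
    tensMap G (r • f) f' = r • tensMap G f f' := by
  simp only [tensMap, Finset.smul_sum, Linear.smul_comp, Linear.comp_smul, MonoidalCategory.tensorHom_def,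
    MonoidalLinear.smul_whiskerRight]

variable [∀ g : G, (act g : C ⥤ C).Linear k]

lemma tensMap_smul_right {X X' Y Y' : C} (r : k) (f : X ⟶ X') (f' : Y ⟶ Y') :
    tensMap G f (r • f') = r • tensMap G f f' := by
  simp only [tensMap, Finset.smul_sum, Linear.smul_comp, Linear.comp_smul, MonoidalCategory.tensorHom_def,
    MonoidalLinear.whiskerLeft_smul, Functor.map_smul]

instance : MonoidalLinear k (Rev G C) where
  whiskerLeft_smul X Y Z r f := by
    have h (X Y Z : C) (f : Y ⟶ Z) := tensMap_smul_right (G := G) r (𝟙 X) f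
    exact h X Y Z f
  smul_whiskerRight r Y Z f X := by
    have h (X Y Z : C) (f : Y ⟶ Z) := tensMap_smul_left (G := G) r f (𝟙 X)
    exact h X Y Z f

/-- The linear category and the unit object are those of `C`. Only bilinearity of the tensor product
and rigidity involve ⊗^rev. -/
lemma isFusion (h : IsFusion k C) : IsFusion k (Rev G C) where
  abelian := h.abelian
  tensor_additive := inferInstance
  tensor_linear := inferInstance
  rigid := nonempty_rigid G h.rigid
  simple_unit := h.simple_unit
  finite_hom := h.finite_hom
  semisimple := h.semisimple
  finite_simples := h.finite_simples

lemma isBraidedCrossedFusion (h : IsFusion k C) : IsBraidedCrossedFusion k G (Rev G C) where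
  fusion := isFusion h
  act_linear := actLinear
  crossed := inferInstance

end Linear

end Rev

/-! ### Normalization of equivariant structures -/

namespace Equivariant

/-- Not part of the definition of an equivariant object: the cocycle condition for (1,1) gives γ =
1(v_1), because v_1 can be cancelled, and unitality of γ does the rest. -/
lemma v_ι {G : Type*} [Group G] {C : Type*} [Category C] [Preadditive C] [MonoidalCategory C]
    [CrossedData G C] [IsAction G C] (Y : Equivariant G C) {u : G} (e : u = 1) :
    (Y.v u).hom ≫ ι e Y.obj = 𝟙 _ := by
  have e' : u * u = u := by rw [e, mul_one]
  have h := Y.v_mul e'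
  rw [cancel_mono] at h
  rw [IsAction.ι_natural, ← h, IsAction.γ_left_unitality]

lemma ι_v {G : Type*} [Group G] {C : Type*} [Category C] [Preadditive C] [MonoidalCategory C]
    [CrossedData G C] [IsAction G C] (Y : Equivariant G C) {u : G} (e : u = 1) :
    ι e Y.obj ≫ (Y.v u).hom = 𝟙 _ := by
  rw [← cancel_mono (ι e Y.obj), Category.assoc, v_ι, Category.id_comp, Category.comp_id]

lemma v_cancel {G : Type*} [Group G] {C : Type*} [Category C] [Preadditive C] [MonoidalCategory C]
    [CrossedData G C] [IsAction G C] (Y : Equivariant G C) {a g : G} (e : a * g = 1) :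
    (act a).map (Y.v g).hom ≫ (Y.v a).hom = (cancel e Y.obj).hom := by
  rw [← cancel_mono (ι (rfl : (1 : G) = 1) Y.obj), ← Y.v_mul e, cancel_hom_ι, Category.assoc, v_ι,
    Category.comp_id]

end Equivariant

/-! ### The isomorphism X ⊗^rev Y ≅ X ⊗ Y for equivariant Y -/

namespace Rev

section RevTensor

variable {G : Type*} [Group G] [Fintype G] {C : Type*} [Category C] [Preadditive C]
  [HasFiniteBiproducts C] [MonoidalCategory C] [MonoidalPreadditive C] [CrossedData G C]
  [IsBraidedCrossed G C]

/-- The isomorphism `X ⊗^rev Y ⟶ X ⊗ Y` for an object `Y` with isomorphisms `g(Y) ≅ Y`. -/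
noncomputable def untwist (X : C) {Y : C} (y : ∀ g : G, (act g).obj Y ≅ Y) : tens G X Y ⟶ X ⊗ Y :=
  ∑ g : G, tp X Y g ≫ (inc X g ⊗ₘ (y g⁻¹).hom)

lemma into_untwist {g : G} {W X V Y : C} (hW : deg g W) (y : ∀ g : G, (act g).obj Y ≅ Y)
    (f : W ⟶ X) (f' : V ⟶ Y) :
    into hW f f' ≫ untwist X y = (f ⊗ₘ (act g⁻¹).map f' ≫ (y g⁻¹).hom) := by
  have h := comp_prj_inc hW f
  rw [untwist, Preadditive.comp_sum, Finset.sum_eq_single g]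
  · rw [into, Category.assoc, reassoc_of% ti_tp, MonoidalCategory.tensorHom_comp_tensorHom,
      Category.assoc, h]
  · intro l _ hne
    rw [into, Category.assoc, reassoc_of% (ti_tp_ne X Y hne.symm), zero_comp, comp_zero]
  · simp

/-- The inverse of `untwist`. -/
noncomputable def retwist (X : C) {Y : C} (y : ∀ g : G, (act g).obj Y ≅ Y) : X ⊗ Y ⟶ tens G X Y :=
  ∑ g : G, (prj X g ⊗ₘ (y g⁻¹).inv) ≫ ti X Y g

lemma whisker_retwist {g : G} {W X Y : C} (hW : deg g W) (y : ∀ g : G, (act g).obj Y ≅ Y)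
    (f : W ⟶ X) :
    f ▷ Y ≫ retwist X y = W ◁ (y g⁻¹).inv ≫ into hW f (𝟙 _) := by
  rw [retwist, Preadditive.comp_sum, Finset.sum_eq_single g]
  · rw [into, MonoidalCategory.tensorHom_def, Category.assoc, ← comp_whiskerRight_assoc,
      CategoryTheory.Functor.map_id, tensorHom_id, whisker_exchange_assoc]
  · intro l _ hne
    rw [MonoidalCategory.tensorHom_def, Category.assoc, ← comp_whiskerRight_assoc,
      comp_prj_eq_zero hW f hne.symm]
    simp
  · simp

/-- The isomorphism `X ⊗^rev Y ≅ X ⊗ Y` for an object `Y` with isomorphisms `g(Y) ≅ Y`. -/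
@[simps] noncomputable def untwistIso (X : C) {Y : C} (y : ∀ g : G, (act g).obj Y ≅ Y) :
    tens G X Y ≅ X ⊗ Y where
  hom := untwist X y
  inv := retwist X y
  hom_inv_id := tens_ext fun g => by
    rw [reassoc_of% into_untwist, MonoidalCategory.tensorHom_def', Category.assoc,
      whisker_retwist (deg_comp X g), (act g⁻¹).map_id, Category.id_comp, Category.comp_id,
      ← whiskerLeft_comp_assoc]
    simp
  inv_hom_id := whisker_component_ext (G := G) fun g => by
    rw [reassoc_of% (whisker_retwist (deg_comp X g)), into_untwist]
    simp [MonoidalCategory.tensorHom_def']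

/-- Only the second factor is twisted, so `f` may be any morphism of `C`. This freedom is needed
later for idempotents and projections that are not equivariant. -/
lemma tensMap_untwist {X X' : C} (f : X ⟶ X') {Y Y' : C} {y : ∀ g : G, (act g).obj Y ≅ Y}
    {y' : ∀ g : G, (act g).obj Y' ≅ Y'} (f' : Y ⟶ Y')
    (h : ∀ g, (act g).map f' ≫ (y' g).hom = (y g).hom ≫ f') :
    tensMap G f f' ≫ untwist X' y' = untwist X y ≫ (f ⊗ₘ f') :=
  tens_ext fun g => by
    rw [reassoc_of% into_tensMap, into_untwist, reassoc_of% into_untwist, Category.id_comp, h,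
      MonoidalCategory.tensorHom_comp_tensorHom, CategoryTheory.Functor.map_id, Category.id_comp]

/-- On the summand X_g one side uses v_k ∘ k(v_{g⁻¹}), the other v_{kg⁻¹k⁻¹} applied after v_k; up
to γ both are v_{kg⁻¹} by the cocycle condition. So the tensor structure is equivariant. -/
lemma actμ_untwist (k : G) {X : C} (x : (act k).obj X ≅ X) (Y : Equivariant G C) :
    actμ k X Y.obj ≫ (act k).map (untwist X Y.v) ≫ (Equivariant.tensV x (Y.v k)).hom =
      tensMap G x.hom (Y.v k).hom ≫ untwist X Y.v :=
  tens_act_ext k fun g => by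
    have h := into_actμ k (deg_comp X g) (inc X g) (𝟙 Y.obj)
    rw [(act k).map_id] at h
    rw [reassoc_of% h, ← Functor.map_comp_assoc, into_untwist, reassoc_of% into_tensMap, into_untwist,
      ← reassoc_of% IsAction.μ_natural, Equivariant.μ_tensV, ← id_tensorHom,
      MonoidalCategory.tensorHom_comp_tensorHom, MonoidalCategory.tensorHom_comp_tensorHom,
      (act g⁻¹).map_id, Category.id_comp, Category.id_comp, Category.id_comp, Category.assoc,
      ← Y.v_mul rfl, IsIso.inv_hom_id_assoc, Y.v_mul]

instance (k : G) (X Y : C) : IsIso (actμ k X Y) := by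
  have h (X Y : Rev G C) : IsIso (μ k X Y) := inferInstance
  exact h X Y

/-- The family `w` plays the part of the equivariant structure of Y ⊗^rev Z. Only `hw` is assumed of
it, so the lemma serves both for objects of (C^rev)^G and for a structure carried over from Y ⊗ Z.
-/
lemma untwist_assoc (X : C) {Y : C} (y : ∀ g : G, (act g).obj Y ≅ Y) (Z : Equivariant G C)
    (w : ∀ g : G, (act g).obj (tens G Y Z.obj) ≅ tens G Y Z.obj)
    (hw : ∀ g, actμ g Y Z.obj ≫ (w g).hom = tensMap G (y g).hom (Z.v g).hom) :
    untwist (tens G X Y) Z.v ≫ untwist X y ▷ Z.obj ≫ (α_ _ _ _).hom =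
      assocHom X Y Z.obj ≫ untwist X w ≫ X ◁ untwist Y Z.v := by
  have h₁ (g : G) : (w g).hom ≫ untwist Y Z.v =
      (act g).map (untwist Y Z.v) ≫ (Equivariant.tensV (y g) (Z.v g)).hom := by
    rw [← cancel_epi (actμ g Y Z.obj), reassoc_of% hw, actμ_untwist]
  refine tens_ext₃ fun g h l e => ?_
  have hW := deg_comp X g
  have hV := deg_comp Y h
  rw [reassoc_of% into_untwist, reassoc_of% (into_assocHom e hW hV), reassoc_of% into_untwist,
    ← tensorHom_id, MonoidalCategory.tensorHom_comp_tensorHom_assoc, into_untwist,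
    ← id_tensorHom X (untwist _ _),
    MonoidalCategory.tensorHom_comp_tensorHom, Category.assoc, Category.assoc, h₁, ← Functor.map_comp_assoc,
    into_untwist, assocCore_hom, Category.assoc, ← id_tensorHom (comp X g),
    MonoidalCategory.tensorHom_comp_tensorHom, Category.assoc, ← reassoc_of% IsAction.μ_natural,
    Equivariant.μ_tensV, ← id_tensorHom, MonoidalCategory.tensorHom_comp_tensorHom_assoc,
    MonoidalCategory.tensorHom_comp_tensorHom]
  have e₁ : g⁻¹ * h⁻¹ = l⁻¹ := by rw [← e, mul_inv_rev]
  simp only [CategoryTheory.Functor.map_id, Category.comp_id, Category.id_comp, Category.assoc]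
  rw [MonoidalCategory.associator_naturality, ← Z.v_mul e₁, IsIso.inv_hom_id_assoc]

lemma leftU_inv_untwist (X : Equivariant G C) :
    (leftU G X.obj).inv ≫ untwist (𝟙_ C) X.v = (λ_ X.obj).inv := by
  rw [leftU]
  dsimp only
  rw [Category.assoc, Category.assoc, into_untwist, (act _).map_id, Category.id_comp, id_tensorHom,
    ← whiskerLeft_comp, Equivariant.ι_v, whiskerLeft_id, Category.comp_id]

lemma rightInv_untwist (X : C) :
    rightInv G X ≫ untwist X (fun g => (asIso (ε g : 𝟙_ C ⟶ _)).symm) = (ρ_ X).inv :=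
  map_component_ext (G := G) (𝟭 C) fun g => by
    change inc X g ≫ _ = inc X g ≫ _
    rw [reassoc_of% (comp_rightInv (deg_comp X g)), into_untwist]
    simp [MonoidalCategory.tensorHom_def']

/-- By the cocycle condition v_g ∘ g(v_{g⁻¹}) is the canonical g(g⁻¹(Y)) ≅ Y
(`Equivariant.v_cancel`). This links the braiding of C^G with the comparison to the opposite tensor
product. -/
lemma untwist_braidHom (X : C) (Y : Equivariant G C) :
    untwist X Y.v ≫ Equivariant.braidHom X Y.v = toOp G X Y.obj :=
  tens_ext fun g => by
    rw [reassoc_of% into_untwist, into_toOp, MonoidalCategory.tensorHom_def', Category.assoc,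
      Equivariant.whisker_braidHom _ (deg_comp X g), reassoc_of% cb_natural_right,
      ← comp_whiskerRight_assoc, (act g⁻¹).map_id, Category.id_comp,
      Equivariant.v_cancel _ (mul_inv_cancel g), flip_hom, Category.assoc, id_tensorHom]

lemma into_one_tensMap {g : G} {W X V Y : C} (hW : deg g W) (f : W ⟶ X) (f' : V ⟶ Y) :
    into hW (𝟙 W) (𝟙 V) ≫ tensMap G f f' = into hW f f' := by
  rw [into_tensMap, Category.id_comp, Category.id_comp]

variable (G C) in
/-- An object of `(C^rev)^G` as an object of `C^G`. -/
abbrev ofRev (X : Equivariant G (Rev G C)) : Equivariant G C := (revIdentity G C).obj X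

lemma tensMap_revBraiding (X Y : Equivariant G (Rev G C)) {g : G} {W : C} (hW : deg g⁻¹⁻¹ W)
    (f : W ⟶ (ofRev G C X).obj) :
    tensMap G f (𝟙 _) ≫ Equivariant.Hom.hom (β_ X Y).hom =
      (crossed hW _ ≫ tensMap G (eqToHom (by rw [inv_inv]; rfl)) (𝟙 _)) ≫
        tensMap G ((ofRev G C Y).v g⁻¹).hom (𝟙 W) ≫ tensMap G (𝟙 _) f := by
  have h (W : Rev G C) (hW : deg g⁻¹ W) (f : W ⟶ X.obj) :=
    Equivariant.whisker_braidHom (C := Rev G C) Y.v hW f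
  exact h W hW f

/-- The braiding of `(C^rev)^G` corresponds to the inverse braiding of `C^G`. -/
lemma revBraiding_untwist (X Y : Equivariant G (Rev G C)) :
    (show tens G (ofRev G C X).obj (ofRev G C Y).obj ⟶ tens G (ofRev G C Y).obj (ofRev G C X).obj
      from Equivariant.Hom.hom (β_ X Y).hom) ≫ untwist (ofRev G C Y).obj (ofRev G C X).v =
      untwist (ofRev G C X).obj (ofRev G C Y).v ≫
        Equivariant.braidInv (ofRev G C Y).obj (ofRev G C X).v := by
  have : IsIso (Equivariant.braidHom (ofRev G C Y).obj (ofRev G C X).v) :=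
    (Equivariant.braidIso (ofRev G C Y).obj (ofRev G C X).v).isIso_hom
  have hi : Equivariant.braidInv (ofRev G C Y).obj (ofRev G C X).v ≫
      Equivariant.braidHom (ofRev G C Y).obj (ofRev G C X).v = 𝟙 _ :=
    (Equivariant.braidIso (ofRev G C Y).obj (ofRev G C X).v).inv_hom_id
  -- A morphism `b` which is the inverse crossed braiding followed by v on each component: after
  -- `toOp` the braidings cancel by `crossed_toOp`, and just the v_{g⁻¹} remain, which is `untwist`.
  have key (X Y : C) (y : ∀ g : G, (act g).obj Y ≅ Y) (b : tens G X Y ⟶ tens G Y X)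
      (h : ∀ g (hW : deg (g⁻¹)⁻¹ (comp X g)), tensMap G (inc X g) (𝟙 Y) ≫ b =
        (crossed hW Y ≫ tensMap G (eqToHom (by rw [inv_inv])) (𝟙 _)) ≫
        tensMap G (y g⁻¹).hom (𝟙 (comp X g)) ≫ tensMap G (𝟙 Y) (inc X g)) :
      b ≫ toOp G Y X = untwist X y := by
    refine tens_ext fun g => ?_
    have hW := deg_comp X g
    have hW' : deg (g⁻¹)⁻¹ (comp X g) := by rwa [inv_inv]
    have e {a b : G} (e : a = b) {W : C} (ha : deg a W) (hb : deg b W) :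
        into hb (𝟙 W) (𝟙 Y) ≫ outof ha (𝟙 W) (𝟙 Y) = W ◁ eqToHom (by rw [e]) := by
      subst e
      simp [into_outof]
    rw [← into_one_tensMap, Category.assoc, reassoc_of% (h g hW'), tensMap_toOp,
      reassoc_of% tensMap_toOp, reassoc_of% tensMap_toOp, reassoc_of% crossed_toOp,
      reassoc_of% (e (inv_inv g) hW' hW), Category.assoc,
      reassoc_of% into_tensMap, into_untwist]
    simp [MonoidalCategory.tensorHom_def', whisker_exchange]
  -- Composing with the braiding of C^G cancels its inverse on the right and, by `untwist_braidHom`,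
  -- produces `toOp` on the left.
  rw [← cancel_mono (Equivariant.braidHom (ofRev G C Y).obj (ofRev G C X).v), Category.assoc,
    Category.assoc, hi, Category.comp_id, untwist_braidHom]
  exact key _ _ _ _ fun g hW => tensMap_revBraiding X Y hW _

end RevTensor

/-! ### Part (a): the identity functor as a braided equivalence -/

section Identity

variable (G : Type*) [Group G] [Fintype G] (C : Type*) [Category C] [Preadditive C]
  [HasFiniteBiproducts C] [MonoidalCategory C] [MonoidalPreadditive C] [CrossedData G C]
  [IsBraidedCrossed G C]

instance : (revIdentity G C).IsEquivalence where
  faithful := ⟨fun h => Equivariant.hom_ext (congrArg (Equivariant.Hom.hom (G := G) (C := C)) h)⟩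
  full := ⟨fun f => ⟨⟨Equivariant.Hom.hom (G := G) (C := C) f, Equivariant.Hom.comm (G := G) (C := C) f⟩, rfl⟩⟩
  essSurj := ⟨fun X => ⟨⟨X.obj, X.v, X.v_mul⟩, ⟨Iso.refl _⟩⟩⟩

variable {G C} in
lemma untwist_comm (X Y : Equivariant G (Rev G C)) (k : G) :
    (act k).map (untwist (ofRev G C X).obj (ofRev G C Y).v) ≫
        (Equivariant.tensV ((ofRev G C X).v k) ((ofRev G C Y).v k)).hom =
      ((ofRev G C (X ⊗ Y)).v k).hom ≫ untwist (ofRev G C X).obj (ofRev G C Y).v := by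
  have h : actμ k (ofRev G C X).obj (ofRev G C Y).obj ≫ ((ofRev G C (X ⊗ Y)).v k).hom =
      tensMap G ((ofRev G C X).v k).hom ((ofRev G C Y).v k).hom :=
    Equivariant.μ_tensV (C := Rev G C) (X.v k) (Y.v k)
  have h₁ := actμ_untwist k ((ofRev G C X).v k) (ofRev G C Y)
  exact (cancel_epi (actμ k (ofRev G C X).obj (ofRev G C Y).obj)).1
    (h₁.trans (by rw [← h]; exact Category.assoc _ _ _))

/-- The tensor structure of `revIdentity`. -/
noncomputable def revTensorIso (X Y : Equivariant G (Rev G C)) :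
    ofRev G C (X ⊗ Y) ≅ ofRev G C X ⊗ ofRev G C Y :=
  Equivariant.mkIso (untwistIso (ofRev G C X).obj (ofRev G C Y).v) fun k => untwist_comm X Y k

noncomputable scoped instance : (revIdentity G C).OplaxMonoidal where
  η := 𝟙 (𝟙_ (Equivariant G C))
  δ X Y := (revTensorIso G C X Y).hom
  δ_natural_left {X Y} f X' := by
    have h (X Y X' : Equivariant G C) (f : X ⟶ Y) : untwist X.obj X'.v ≫ f.hom ▷ X'.obj =
        tensMap G f.hom (𝟙 X'.obj) ≫ untwist Y.obj X'.v := by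
      rw [tensMap_untwist _ (y := X'.v) _ (by simp), tensorHom_id]
    exact Equivariant.hom_ext (h _ _ (ofRev G C X') ((revIdentity G C).map f))
  δ_natural_right {X Y} X' f := by
    have h (X Y X' : Equivariant G C) (f : X ⟶ Y) : untwist X'.obj X.v ≫ X'.obj ◁ f.hom =
        tensMap G (𝟙 X'.obj) f.hom ≫ untwist X'.obj Y.v := by
      rw [tensMap_untwist _ _ f.comm, id_tensorHom]
    exact Equivariant.hom_ext (h _ _ (ofRev G C X') ((revIdentity G C).map f))
  oplax_associativity X Y Z := Equivariant.hom_ext <|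
    untwist_assoc (ofRev G C X).obj (ofRev G C Y).v (ofRev G C Z) (ofRev G C (Y ⊗ Z)).v fun g =>
      Equivariant.μ_tensV (C := Rev G C) (Y.v g) (Z.v g)
  oplax_left_unitality X := by
    have h (X : Equivariant G C) : (λ_ X.obj).inv =
        (leftU G X.obj).inv ≫ untwist (𝟙_ C) X.v ≫ 𝟙 (𝟙_ C) ▷ X.obj := by
      rw [id_whiskerRight, Category.comp_id, leftU_inv_untwist]
    exact Equivariant.hom_ext (h (ofRev G C X))
  oplax_right_unitality X := by
    have h (X : C) : (ρ_ X).inv =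
        rightInv G X ≫ untwist X (fun g => (asIso (ε g : 𝟙_ C ⟶ _)).symm) ≫ X ◁ 𝟙 (𝟙_ C) := by
      rw [whiskerLeft_id, Category.comp_id, rightInv_untwist]
    exact Equivariant.hom_ext (h (ofRev G C X).obj)

instance : IsIso (Functor.OplaxMonoidal.η (revIdentity G C)) :=
  inferInstanceAs (IsIso (𝟙 (𝟙_ (Equivariant G C))))

instance (X Y : Equivariant G (Rev G C)) :
    IsIso (Functor.OplaxMonoidal.δ (revIdentity G C) X Y) :=
  inferInstanceAs (IsIso (revTensorIso G C X Y).hom)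

noncomputable scoped instance : (revIdentity G C).Monoidal := Functor.Monoidal.ofOplaxMonoidal _

noncomputable scoped instance revIdentityBraided : (revIdentity G C).Braided where
  braided X Y := by
    have h : (revIdentity G C).map (β_ X Y).hom ≫ Functor.OplaxMonoidal.δ (revIdentity G C) Y X =
        Functor.OplaxMonoidal.δ (revIdentity G C) X Y ≫
          (β_ ((revIdentity G C).obj X) ((revIdentity G C).obj Y)).hom :=
      Equivariant.hom_ext (revBraiding_untwist X Y)
    -- The condition is phrased with μ; multiplying by δ = μ⁻¹ turns it into the square `h`.
    rw [← cancel_mono (Functor.OplaxMonoidal.δ (revIdentity G C) Y X), Category.assoc, h]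
    erw [Functor.Monoidal.μ_δ_assoc, Category.assoc, Functor.Monoidal.μ_δ, Category.comp_id]

lemma revIdentity_δ (X Y : Equivariant G (Rev G C)) :
    BraidedRev.hom (Functor.OplaxMonoidal.δ (revIdentity G C) X Y) = revTensor X Y :=
  rfl

lemma revIdentity_linear {k : Type*} [Field k] [Linear k C] [∀ g : G, (act g : C ⥤ C).Linear k]
    [∀ g : G, (act g : Rev G C ⥤ Rev G C).Linear k] : (revIdentity G C).Linear k where
  map_smul _ _ := rfl

end Identity

end Rev

/-! ### Colimits in the equivariantization -/

namespace Equivariant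

section Colimits

variable {G : Type*} [Group G] {C : Type*} [Category C] [Preadditive C] [MonoidalCategory C]
  [CrossedData G C] [IsAction G C]

section Coequalizers

variable [HasCoequalizers C] {X Y : Equivariant G C} (f f' : X ⟶ Y)

/-- The equivariant structure of a coequalizer. -/
noncomputable def coequalizerV (g : G) :
    (act g).obj (coequalizer f.hom f'.hom) ⟶ coequalizer f.hom f'.hom :=
  (PreservesCoequalizer.iso (act g) f.hom f'.hom).inv ≫
    coequalizer.desc ((Y.v g).hom ≫ coequalizer.π f.hom f'.hom) (by
      rw [reassoc_of% f.comm, reassoc_of% f'.comm, coequalizer.condition])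

lemma π_coequalizerV (g : G) : (act g).map (coequalizer.π f.hom f'.hom) ≫ coequalizerV f f' g =
    (Y.v g).hom ≫ coequalizer.π f.hom f'.hom :=
  map_π_preserves_coequalizer_inv_desc _ _ _ _ _

/-- The coequalizer of equivariant morphisms. -/
noncomputable def coequalizerObj : Equivariant G C where
  obj := coequalizer f.hom f'.hom
  v g :=
    { hom := coequalizerV f f' g
      inv := coequalizer.desc ((Y.v g).inv ≫ (act g).map (coequalizer.π f.hom f'.hom)) (by
        have h (f : X ⟶ Y) : f.hom ≫ (Y.v g).inv = (X.v g).inv ≫ (act g).map f.hom := by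
          rw [Iso.comp_inv_eq, Category.assoc, f.comm, Iso.inv_hom_id_assoc]
        rw [reassoc_of% h f, reassoc_of% h f', ← Functor.map_comp, coequalizer.condition,
          Functor.map_comp])
      hom_inv_id := by
        rw [← cancel_epi ((act g).map (coequalizer.π f.hom f'.hom)), reassoc_of% π_coequalizerV]
        simp
      inv_hom_id := by
        rw [← cancel_epi (coequalizer.π f.hom f'.hom)]
        simp [π_coequalizerV] }
  v_mul {g h l} e := by
    dsimp only
    rw [← cancel_epi ((act g).map ((act h).map (coequalizer.π f.hom f'.hom))),
      reassoc_of% IsAction.γ_natural e, π_coequalizerV, ← Functor.map_comp_assoc, π_coequalizerV,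
      Functor.map_comp_assoc, π_coequalizerV, reassoc_of% Y.v_mul e]

/-- The projection to the coequalizer of equivariant morphisms. -/
noncomputable def coequalizerπ : Y ⟶ coequalizerObj f f' :=
  ⟨coequalizer.π f.hom f'.hom, π_coequalizerV f f'⟩

lemma coequalizerπ_condition : f ≫ coequalizerπ f f' = f' ≫ coequalizerπ f f' :=
  hom_ext (coequalizer.condition f.hom f'.hom)

/-- The universal property of `coequalizerObj`. -/
noncomputable def isColimitCoequalizer :
    IsColimit (Cofork.ofπ (coequalizerπ f f') (coequalizerπ_condition f f')) :=
  Cofork.IsColimit.mk' _ fun s =>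
    ⟨⟨coequalizer.desc s.π.hom (congrArg Hom.hom s.condition), fun g => by
        change (act g).map (coequalizer.desc s.π.hom _) ≫ _ = coequalizerV f f' g ≫ _
        rw [← cancel_epi ((act g).map (coequalizer.π f.hom f'.hom)), reassoc_of% π_coequalizerV,
          ← Functor.map_comp_assoc]
        simp [s.π.comm]⟩,
      hom_ext (coequalizer.π_desc _ _), fun {m} hm => hom_ext
        ((cancel_epi (coequalizer.π f.hom f'.hom)).1
          ((congrArg Hom.hom hm).trans (coequalizer.π_desc _ _).symm))⟩

instance : HasCoequalizers (Equivariant G C) :=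
  have (X Y : Equivariant G C) (f f' : X ⟶ Y) : HasColimit (parallelPair f f') :=
    ⟨⟨⟨_, isColimitCoequalizer f f'⟩⟩⟩
  hasCoequalizers_of_hasColimit_parallelPair _

end Coequalizers

/-- The morphism of `C` induced by a colimit is automatically equivariant, by uniqueness of induced
morphisms out of g of the colimit. -/
instance reflectsColimits_forget : ReflectsColimitsOfSize.{0, 0} (forget G C) where
  reflectsColimitsOfShape {J} _ :=
    { reflectsColimit := fun {K} =>
        ⟨fun {c} hc => ⟨
          { desc := fun s => ⟨hc.desc ((forget G C).mapCocone s), fun g => by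
              have h (d : c.pt.obj ⟶ s.pt.obj)
                  (hd : ∀ j, (c.ι.app j).hom ≫ d = (s.ι.app j).hom) :
                  (act g).map d ≫ (s.pt.v g).hom = (c.pt.v g).hom ≫ d := by
                -- g acts by an equivalence, so g of the colimit is again a colimit and equivariance
                -- can be tested on the legs.
                refine (isColimitOfPreserves (act g) hc).hom_ext fun j => ?_
                change (act g).map (c.ι.app j).hom ≫ _ = (act g).map (c.ι.app j).hom ≫ _
                have h₂ := (c.ι.app j).comm g
                have h₃ := (s.ι.app j).comm g
                dsimp at h₂ h₃
                rw [← Functor.map_comp_assoc, hd, h₃, reassoc_of% h₂, hd]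
              exact h _ fun j => hc.fac ((forget G C).mapCocone s) j⟩
            fac := fun s j => hom_ext (hc.fac ((forget G C).mapCocone s) j)
            uniq := fun s m hm => hom_ext (hc.uniq ((forget G C).mapCocone s) m.hom fun j =>
              congrArg Hom.hom (hm j)) }⟩⟩ }

end Colimits

/-! ### Induction as the right adjoint of the forgetful functor -/

section Induction

variable {G : Type*} [Group G] [Fintype G] {C : Type*} [Category C] [Preadditive C]
  [HasFiniteBiproducts C] [MonoidalCategory C] [CrossedData G C] [IsAction G C]

variable (G) in
/-- The underlying object of the induced object: the direct sum of the `x(Y)`. -/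
noncomputable def indObj (Y : C) : C := ⨁ fun x : G => (act x).obj Y

/-- The inclusion `x(Y) ⟶ ⊕ x(Y)`. -/
noncomputable def indι (Y : C) (x : G) : (act x).obj Y ⟶ indObj G Y :=
  biproduct.ι (fun x : G => (act x).obj Y) x

/-- The projection `⊕ x(Y) ⟶ x(Y)`. -/
noncomputable def indπ (Y : C) (x : G) : indObj G Y ⟶ (act x).obj Y :=
  biproduct.π (fun x : G => (act x).obj Y) x

lemma indι_π (Y : C) (x : G) : indι Y x ≫ indπ Y x = 𝟙 _ := biproduct.ι_π_self _ _

lemma indι_π_ne (Y : C) {x y : G} (h : x ≠ y) : indι Y x ≫ indπ Y y = 0 := biproduct.ι_π_ne _ h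

lemma indObj_ext {T Y : C} {f f' : T ⟶ indObj G Y} (h : ∀ x : G, f ≫ indπ Y x = f' ≫ indπ Y x) :
    f = f' :=
  biproduct.hom_ext _ _ h

lemma indObj_ext' {T Y : C} {f f' : indObj G Y ⟶ T} (h : ∀ x : G, indι Y x ≫ f = indι Y x ≫ f') :
    f = f' :=
  biproduct.hom_ext' _ _ h

lemma sum_indπ_ι (Y : C) : ∑ x : G, indπ Y x ≫ indι Y x = 𝟙 (indObj G Y) :=
  indObj_ext' fun x => by
    rw [Preadditive.comp_sum, Finset.sum_eq_single x]
    · rw [reassoc_of% indι_π, Category.comp_id]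
    · intro y _ hne
      rw [reassoc_of% (indι_π_ne Y hne.symm), zero_comp]
    · simp

lemma map_indObj_ext {D : Type*} [Category D] [Preadditive D] (F : C ⥤ D) [F.Additive] {Y : C}
    {T : D} {f f' : F.obj (indObj G Y) ⟶ T}
    (h : ∀ x : G, F.map (indι Y x) ≫ f = F.map (indι Y x) ≫ f') : f = f' := by
  rw [← Category.id_comp f, ← Category.id_comp f', ← F.map_id, ← sum_indπ_ι (G := G) Y,
    F.map_sum, Preadditive.sum_comp, Preadditive.sum_comp]
  simp only [F.map_comp, Category.assoc, h]

/-- The isomorphism `g(⊕ x(Y)) ⟶ ⊕ x(Y)` permuting the summands. -/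
noncomputable def indHom (Y : C) (g : G) : (act g).obj (indObj G Y) ⟶ indObj G Y :=
  ∑ x : G, (act g).map (indπ Y x) ≫ γ rfl Y ≫ indι Y (g * x)

lemma indι_hom (Y : C) {g x y : G} (e : g * x = y) :
    (act g).map (indι Y x) ≫ indHom Y g = γ e Y ≫ indι Y y := by
  subst e
  rw [indHom, Preadditive.comp_sum, Finset.sum_eq_single x]
  · rw [← Functor.map_comp_assoc, indι_π, CategoryTheory.Functor.map_id, Category.id_comp]
  · intro z _ hne
    rw [← Functor.map_comp_assoc, indι_π_ne Y hne.symm, Functor.map_zero, zero_comp]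
  · simp

/-- The inverse of `indHom`. -/
noncomputable def indInv (Y : C) (g : G) : indObj G Y ⟶ (act g).obj (indObj G Y) :=
  ∑ x : G, indπ Y (g * x) ≫ inv (γ rfl Y) ≫ (act g).map (indι Y x)

lemma indι_inv (Y : C) {g x y : G} (e : g * x = y) :
    indι Y y ≫ indInv Y g = inv (γ e Y) ≫ (act g).map (indι Y x) := by
  subst e
  rw [indInv, Preadditive.comp_sum, Finset.sum_eq_single x]
  · rw [reassoc_of% indι_π]
  · intro z _ hne
    rw [reassoc_of% (indι_π_ne Y fun h => hne (mul_left_cancel h).symm), zero_comp]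
  · simp

/-- The equivariant structure of the induced object permutes the summands. -/
@[simps] noncomputable def indV (Y : C) (g : G) : (act g).obj (indObj G Y) ≅ indObj G Y where
  hom := indHom Y g
  inv := indInv Y g
  hom_inv_id := map_indObj_ext (G := G) (act g) fun x => by
    rw [reassoc_of% (indι_hom Y (rfl : g * x = g * x)), indι_inv Y rfl, IsIso.hom_inv_id_assoc,
      Category.comp_id]
  inv_hom_id := indObj_ext' fun x => by
    rw [reassoc_of% (indι_inv Y (mul_inv_cancel_left g x)), indι_hom Y (mul_inv_cancel_left g x),
      IsIso.inv_hom_id_assoc, Category.comp_id]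

lemma indι_V (Y : C) {g x y : G} (e : g * x = y) :
    (act g).map (indι Y x) ≫ (indV Y g).hom = γ e Y ≫ indι Y y :=
  indι_hom Y e

lemma indV_π (Y : C) {g x y : G} (e : g * x = y) :
    (indV Y g).hom ≫ indπ Y y = (act g).map (indπ Y x) ≫ γ e Y :=
  map_indObj_ext (G := G) (act g) fun z => by
    rw [reassoc_of% (indι_V Y (rfl : g * z = g * z)), ← Functor.map_comp_assoc]
    obtain rfl | hne := eq_or_ne z x
    · subst e
      rw [indι_π, indι_π, Category.comp_id, CategoryTheory.Functor.map_id, Category.id_comp]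
    · rw [indι_π_ne _ hne, indι_π_ne _ (by rw [← e]; simpa using hne)]
      simp

/-- The induced equivariant object `⊕ x(Y)`. -/
noncomputable def ind (Y : C) : Equivariant G C where
  obj := indObj G Y
  v := indV Y
  v_mul {g h l} e := map_indObj_ext (G := G) (act h ⋙ act g) fun x => by
    change (act g).map ((act h).map _) ≫ _ = (act g).map ((act h).map _) ≫ _
    have e₁ : g * (h * x) = l * x := by rw [← e, mul_assoc]
    rw [reassoc_of% IsAction.γ_natural e, indι_V _ rfl, ← Functor.map_comp_assoc, indι_V _ rfl,
      Functor.map_comp_assoc, indι_V _ e₁, reassoc_of% (IsAction.γ_associativity e rfl rfl e₁ Y)]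

/-- The morphism to an induced object determined by a morphism `f`. -/
noncomputable def toInd (X : Equivariant G C) {Y : C} (f : X.obj ⟶ Y) : X.obj ⟶ indObj G Y :=
  ∑ x : G, (X.v x).inv ≫ (act x).map f ≫ indι Y x

lemma toInd_π (X : Equivariant G C) {Y : C} (f : X.obj ⟶ Y) (x : G) :
    toInd X f ≫ indπ Y x = (X.v x).inv ≫ (act x).map f := by
  rw [toInd, Preadditive.sum_comp, Finset.sum_eq_single x]
  · rw [Category.assoc, Category.assoc, indι_π, Category.comp_id]
  · intro z _ hne
    rw [Category.assoc, Category.assoc, indι_π_ne Y hne, comp_zero, comp_zero]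
  · simp

lemma inv_v_mul (X : Equivariant G C) {g h l : G} (e : g * h = l) :
    (X.v l).inv ≫ inv (γ e X.obj) = (X.v g).inv ≫ (act g).map (X.v h).inv := by
  have h₁ := X.v_mul e
  rw [Iso.inv_comp_eq, ← cancel_epi (γ e X.obj), reassoc_of% h₁, Iso.hom_inv_id_assoc,
    ← Functor.map_comp, Iso.hom_inv_id, CategoryTheory.Functor.map_id, IsIso.hom_inv_id]

lemma toInd_comm (X : Equivariant G C) {Y : C} (f : X.obj ⟶ Y) (g : G) :
    (act g).map (toInd X f) ≫ (indV Y g).hom = (X.v g).hom ≫ toInd X f :=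
  indObj_ext fun x => by
    have e := mul_inv_cancel_left g x
    have h := inv_v_mul X e
    rw [IsIso.comp_inv_eq, Category.assoc] at h
    rw [Category.assoc, indV_π Y e, ← Functor.map_comp_assoc, toInd_π, Category.assoc, toInd_π,
      Functor.map_comp_assoc, IsAction.γ_natural, h, Category.assoc, Iso.hom_inv_id_assoc,
      Category.assoc]

lemma toInd_one (X : Equivariant G C) {Y : C} (f : X.obj ⟶ Y) :
    toInd X f ≫ indπ Y (1 : G) ≫ inv (ι rfl Y) = f := by
  have h := v_ι X (rfl : (1 : G) = 1)
  rw [← Iso.eq_inv_comp, Category.comp_id] at h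
  rw [reassoc_of% toInd_π, ← h, ← reassoc_of% IsAction.ι_natural, IsIso.hom_inv_id,
    Category.comp_id]

/-- Equivariance expresses the component at x through the component at 1, since x carries the
summand of 1 to that of x. -/
lemma eq_toInd (X : Equivariant G C) {Y : C} (f : X.obj ⟶ indObj G Y)
    (h : ∀ g, (act g).map f ≫ (indV Y g).hom = (X.v g).hom ≫ f) :
    toInd X (f ≫ indπ Y (1 : G) ≫ inv (ι rfl Y)) = f :=
  indObj_ext fun x => by
    rw [toInd_π, Iso.inv_comp_eq, ← reassoc_of% h, indV_π Y (mul_one x), one_γ rfl, Functor.map_comp, Functor.map_comp, Functor.map_inv]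

lemma comp_toInd {X' X : Equivariant G C} {Y : C} (f : X' ⟶ X) (g : X.obj ⟶ Y) :
    toInd X' (f.hom ≫ g) = f.hom ≫ toInd X g :=
  indObj_ext fun x => by
    rw [toInd_π, Category.assoc, toInd_π, Functor.map_comp, Iso.inv_comp_eq, ← reassoc_of% f.comm,
      Iso.hom_inv_id_assoc]

/-- Morphisms to an induced object. -/
noncomputable def indEquiv (X : Equivariant G C) (Y : C) : (X.obj ⟶ Y) ≃ (X ⟶ ind (G := G) Y) where
  toFun f := ⟨toInd X f, toInd_comm X f⟩
  invFun f := f.hom ≫ indπ Y 1 ≫ inv (ι rfl Y)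
  left_inv f := toInd_one X f
  right_inv f := hom_ext (eq_toInd X f.hom f.comm)

variable (G C) in
/-- The right adjoint of the forgetful functor. -/
noncomputable def forgetAdjunction : forget G C ⊣ Adjunction.rightAdjointOfEquiv (F := forget G C)
    (G_obj := ind) indEquiv (fun _ _ _ f g => hom_ext (comp_toInd f g)) :=
  Adjunction.adjunctionOfEquivRight _ _

/-- With this, the coequalizer defining a tensor product over A stays a coequalizer in `C`, where
components and idempotents are available. -/
instance : PreservesColimitsOfSize.{0, 0} (forget G C) :=
  (forgetAdjunction G C).leftAdjoint_preservesColimits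

/-- Forgetting commutes with tensoring, preserves colimits and reflects them, so the property
descends from `C`. -/
lemma preservesColimits_tensorLeft (X : Equivariant G C)
    [PreservesColimitsOfSize.{0, 0} (tensorLeft X.obj)] :
    PreservesColimitsOfSize.{0, 0} (tensorLeft X) := by
  have : PreservesColimitsOfSize.{0, 0} (tensorLeft X ⋙ forget G C) :=
    inferInstanceAs (PreservesColimitsOfSize.{0, 0} (forget G C ⋙ tensorLeft X.obj))
  exact preservesColimits_of_reflects_of_preserves _ (forget G C)

lemma preservesColimits_tensorRight (X : Equivariant G C)
    [PreservesColimitsOfSize.{0, 0} (tensorRight X.obj)] :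
    PreservesColimitsOfSize.{0, 0} (tensorRight X) := by
  have : PreservesColimitsOfSize.{0, 0} (tensorRight X ⋙ forget G C) :=
    inferInstanceAs (PreservesColimitsOfSize.{0, 0} (forget G C ⋙ tensorRight X.obj))
  exact preservesColimits_of_reflects_of_preserves _ (forget G C)

end Induction

end Equivariant

/-! ### Delta functions -/

section FunctionAction

variable {G : Type*} [Group G] [Fintype G] {C : Type*} [Category C] [Preadditive C]
  [HasFiniteBiproducts C] [MonoidalCategory C] [CrossedData G C] [IsAction G C]

lemma delta_ev_eq (x y : G) [DecidableEq G] : delta C x ≫ ev C y = if x = y then 𝟙 _ else 0 := by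
  split_ifs with h
  · subst h
    exact delta_ev x
  · exact delta_ev_ne h

lemma funOne_eq_sum : funOne G C = ∑ x : G, delta C x := by
  rw [← Category.comp_id (funOne G C), ← sum_ev_delta, Preadditive.comp_sum]
  refine Finset.sum_congr rfl fun x _ => ?_
  rw [← Category.assoc, funOne_ev, Category.id_comp]

lemma delta_T (x g : G) : delta C x ≫ funT C g = delta C (x * g) :=
  fun_ext fun y => by
    classical
    rw [Category.assoc, funT_ev, delta_ev_eq, delta_ev_eq]
    simp only [eq_mul_inv_iff_mul_eq]

/-- Orthogonality of delta functions without a case distinction: evaluating δ_x at y gives 1 or 0.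
-/
lemma delta_funMul (x y : G) [MonoidalPreadditive C] :
    (delta C x ⊗ₘ delta C y) ≫ funMul G C = (λ_ (𝟙_ C)).hom ≫ delta C x ≫ ev C y ≫ delta C y :=
  fun_ext fun z => by
    classical
    simp only [Category.assoc, funMul_ev, MonoidalCategory.tensorHom_comp_tensorHom_assoc, delta_ev_eq]
    rw [reassoc_of% (delta_ev_eq (C := C) x y)]
    by_cases h₁ : x = z
    · subst h₁
      by_cases h₂ : x = y
      · subst h₂
        simp
      · simp [h₂, Ne.symm h₂]
    · by_cases h₂ : x = y
      · subst h₂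
        simp [h₁]
      · simp [h₁, h₂]

lemma whisker_delta_ext [MonoidalPreadditive C] {Y T : C} {f f' : Y ⊗ funObj G C ⟶ T}
    (h : ∀ x : G, Y ◁ delta C x ≫ f = Y ◁ delta C x ≫ f') : f = f' := by
  rw [← Category.id_comp f, ← Category.id_comp f', ← whiskerLeft_id, ← sum_ev_delta,
    whiskerLeft_sum, Preadditive.sum_comp, Preadditive.sum_comp]
  simp only [whiskerLeft_comp, Category.assoc, h]

lemma delta_funV {g x y : G} (e : g * x = y) :
    ε g ≫ (act g).map (delta C x) ≫ (funV g).hom = delta C y :=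
  fun_ext fun z => by
    classical
    subst e
    rw [Category.assoc, Category.assoc, funV, tuple_ev, ← Functor.map_comp_assoc, delta_ev_eq,
      delta_ev_eq]
    simp only [eq_inv_mul_iff_mul_eq]
    split_ifs <;> simp

end FunctionAction

/-! ### Modules over the functions as systems of idempotents -/

section Modules

variable {G : Type*} [Group G] [Fintype G] {C : Type*} [Category C] [Preadditive C]
  [HasFiniteBiproducts C] [MonoidalCategory C] [MonoidalPreadditive C] [CrossedData G C]
  [IsBraidedCrossed G C]

lemma delta_act {Y : C} {E : G → (Y ⟶ Y)} {l : funObj G C ⊗ Y ⟶ Y}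
    (hl : ∀ x, delta C x ▷ Y ≫ l = (λ_ _).hom ≫ E x) (x : G) {W : C} (f : W ⟶ Y) :
    (delta C x ⊗ₘ f) ≫ l = (λ_ _).hom ≫ f ≫ E x := by
  rw [MonoidalCategory.tensorHom_def', Category.assoc, hl, leftUnitor_naturality_assoc]

/-- The braiding past an object of degree h applies h to the functions, and left translation takes
δ_x to δ_{hx}. The action `l` is arbitrary, for use both with a given module and in the construction
of one. -/
lemma delta_braidHom_act {Y : C} {E : G → (Y ⟶ Y)} {l : funObj G C ⊗ Y ⟶ Y}
    (hl : ∀ x, delta C x ▷ Y ≫ l = (λ_ _).hom ≫ E x) {h x y : G} (e : h * x = y) {W : C}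
    (hW : deg h W) (f : W ⟶ Y) :
    (f ⊗ₘ delta C x) ≫ Equivariant.braidHom Y (fun g => funV g) ≫ l = (ρ_ _).hom ≫ f ≫ E y := by
  rw [MonoidalCategory.tensorHom_def', Category.assoc,
    reassoc_of% (Equivariant.whisker_braidHom _ hW), reassoc_of% cb_natural_right, cb_unit_right]
  simp only [Category.assoc, ← comp_whiskerRight_assoc]
  rw [delta_funV e, ← whisker_exchange_assoc, hl, leftUnitor_naturality_assoc,
    Iso.inv_hom_id_assoc]

variable (G C) in
/-- The category of modules over the algebra of functions on `G`. -/
abbrev FunMod : Type _ := DeEquiv (revFunctions G C)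

namespace FunMod

variable (M N : FunMod G C)

/-- The equivariant object underlying a module. -/
noncomputable def eq : Equivariant G C := M.X

/-- The left action. -/
noncomputable def aL : funObj G C ⊗ M.eq.obj ⟶ M.eq.obj := Equivariant.Hom.hom (G := G) (C := C) M.actL

/-- The right action. -/
noncomputable def aR : M.eq.obj ⊗ funObj G C ⟶ M.eq.obj := Equivariant.Hom.hom (G := G) (C := C) M.actR

variable {M N} in
/-- The equivariant morphism underlying a morphism of modules. -/
noncomputable def hom (f : M ⟶ N) : M.eq ⟶ N.eq := f.hom.hom

@[simp] lemma hom_id : hom (𝟙 M) = 𝟙 _ := rfl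

@[simp] lemma hom_comp {M N P : FunMod G C} (f : M ⟶ N) (g : N ⟶ P) :
    hom (f ≫ g) = hom f ≫ hom g :=
  rfl

variable {M N} in
lemma hom_ext {f g : M ⟶ N} (h : (hom f).hom = (hom g).hom) : f = g :=
  ObjectProperty.hom_ext _ (Bimod.hom_ext _ _ (Equivariant.hom_ext h))

lemma one_aL : funOne G C ▷ M.eq.obj ≫ M.aL = (λ_ _).hom :=
  congrArg (Equivariant.Hom.hom (G := G) (C := C)) M.obj.one_actLeft

lemma mul_aL : funMul G C ▷ M.eq.obj ≫ M.aL = (α_ _ _ _).hom ≫ funObj G C ◁ M.aL ≫ M.aL :=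
  congrArg (Equivariant.Hom.hom (G := G) (C := C)) M.obj.left_assoc

lemma aL_comm (g : G) : (act g).map M.aL ≫ (M.eq.v g).hom =
    (Equivariant.tensV (funV g) (M.eq.v g)).hom ≫ M.aL :=
  Equivariant.Hom.comm (G := G) (C := C) M.actL g

/-- The ambient category is the reverse of C^G, so the inverse braiding occurring in `IsModule` is
the braiding of C^G. -/
lemma aR_eq : M.aR = Equivariant.braidHom M.eq.obj (fun g => funV g) ≫ M.aL :=
  congrArg (Equivariant.Hom.hom (G := G) (C := C)) M.property

variable {M N} in
lemma hom_aL (f : M ⟶ N) : M.aL ≫ (hom f).hom = _ ◁ (hom f).hom ≫ N.aL :=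
  congrArg (Equivariant.Hom.hom (G := G) (C := C)) f.hom.left_act_hom

/-- The action of the delta function of `x`. -/
noncomputable def idem (x : G) : M.eq.obj ⟶ M.eq.obj :=
  (λ_ _).inv ≫ delta C x ▷ M.eq.obj ≫ M.aL

lemma delta_aL (x : G) : delta C x ▷ M.eq.obj ≫ M.aL = (λ_ _).hom ≫ M.idem x := by
  simp [idem]

lemma sum_idem : ∑ x : G, M.idem x = 𝟙 _ := by
  simp only [idem, ← Preadditive.comp_sum, ← Preadditive.sum_comp]
  rw [← sum_whiskerRight, ← funOne_eq_sum, one_aL, Iso.inv_hom_id]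

lemma idem_comp [DecidableEq G] (x y : G) : M.idem x ≫ M.idem y = if x = y then M.idem x else 0 := by
  have h : delta C y ▷ _ ≫ funObj G C ◁ delta C x ▷ M.eq.obj ≫ funObj G C ◁ M.aL ≫ M.aL =
    (α_ _ _ _).inv ≫ (delta C y ⊗ₘ delta C x) ▷ _ ≫ funMul G C ▷ M.eq.obj ≫ M.aL := by
    rw [mul_aL]
    simp [MonoidalCategory.tensorHom_def]
  have h' : (M.idem x ≫ M.idem y) = (λ_ _).inv ≫ (λ_ _).inv ≫ delta C y ▷ _ ≫
      funObj G C ◁ delta C x ▷ M.eq.obj ≫ funObj G C ◁ M.aL ≫ M.aL := by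
    simp only [idem, Category.assoc]
    rw [leftUnitor_inv_naturality_assoc, leftUnitor_inv_naturality_assoc,
      leftUnitor_inv_naturality_assoc]
    simp only [whisker_exchange_assoc]
    rw [← whisker_exchange_assoc, ← leftUnitor_inv_naturality_assoc]
  rw [h', h, ← comp_whiskerRight_assoc, delta_funMul, reassoc_of% (delta_ev_eq (C := C) y x)]
  by_cases e : x = y
  · subst e
    simp [idem]
  · simp [e, Ne.symm e]

lemma idem_idem (x : G) : M.idem x ≫ M.idem x = M.idem x := by
  classical
  rw [idem_comp, if_pos rfl]

lemma idem_idem_ne {x y : G} (h : x ≠ y) : M.idem x ≫ M.idem y = 0 := by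
  classical
  rw [idem_comp, if_neg h]

/-- The action of A is an equivariant morphism and g carries δ_x to δ_{gx}. So G permutes the images
of the idempotents simply transitively, which is why a module is determined by one of them. -/
lemma map_idem {g x y : G} (e : g * x = y) :
    (act g).map (M.idem x) ≫ (M.eq.v g).hom = (M.eq.v g).hom ≫ M.idem y := by
  have h₁ : (act g).map (λ_ M.eq.obj).inv = (λ_ _).inv ≫ ε g ▷ _ ≫ μ g _ _ := by
    rw [Iso.eq_inv_comp, ← cancel_mono ((act g).map (λ_ M.eq.obj).hom), Category.assoc,
      Category.assoc, IsAction.μ_left_unitality, ← Functor.map_comp]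
    simp
  rw [idem, Functor.map_comp, Functor.map_comp, Category.assoc, Category.assoc, aL_comm, h₁,
    Category.assoc, Category.assoc, ← reassoc_of% μ_natural_left, reassoc_of% Equivariant.μ_tensV,
    MonoidalCategory.tensorHom_def, Category.assoc, ← comp_whiskerRight_assoc,
    ← comp_whiskerRight_assoc, Category.assoc, delta_funV e, idem, leftUnitor_inv_naturality_assoc,
    whisker_exchange_assoc]

variable {M N} in
lemma hom_idem (f : M ⟶ N) (x : G) : M.idem x ≫ (hom f).hom = (hom f).hom ≫ N.idem x := by
  rw [idem, idem, Category.assoc, Category.assoc, hom_aL, leftUnitor_inv_naturality_assoc,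
    whisker_exchange_assoc]

variable {M} in
lemma comp_aR {h x y : G} (e : h * x = y) {W : C} (hW : deg h W) (f : W ⟶ M.eq.obj) :
    (f ⊗ₘ delta C x) ≫ M.aR = (ρ_ _).hom ≫ f ≫ M.idem y := by
  rw [aR_eq]
  exact delta_braidHom_act M.delta_aL e hW f

variable {M} in
lemma whisker_aR {h x y : G} (e : h * x = y) {W : C} (hW : deg h W) (f : W ⟶ M.eq.obj) :
    W ◁ delta C x ≫ f ▷ _ ≫ M.aR = (ρ_ _).hom ≫ f ≫ M.idem y := by
  rw [← comp_aR e hW, MonoidalCategory.tensorHom_def', Category.assoc]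

end FunMod

end Modules

lemma deg_of_zero {G : Type*} [Group G] [Fintype G] {C : Type*} [Category C] [Preadditive C]
    [MonoidalCategory C] [CrossedData G C] [IsBraidedCrossed G C] {g : G} {X : C}
    (h : ∀ l : G, l ≠ g → inc X l = 0) : deg g X :=
  IsBraidedCrossed.deg_iso g
    { hom := inc X g
      inv := prj X g
      hom_inv_id := inc_prj X g
      inv_hom_id := by
        rw [← sum_prj_inc (G := G) X, Finset.sum_eq_single g]
        · intro l _ hne
          rw [h l hne, comp_zero]
        · simp } (deg_comp X g)

/-! ### Conjugation of morphisms by the equivariant structures -/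

namespace Equivariant

section Conj

variable {G : Type*} [Group G] {C : Type*} [Category C] [Preadditive C] [MonoidalCategory C]
  [CrossedData G C] [IsAction G C] {X Y Z : Equivariant G C}

/-- The action of `G` on the morphisms between the objects underlying two equivariant objects. -/
def conj (x : G) (f : X.obj ⟶ Y.obj) : X.obj ⟶ Y.obj :=
  (X.v x).inv ≫ (act x).map f ≫ (Y.v x).hom

lemma v_conj (x : G) (f : X.obj ⟶ Y.obj) :
    (X.v x).hom ≫ conj x f = (act x).map f ≫ (Y.v x).hom := by
  simp [conj]

lemma conj_comp (x : G) (f : X.obj ⟶ Y.obj) (f' : Y.obj ⟶ Z.obj) :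
    conj x (f ≫ f') = conj x f ≫ conj x f' := by
  simp [conj]

@[simp] lemma conj_one (f : X.obj ⟶ Y.obj) : conj (1 : G) f = f := by
  rw [← cancel_epi (X.v 1).hom, v_conj, ← cancel_mono (ι (rfl : (1 : G) = 1) Y.obj),
    Category.assoc, v_ι, Category.comp_id, Category.assoc, IsAction.ι_natural,
    reassoc_of% (v_ι X)]

lemma map_conj (g x : G) (f : X.obj ⟶ Y.obj) :
    (act g).map (conj x f) ≫ (Y.v g).hom = (X.v g).hom ≫ conj (g * x) f := by
  rw [← cancel_epi ((act g).map (X.v x).hom), ← Functor.map_comp_assoc, v_conj,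
    ← reassoc_of% (X.v_mul rfl), v_conj, Functor.map_comp_assoc, ← Y.v_mul rfl,
    reassoc_of% IsAction.γ_natural]

lemma conj_zero (x : G) : conj x (0 : X.obj ⟶ Y.obj) = 0 := by
  simp [conj]

lemma conj_hom (x : G) (f : X ⟶ Y) : conj x f.hom = f.hom := by
  rw [← cancel_epi (X.v x).hom, v_conj, f.comm]

end Conj

end Equivariant

/-! ### Degrees of modules -/

namespace FunMod

open GCrossed.Equivariant (conj)

section

variable {G : Type*} [Group G] [Fintype G] {C : Type*} [Category C] [Preadditive C]
  [HasFiniteBiproducts C] [MonoidalCategory C] [MonoidalPreadditive C] [CrossedData G C]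
  [IsBraidedCrossed G C]

variable (M N : FunMod G C)

lemma conj_idem {x y z : G} (e : x * y = z) : conj (X := M.eq) (Y := M.eq) x (M.idem y) = M.idem z := by
  rw [← cancel_epi (M.eq.v x).hom, Equivariant.v_conj, map_idem M e]

variable {M N} in
/-- An equivariant morphism commuting with the idempotents is a morphism of modules. -/
noncomputable def ofHom (f : M.eq ⟶ N.eq) (h : ∀ x, M.idem x ≫ f.hom = f.hom ≫ N.idem x) : M ⟶ N :=
  DeEquiv.ofLeft f (Equivariant.hom_ext (delta_whisker_ext fun x => by
    change delta C x ▷ M.eq.obj ≫ M.aL ≫ f.hom = delta C x ▷ M.eq.obj ≫ _ ◁ f.hom ≫ N.aL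
    rw [← whisker_exchange_assoc, delta_aL, reassoc_of% delta_aL, h,
      leftUnitor_naturality_assoc]))

variable {M N} in
@[simp] lemma hom_ofHom (f : M.eq ⟶ N.eq) (h : ∀ x, M.idem x ≫ f.hom = f.hom ≫ N.idem x) :
    hom (ofHom f h) = f := rfl

variable {M} in
-- In the reverse category the braiding of M with A is the inverse braiding of A with M in C^G, and
-- the inverse one is the braiding of C^G that defines the right action.
lemma deg_iff_braid {g : G} : DeEquiv.degree g M ↔
    Equivariant.braidInv (funObj G C) M.eq.v ≫ M.aL = M.eq.obj ◁ funT C g ≫ M.aR := by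
  constructor
  · intro h
    exact (congrArg (Equivariant.Hom.hom (G := G) (C := C)) h).trans
      (congrArg (fun f => M.eq.obj ◁ funT C g ≫ f) M.aR_eq.symm)
  · intro h
    exact Equivariant.hom_ext (h.trans (congrArg (fun f => M.eq.obj ◁ funT C g ≫ f) M.aR_eq))

variable {M} in
-- Tested on δ_y and M_h: the inverse braiding leaves δ_y unchanged and gives E_y, while the right
-- action of δ_{yg} on degree h is E_{hyg}.
lemma deg_iff_idem {g : G} : DeEquiv.degree g M ↔
    ∀ h y : G, inc M.eq.obj h ≫ M.idem y = inc M.eq.obj h ≫ M.idem (h * y * g) := by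
  -- δ_y factors through the unit object, which has degree 1 and whose crossed braiding is trivial
  -- by `cb_unit_left`.
  have key (y : G) : M.eq.obj ◁ delta C y ≫ Equivariant.braidInv (funObj G C) M.eq.v ≫ M.aL =
      (ρ_ _).hom ≫ M.idem y := by
    have e : inv (ι (rfl : (1 : G) = 1) M.eq.obj) = (M.eq.v 1).hom := by
      rw [IsIso.inv_eq_of_hom_inv_id]
      exact Equivariant.ι_v _ _
    rw [reassoc_of% (Equivariant.whisker_braidInv M.eq.v (IsBraidedCrossed.deg_unit (G := G))),
      delta_aL]
    simp only [cb_unit_left (rfl : (1 : G) = 1), IsIso.inv_comp, IsIso.Iso.inv_hom, IsIso.Iso.inv_inv, e, Category.assoc,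
      Iso.inv_hom_id_assoc]
    rw [rightUnitor_naturality_assoc, Iso.inv_hom_id_assoc]
  rw [deg_iff_braid]
  have key' (h y : G) : inc M.eq.obj h ▷ _ ≫ M.eq.obj ◁ delta C y ≫
      Equivariant.braidInv (funObj G C) M.eq.v ≫ M.aL =
      (ρ_ _).hom ≫ inc M.eq.obj h ≫ M.idem y := by
    rw [key, rightUnitor_naturality_assoc]
  have key'' (h y : G) : inc M.eq.obj h ▷ _ ≫ M.eq.obj ◁ delta C y ≫ M.eq.obj ◁ funT C g ≫ M.aR =
      (ρ_ _).hom ≫ inc M.eq.obj h ≫ M.idem (h * y * g) := by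
    rw [← whiskerLeft_comp_assoc, delta_T, ← whisker_exchange_assoc,
      whisker_aR (mul_assoc h y g).symm (deg_comp _ h)]
  constructor
  · intro H h y
    rw [← cancel_epi (ρ_ _).hom, ← key', ← key'', H]
  · intro H
    refine whisker_delta_ext fun y => whisker_component_ext (G := G) fun h => ?_
    rw [key', key'', H]

variable {M} in
lemma comp_idem_of_degree {g h : G} (H : DeEquiv.degree g M) {W : C} (hW : deg h W)
    (f : W ⟶ M.eq.obj) (y : G) : f ≫ M.idem y = f ≫ M.idem (h * y * g) := by
  rw [← comp_prj_inc hW f, Category.assoc, Category.assoc, Category.assoc, Category.assoc,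
    deg_iff_idem.1 H]

end

/-! ### The fiber functor and its full faithfulness -/

section Fiber

variable {G : Type*} [Group G] [Fintype G] {C : Type*} [Category C] [Preadditive C]
  [HasFiniteBiproducts C] [MonoidalCategory C] [MonoidalPreadditive C] [CrossedData G C]
  [IsBraidedCrossed G C] [IsIdempotentComplete C]

variable (M N : FunMod G C)

/-- The fiber of a module at `1`. -/
noncomputable def fib : C :=
  (IsIdempotentComplete.idempotents_split _ (M.idem 1) (M.idem_idem 1)).choose

/-- The inclusion of the fiber at `1`. -/
noncomputable def fi : M.fib ⟶ M.eq.obj :=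
  (IsIdempotentComplete.idempotents_split _ (M.idem 1) (M.idem_idem 1)).choose_spec.choose

/-- The projection to the fiber at `1`. -/
noncomputable def fq : M.eq.obj ⟶ M.fib :=
  (IsIdempotentComplete.idempotents_split _ (M.idem 1) (M.idem_idem 1)).choose_spec.choose_spec.choose

@[simp]
lemma fi_fq : M.fi ≫ M.fq = 𝟙 _ :=
  (IsIdempotentComplete.idempotents_split _ (M.idem 1)
    (M.idem_idem 1)).choose_spec.choose_spec.choose_spec.1

@[simp] lemma fi_fq_assoc {T : C} (f : M.fib ⟶ T) : M.fi ≫ M.fq ≫ f = f := by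
  rw [← Category.assoc, fi_fq, Category.id_comp]

lemma fq_fi : M.fq ≫ M.fi = M.idem 1 :=
  (IsIdempotentComplete.idempotents_split _ (M.idem 1)
    (M.idem_idem 1)).choose_spec.choose_spec.choose_spec.2

lemma fi_idem : M.fi ≫ M.idem 1 = M.fi := by
  rw [← fq_fi, ← Category.assoc, fi_fq, Category.id_comp]

lemma fi_idem_ne {x : G} (h : x ≠ 1) : M.fi ≫ M.idem x = 0 := by
  rw [← fi_idem, Category.assoc, idem_idem_ne _ h.symm, comp_zero]

lemma idem_fq : M.idem 1 ≫ M.fq = M.fq := by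
  rw [← fq_fi, Category.assoc, fi_fq, Category.comp_id]

lemma idem_fq_ne {x : G} (h : x ≠ 1) : M.idem x ≫ M.fq = 0 := by
  rw [← idem_fq, ← Category.assoc, idem_idem_ne _ h, zero_comp]

variable {M N} in
lemma fi_fq_hom (f : M ⟶ N) : (M.fi ≫ (hom f).hom ≫ N.fq) ≫ N.fi = M.fi ≫ (hom f).hom := by
  rw [Category.assoc, Category.assoc, fq_fi, ← hom_idem, ← Category.assoc, fi_idem]

variable (G C) in
/-- The functor which maps a module to its fiber at `1`. -/
noncomputable def fiber : FunMod G C ⥤ Rev G C where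
  obj M := (M.fib : C)
  map {M N} f := (M.fi ≫ (hom f).hom ≫ N.fq : M.fib ⟶ N.fib)
  map_id M := by
    have h : M.fi ≫ (hom (𝟙 M)).hom ≫ M.fq = 𝟙 _ := by
      simp
    exact h
  map_comp {M N P} f g := by
    have h : M.fi ≫ (hom (f ≫ g)).hom ≫ P.fq =
        (M.fi ≫ (hom f).hom ≫ N.fq) ≫ N.fi ≫ (hom g).hom ≫ P.fq := by
      rw [← Category.assoc (_ ≫ _ ≫ _), fi_fq_hom]
      simp
    exact h

variable {M N} in
/-- The morphism of modules induced by a morphism between fibers. -/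
noncomputable def extend (φ : M.fib ⟶ N.fib) : M.eq ⟶ N.eq where
  hom := ∑ x : G, conj (X := M.eq) (Y := N.eq) x (M.fq ≫ φ ≫ N.fi)
  comm g := by
    rw [Functor.map_sum, Preadditive.sum_comp, Preadditive.comp_sum]
    refine Fintype.sum_equiv (Equiv.mulLeft g) _ _ fun x => ?_
    exact Equivariant.map_conj _ _ _

variable {M N} in
-- The conjugate by y starts at the image of E_y and ends there, so E_x selects the term x. With the
-- mirror statement `extend_idem`, the extension commutes with all idempotents and is thus A-linear.
lemma idem_extend (φ : M.fib ⟶ N.fib) (x : G) : M.idem x ≫ (extend φ).hom =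
    conj (X := M.eq) (Y := N.eq) x (M.fq ≫ φ ≫ N.fi) := by
  have e (y : G) : M.idem x ≫ conj (X := M.eq) (Y := N.eq) y (M.fq ≫ φ ≫ N.fi) =
      conj (X := M.eq) (Y := N.eq) y (M.idem (y⁻¹ * x) ≫ M.fq ≫ φ ≫ N.fi) := by
    rw [Equivariant.conj_comp (Y := M.eq), conj_idem M (mul_inv_cancel_left y x)]
  rw [extend, Preadditive.comp_sum, Finset.sum_eq_single x]
  · rw [e, inv_mul_cancel, reassoc_of% idem_fq]
  · intro y _ hne
    rw [e, reassoc_of% (M.idem_fq_ne (x := y⁻¹ * x) (fun h => hne (inv_mul_eq_one.1 h))), zero_comp,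
      Equivariant.conj_zero]
  · simp

variable {M N} in
lemma extend_idem (φ : M.fib ⟶ N.fib) (x : G) : (extend φ).hom ≫ N.idem x =
    conj (X := M.eq) (Y := N.eq) x (M.fq ≫ φ ≫ N.fi) := by
  have e (y : G) : conj (X := M.eq) (Y := N.eq) y (M.fq ≫ φ ≫ N.fi) ≫ N.idem x =
      conj (X := M.eq) (Y := N.eq) y ((M.fq ≫ φ ≫ N.fi) ≫ N.idem (y⁻¹ * x)) := by
    rw [Equivariant.conj_comp (Y := N.eq), conj_idem N (mul_inv_cancel_left y x)]
  rw [extend, Preadditive.sum_comp, Finset.sum_eq_single x]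
  · rw [e, inv_mul_cancel, Category.assoc, Category.assoc, fi_idem]
  · intro y _ hne
    rw [e, Category.assoc, Category.assoc,
      N.fi_idem_ne (x := y⁻¹ * x) (fun h => hne (inv_mul_eq_one.1 h)), comp_zero, comp_zero,
      Equivariant.conj_zero]
  · simp

instance : (fiber G C).Full where
  map_surjective {M N} φ := by
    have h : ∀ φ : M.fib ⟶ N.fib, ∃ f : M ⟶ N, M.fi ≫ (hom f).hom ≫ N.fq = φ := fun φ =>
      ⟨ofHom (extend φ) fun x => by rw [idem_extend, extend_idem], by
        rw [hom_ofHom, ← M.fi_idem, Category.assoc, ← Category.assoc (M.idem 1), idem_extend,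
          Equivariant.conj_one]
        simp⟩
    exact h φ

variable {M N} in
-- A module morphism is the sum over x of its restrictions to the images of E_x, and equivariance
-- makes each of them a conjugate of the restriction to the fiber at 1.
lemma hom_ext_fiber {f f' : M ⟶ N} (h : M.fi ≫ (hom f).hom ≫ N.fq = M.fi ≫ (hom f').hom ≫ N.fq) :
    f = f' := by
  have key (f : M ⟶ N) : (hom f).hom = ∑ x : G, conj (X := M.eq) (Y := N.eq) x
      (M.fq ≫ (M.fi ≫ (hom f).hom ≫ N.fq) ≫ N.fi) := by
    conv_lhs => rw [← Category.id_comp (hom f).hom, ← sum_idem, Preadditive.sum_comp]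
    refine Finset.sum_congr rfl fun x _ => ?_
    rw [fi_fq_hom, ← Category.assoc, fq_fi, Equivariant.conj_comp (Y := M.eq), Equivariant.conj_hom,
      conj_idem M (mul_one x)]
  exact hom_ext (by rw [key f, key f', h])

instance : (fiber G C).Faithful where
  map_injective h := hom_ext_fiber h

instance : (fiber G C).Additive where
  map_add {M N f f'} := by
    have h : M.fi ≫ ((hom f).hom + (hom f').hom) ≫ N.fq =
        M.fi ≫ (hom f).hom ≫ N.fq + M.fi ≫ (hom f').hom ≫ N.fq := by
      simp
    exact h

variable {M} in
lemma idem_eq_conj (x : G) : M.idem x =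
    ((M.eq.v x).inv ≫ (act x).map M.fq) ≫ (act x).map M.fi ≫ (M.eq.v x).hom := by
  rw [← conj_idem M (mul_one x), ← fq_fi, conj]
  simp

variable {M} in
-- If M has degree g, then E_1 = E_{lg} on pieces of degree l, so a piece of the fiber at 1 vanishes
-- unless lg = 1. Conversely the image of E_x is x(M_1), of degree xg⁻¹x⁻¹, which restricts where
-- E_x can act nontrivially.
lemma deg_iff_fiber {g : G} : DeEquiv.degree g M ↔ deg g⁻¹ M.fib := by
  constructor
  · intro H
    refine deg_of_zero fun l hne => ?_
    rw [← Category.comp_id (inc M.fib l), ← fi_fq, ← idem_fq, ← Category.assoc, ← Category.assoc,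
      Category.assoc (inc _ _), ← Category.assoc, comp_idem_of_degree H (deg_comp _ l), Category.assoc,
      idem_fq_ne, comp_zero]
    · intro e
      rw [mul_one] at e
      exact hne (eq_inv_of_mul_eq_one_left e)
  · intro H
    rw [deg_iff_idem]
    intro h y
    have key (x : G) (hne : h ≠ x * g⁻¹ * x⁻¹) : inc M.eq.obj h ≫ M.idem x = 0 := by
      have h₀ := IsBraidedCrossed.deg_orthogonal hne (deg_comp M.eq.obj h)
        (IsBraidedCrossed.deg_act x H) (inc M.eq.obj h ≫ (M.eq.v x).inv ≫ (act x).map M.fq)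
      rw [idem_eq_conj, ← Category.assoc, h₀, zero_comp]
    -- Either hyg = y, or E_y and E_{hyg} both vanish on M_h.
    by_cases e : h = y * g⁻¹ * y⁻¹
    · rw [show h * y * g = y by rw [e]; group]
    · rw [key _ e, key]
      intro e'
      apply e
      -- For x = hyg the element xg⁻¹x⁻¹ is the conjugate by h of yg⁻¹y⁻¹, so one equals h exactly
      -- when the other does.
      calc h = h⁻¹ * h * h := by group
        _ = h⁻¹ * (h * y * g * g⁻¹ * (h * y * g)⁻¹) * h := by rw [← e']
        _ = y * g⁻¹ * y⁻¹ := by group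

end Fiber

end FunMod

/-! ### Construction of modules from idempotents -/

namespace FunMod

section OfIdem

variable {G : Type*} [Group G] [Fintype G] {C : Type*} [Category C] [Preadditive C]
  [HasFiniteBiproducts C] [MonoidalCategory C] [MonoidalPreadditive C] [CrossedData G C]
  [IsBraidedCrossed G C]

lemma fun_map_ext {D : Type*} [Category D] [Preadditive D] (F : C ⥤ D) [F.Additive] {T : D}
    {f f' : F.obj (funObj G C) ⟶ T} (h : ∀ x : G, F.map (delta C x) ≫ f = F.map (delta C x) ≫ f') :
    f = f' := by
  rw [← Category.id_comp f, ← Category.id_comp f', ← F.map_id, ← sum_ev_delta, F.map_sum,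
    Preadditive.sum_comp, Preadditive.sum_comp]
  simp only [F.map_comp, Category.assoc, h]

/-- A is a sum of unit objects, so the bimodule axioms can be tested on delta functions and, where a
braiding occurs, on homogeneous pieces. This lemma and the next two supply the tests for the three
associativity axioms. -/
lemma left_assoc_ext {Y T : C} {f f' : (funObj G C ⊗ funObj G C) ⊗ Y ⟶ T}
    (h : ∀ x y : G, ((delta C x ⊗ₘ delta C y) ⊗ₘ 𝟙 Y) ≫ f = ((delta C x ⊗ₘ delta C y) ⊗ₘ 𝟙 Y) ≫ f') :
    f = f' :=
  fun_map_ext (tensorRight (funObj G C) ⋙ tensorRight Y) fun x =>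
    fun_map_ext (tensorLeft (𝟙_ C) ⋙ tensorRight Y) fun y => by
      simpa [MonoidalCategory.tensorHom_def'] using h x y

lemma right_assoc_ext {Y T : C} {f f' : Y ⊗ (funObj G C ⊗ funObj G C) ⟶ T}
    (h : ∀ g x y : G, (inc Y g ⊗ₘ (delta C x ⊗ₘ delta C y)) ≫ f =
      (inc Y g ⊗ₘ (delta C x ⊗ₘ delta C y)) ≫ f') : f = f' :=
  map_component_ext (G := G) (tensorRight (funObj G C ⊗ funObj G C)) fun g =>
    fun_map_ext (tensorRight (funObj G C) ⋙ tensorLeft (comp Y g)) fun x =>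
    fun_map_ext (tensorLeft (𝟙_ C) ⋙ tensorLeft (comp Y g)) fun y => by
      simpa [MonoidalCategory.tensorHom_def'] using h g x y

lemma middle_assoc_ext {Y T : C} {f f' : (funObj G C ⊗ Y) ⊗ funObj G C ⟶ T}
    (h : ∀ g x y : G, ((delta C x ⊗ₘ inc Y g) ⊗ₘ delta C y) ≫ f =
      ((delta C x ⊗ₘ inc Y g) ⊗ₘ delta C y) ≫ f') : f = f' :=
  fun_map_ext (tensorRight Y ⋙ tensorRight (funObj G C)) fun x =>
    map_component_ext (G := G) (tensorLeft (𝟙_ C) ⋙ tensorRight (funObj G C)) fun g =>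
    fun_map_ext (tensorLeft (𝟙_ C ⊗ comp Y g)) fun y => by
      simpa [MonoidalCategory.tensorHom_def'] using h g x y

variable (X : Equivariant G C) (E : G → (X.obj ⟶ X.obj))

/-- The left action of the functions given by idempotents. -/
noncomputable def idemL : funObj G C ⊗ X.obj ⟶ X.obj :=
  ∑ x : G, ev C x ▷ X.obj ≫ (λ_ _).hom ≫ E x

lemma delta_idemL (x : G) : delta C x ▷ X.obj ≫ idemL X E = (λ_ _).hom ≫ E x := by
  classical
  rw [idemL, Preadditive.comp_sum, Finset.sum_eq_single x]
  · rw [← comp_whiskerRight_assoc, delta_ev, id_whiskerRight, Category.id_comp]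
  · intro y _ hne
    rw [← comp_whiskerRight_assoc, delta_ev_ne hne.symm, MonoidalPreadditive.zero_whiskerRight,
      zero_comp]
  · simp

/-- The right action of the functions given by idempotents. -/
noncomputable def idemR : X.obj ⊗ funObj G C ⟶ X.obj :=
  Equivariant.braidHom X.obj (fun g => funV g) ≫ idemL X E

lemma comp_idemR {h x y : G} (e : h * x = y) {W : C} (hW : deg h W) (f : W ⟶ X.obj) :
    (f ⊗ₘ delta C x) ≫ idemR X E = (ρ_ _).hom ≫ f ≫ E y :=
  delta_braidHom_act (delta_idemL X E) e hW f

variable {X E}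

lemma idemL_comm (hE : ∀ {g x y : G}, g * x = y → (act g).map (E x) ≫ (X.v g).hom = (X.v g).hom ≫ E y)
    (g : G) : (act g).map (idemL X E) ≫ (X.v g).hom =
      (Equivariant.tensV (funV g) (X.v g)).hom ≫ idemL X E := by
  rw [← cancel_epi (μ g _ _), reassoc_of% Equivariant.μ_tensV,
    ← cancel_epi ((funV g).inv ⊗ₘ (X.v g).inv)]
  refine delta_whisker_ext fun y => ?_
  have e := mul_inv_cancel_left g y
  have e₁ : delta C y ≫ (funV g).inv = ε g ≫ (act g).map (delta C (g⁻¹ * y)) := by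
    rw [Iso.comp_inv_eq, Category.assoc, delta_funV e]
  have e₂ : delta C y ▷ X.obj ≫ ((funV g).inv ⊗ₘ (X.v g).inv) =
      _ ◁ (X.v g).inv ≫ ε g ▷ _ ≫ (act g).map (delta C (g⁻¹ * y)) ▷ _ := by
    rw [MonoidalCategory.tensorHom_def, ← comp_whiskerRight_assoc, e₁, ← comp_whiskerRight,
      whisker_exchange]
  rw [reassoc_of% e₂, reassoc_of% μ_natural_left, ← Functor.map_comp_assoc, delta_idemL,
    Functor.map_comp_assoc, hE e, reassoc_of% IsAction.μ_left_unitality,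
    leftUnitor_naturality_assoc, Iso.inv_hom_id_assoc,
    MonoidalCategory.tensorHom_comp_tensorHom_assoc]
  simp [delta_idemL]

lemma idemL_assoc (h₂ : ∀ x, E x ≫ E x = E x) (h₃ : ∀ {x y}, x ≠ y → E x ≫ E y = 0) :
    funMul G C ▷ X.obj ≫ idemL X E = (α_ _ _ _).hom ≫ funObj G C ◁ idemL X E ≫ idemL X E :=
  left_assoc_ext fun x y => by
    have e₁ : ((delta C x ⊗ₘ delta C y) ⊗ₘ 𝟙 X.obj) ≫ funMul G C ▷ X.obj =
        ((λ_ _).hom ≫ delta C x ≫ ev C y ≫ delta C y) ▷ X.obj := by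
      rw [← delta_funMul]
      simp
    have e₂ : (delta C x ⊗ₘ (delta C y ⊗ₘ 𝟙 X.obj)) ≫ funObj G C ◁ idemL X E =
        (delta C x ⊗ₘ (λ_ _).hom ≫ E y) := by
      rw [← delta_idemL, ← id_tensorHom, MonoidalCategory.tensorHom_comp_tensorHom]
      simp
    rw [reassoc_of% e₁, associator_naturality_assoc, reassoc_of% e₂, delta_act (delta_idemL X E)]
    by_cases h : x = y
    · subst h
      rw [reassoc_of% (delta_ev (C := C) x), comp_whiskerRight_assoc, delta_idemL, Category.assoc, h₂]
      simp
    · rw [reassoc_of% (delta_ev_ne (C := C) h), Category.assoc, h₃ (Ne.symm h)]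
      simp

lemma idemR_one (h₁ : ∑ x : G, E x = 𝟙 _) : X.obj ◁ funOne G C ≫ idemR X E = (ρ_ _).hom :=
  map_component_ext (G := G) (tensorRight (𝟙_ C)) fun g => by
    change inc X.obj g ▷ 𝟙_ C ≫ _ = inc X.obj g ▷ 𝟙_ C ≫ _
    have e (x : G) : inc X.obj g ▷ 𝟙_ C ≫ X.obj ◁ delta C x ≫ idemR X E =
        (ρ_ _).hom ≫ inc X.obj g ≫ E (g * x) := by
      rw [← comp_idemR X E rfl (deg_comp _ g), MonoidalCategory.tensorHom_def, Category.assoc]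
    rw [funOne_eq_sum, whiskerLeft_sum, Preadditive.sum_comp, Preadditive.comp_sum,
      rightUnitor_naturality]
    refine (Finset.sum_congr rfl fun x _ => e x).trans ?_
    rw [← Preadditive.comp_sum, ← Preadditive.comp_sum,
      Fintype.sum_equiv (Equiv.mulLeft g) (fun x => E (g * x)) E (fun _ => rfl), h₁, Category.comp_id]

lemma idemR_assoc (h₂ : ∀ x, E x ≫ E x = E x) (h₃ : ∀ {x y}, x ≠ y → E x ≫ E y = 0) :
    X.obj ◁ funMul G C ≫ idemR X E =
      (α_ _ _ _).inv ≫ idemR X E ▷ funObj G C ≫ idemR X E :=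
  right_assoc_ext fun g x y => by
    have hg := deg_comp X.obj g
    have e₁ : (inc X.obj g ⊗ₘ (delta C x ⊗ₘ delta C y)) ≫ X.obj ◁ funMul G C =
        (inc X.obj g ⊗ₘ (λ_ _).hom ≫ delta C x ≫ ev C y ≫ delta C y) := by
      rw [← delta_funMul, ← id_tensorHom, MonoidalCategory.tensorHom_comp_tensorHom,
        Category.comp_id]
    have e₂ : ((inc X.obj g ⊗ₘ delta C x) ⊗ₘ delta C y) ≫ idemR X E ▷ funObj G C =
        (ρ_ _).hom ▷ _ ≫ (inc X.obj g ≫ E (g * x) ⊗ₘ delta C y) := by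
      rw [← tensorHom_id, ← tensorHom_id, MonoidalCategory.tensorHom_comp_tensorHom,
        MonoidalCategory.tensorHom_comp_tensorHom, comp_idemR X E rfl hg]
      simp
    rw [reassoc_of% e₁, associator_inv_naturality_assoc, reassoc_of% e₂, comp_idemR X E rfl hg]
    by_cases h : x = y
    · subst h
      have e₃ : (inc X.obj g ⊗ₘ (λ_ (𝟙_ C)).hom ≫ delta C x) =
          comp X.obj g ◁ (λ_ (𝟙_ C)).hom ≫ (inc X.obj g ⊗ₘ delta C x) := by
        rw [← id_tensorHom, MonoidalCategory.tensorHom_comp_tensorHom, Category.id_comp]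
      rw [reassoc_of% (delta_ev (C := C) x), e₃, Category.assoc, comp_idemR X E rfl hg,
        Category.assoc, h₂, ← triangle_assoc_comp_right_assoc]
    · have h' : g * x ≠ g * y := fun h' => h (mul_left_cancel h')
      rw [reassoc_of% (delta_ev_ne (C := C) h), Category.assoc, h₃ h']
      simp

/-- On a piece of degree g the two actions are by E_x and E_{gy}, and orthogonal idempotents
commute. -/
lemma idemLR_assoc (h₃ : ∀ {x y}, x ≠ y → E x ≫ E y = 0) :
    idemL X E ▷ funObj G C ≫ idemR X E =
      (α_ _ _ _).hom ≫ funObj G C ◁ idemR X E ≫ idemL X E :=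
  middle_assoc_ext fun g x y => by
    have hg := deg_comp X.obj g
    have e₁ : ((delta C x ⊗ₘ inc X.obj g) ⊗ₘ delta C y) ≫ idemL X E ▷ funObj G C =
        (λ_ _).hom ▷ _ ≫ (inc X.obj g ≫ E x ⊗ₘ delta C y) := by
      rw [← tensorHom_id, ← tensorHom_id, MonoidalCategory.tensorHom_comp_tensorHom,
        MonoidalCategory.tensorHom_comp_tensorHom, delta_act (delta_idemL X E)]
      simp
    have e₂ : (delta C x ⊗ₘ (inc X.obj g ⊗ₘ delta C y)) ≫ funObj G C ◁ idemR X E =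
        _ ◁ (ρ_ _).hom ≫ (delta C x ⊗ₘ inc X.obj g ≫ E (g * y)) := by
      rw [← id_tensorHom, ← id_tensorHom, MonoidalCategory.tensorHom_comp_tensorHom,
        MonoidalCategory.tensorHom_comp_tensorHom, comp_idemR X E rfl hg]
      simp
    have e₃ : E x ≫ E (g * y) = E (g * y) ≫ E x := by
      by_cases h : x = g * y
      · rw [h]
      · rw [h₃ h, h₃ (Ne.symm h)]
    rw [reassoc_of% e₁, associator_naturality_assoc, reassoc_of% e₂, comp_idemR X E rfl hg,
      delta_act (delta_idemL X E), Category.assoc, e₃]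
    simp

variable (X E)

/-- The module given by a family of idempotents. -/
noncomputable def ofIdem
    (hE : ∀ {g x y : G}, g * x = y → (act g).map (E x) ≫ (X.v g).hom = (X.v g).hom ≫ E y)
    (h₁ : ∑ x : G, E x = 𝟙 _) (h₂ : ∀ x, E x ≫ E x = E x) (h₃ : ∀ {x y}, x ≠ y → E x ≫ E y = 0) :
    FunMod G C where
  obj :=
    { X := (X : Equivariant G C)
      actLeft := (⟨idemL X E, idemL_comm hE⟩ : funEq G C ⊗ X ⟶ X)
      one_actLeft := Equivariant.hom_ext (by
        change funOne G C ▷ X.obj ≫ idemL X E = (λ_ _).hom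
        rw [funOne_eq_sum, sum_whiskerRight, Preadditive.sum_comp]
        simp only [delta_idemL]
        rw [← Preadditive.comp_sum, h₁, Category.comp_id])
      left_assoc := Equivariant.hom_ext (idemL_assoc h₂ h₃)
      actRight := ((β_ X (funEq G C)).hom ≫ (⟨idemL X E, idemL_comm hE⟩ : funEq G C ⊗ X ⟶ X) :
        X ⊗ funEq G C ⟶ X)
      actRight_one := Equivariant.hom_ext (idemR_one h₁)
      right_assoc := Equivariant.hom_ext (idemR_assoc h₂ h₃)
      middle_assoc := Equivariant.hom_ext (idemLR_assoc h₃) }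
  -- The right action was defined with the braiding of C^G, which is the inverse braiding of the
  -- reverse.
  property := rfl

@[simp] lemma idem_ofIdem
    (hE : ∀ {g x y : G}, g * x = y → (act g).map (E x) ≫ (X.v g).hom = (X.v g).hom ≫ E y)
    (h₁ : ∑ x : G, E x = 𝟙 _) (h₂ : ∀ x, E x ≫ E x = E x) (h₃ : ∀ {x y}, x ≠ y → E x ≫ E y = 0)
    (x : G) : (ofIdem X E hE h₁ h₂ h₃).idem x = E x := by
  refine (cancel_epi (λ_ X.obj).hom).1 ?_
  exact ((ofIdem X E hE h₁ h₂ h₃).delta_aL x).symm.trans (delta_idemL X E x)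

end OfIdem

/-! ### Induced modules and essential surjectivity -/

section Induced

open GCrossed.Equivariant (ind indObj indV indι indπ indι_V indι_π indι_π_ne sum_indπ_ι map_indObj_ext)

variable {G : Type*} [Group G] [Fintype G] {C : Type*} [Category C] [Preadditive C]
  [HasFiniteBiproducts C] [MonoidalCategory C] [MonoidalPreadditive C] [CrossedData G C]
  [IsBraidedCrossed G C]

/-- The projection of the induced object onto a summand. -/
noncomputable def indIdem (Y : C) (x : G) : indObj G Y ⟶ indObj G Y := indπ Y x ≫ indι Y x

lemma indIdem_comm (Y : C) {g x y : G} (e : g * x = y) :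
    (act g).map (indIdem Y x) ≫ (indV Y g).hom = (indV Y g).hom ≫ indIdem Y y := by
  refine map_indObj_ext (act g) fun z => ?_
  rw [reassoc_of% (indι_V Y (rfl : g * z = _)), indIdem, indIdem, Functor.map_comp, Category.assoc,
    indι_V Y e, ← Functor.map_comp_assoc]
  by_cases h : z = x
  · subst h e
    rw [indι_π, reassoc_of% (indι_π (G := G) Y)]
    simp
  · have h' : g * z ≠ y := fun h'' => h (mul_left_cancel (h''.trans e.symm))
    rw [indι_π_ne Y h, reassoc_of% (indι_π_ne Y h')]
    simp

lemma indIdem_idem (Y : C) (x : G) : indIdem Y x ≫ indIdem Y x = indIdem Y x := by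
  rw [indIdem, Category.assoc, reassoc_of% (indι_π (G := G) Y)]

lemma indIdem_ne (Y : C) {x y : G} (h : x ≠ y) : indIdem Y x ≫ indIdem Y y = 0 := by
  rw [indIdem, indIdem, Category.assoc, reassoc_of% (indι_π_ne Y h)]
  simp

/-- The free module on an object of `C`. -/
noncomputable def free (Y : C) : FunMod G C :=
  ofIdem (ind (G := G) Y) (indIdem Y) (indIdem_comm Y) (sum_indπ_ι Y) (indIdem_idem Y)
    (indIdem_ne Y)

lemma idem_free (Y : C) : (free (G := G) Y).idem 1 = indπ (G := G) Y 1 ≫ indι Y 1 :=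
  idem_ofIdem (ind (G := G) Y) (indIdem Y) (indIdem_comm Y) (sum_indπ_ι Y) (indIdem_idem Y)
    (indIdem_ne Y) 1

variable [IsIdempotentComplete C]

/-- The fiber as the image of any splitting of the idempotent of `1`. -/
noncomputable def fibIso (M : FunMod G C) {Y : C} (j : Y ⟶ M.eq.obj) (r : M.eq.obj ⟶ Y)
    (h₁ : j ≫ r = 𝟙 Y) (h₂ : r ≫ j = M.idem 1) : M.fib ≅ Y where
  hom := M.fi ≫ r
  inv := j ≫ M.fq
  hom_inv_id := by
    rw [Category.assoc, ← Category.assoc r, h₂, idem_fq, fi_fq]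
  inv_hom_id := by
    rw [Category.assoc, ← Category.assoc M.fq, fq_fi, ← h₂, Category.assoc, h₁, Category.comp_id, h₁]

/-- The fiber of the free module on `Y` is `Y`. -/
noncomputable def freeFib (Y : C) : (free (G := G) Y).fib ≅ Y :=
  fibIso _ (indι Y 1) (indπ Y 1) (indι_π Y 1) (idem_free Y).symm ≪≫
    (asIso (ι (rfl : (1 : G) = 1) Y)).symm

instance : (fiber G C).EssSurj where
  mem_essImage Y := ⟨free (C := C) Y, ⟨freeFib (C := C) Y⟩⟩

instance : (fiber G C).IsEquivalence where

end Induced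

end FunMod

/-! ### The tensor product of modules -/

section TensorOverStructure

variable {B : Type*} [Category B] [MonoidalCategory B] [HasCoequalizers B]
  [∀ X : B, PreservesColimitsOfSize.{0, 0} (tensorLeft X)]
  [∀ X : B, PreservesColimitsOfSize.{0, 0} (tensorRight X)] {A : Mon B} (M N P : Bimod A A)

variable {N P} in
-- These formulas describe the structure maps of bimodules on representatives; the projections are
-- epimorphisms, so nothing else about them is needed.
lemma tπ_whiskerLeft (f : N ⟶ P) : tπ M N ≫ (M ◁ f).hom = M.X ◁ f.hom ≫ tπ M P :=
  ι_colimMap _ _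

variable {M P} in
lemma tπ_whiskerRight (f : M ⟶ P) : tπ M N ≫ (f ▷ N).hom = f.hom ▷ N.X ≫ tπ P N :=
  ι_colimMap _ _

lemma tπ_leftUnitor : tπ (𝟙_ (Bimod A A)) M ≫ (λ_ M).hom.hom = M.actLeft :=
  coequalizer.π_desc _ _

lemma tπ_rightUnitor : tπ M (𝟙_ (Bimod A A)) ≫ (ρ_ M).hom.hom = M.actRight :=
  coequalizer.π_desc _ _

lemma tπ_associator : tπ M N ▷ P.X ≫ tπ (M ⊗ N) P ≫ (α_ M N P).hom.hom =
    (α_ _ _ _).hom ≫ M.X ◁ tπ N P ≫ tπ M (N ⊗ P) := by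
  have h : tπ (M ⊗ N) P ≫ (α_ M N P).hom.hom = Bimod.AssociatorBimod.homAux M N P :=
    coequalizer.π_desc _ _
  refine (congrArg (fun t => tπ M N ▷ P.X ≫ t) h).trans ?_
  exact π_tensor_id_preserves_coequalizer_inv_desc _ _ _ _

end TensorOverStructure

universe v u

namespace FunMod

section Tensor

variable {G : Type*} [Group G] [Fintype G] {C : Type u} [Category.{v} C] [Preadditive C]
  [HasFiniteBiproducts C] [MonoidalCategory C] [MonoidalPreadditive C] [CrossedData G C]
  [IsBraidedCrossed G C] [HasCoequalizers (Equivariant G C)]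
  [∀ X : Equivariant G C, PreservesColimitsOfSize.{0, 0} (tensorLeft X)]
  [∀ X : Equivariant G C, PreservesColimitsOfSize.{0, 0} (tensorRight X)]

variable (M N P : FunMod G C)

/-- The projection onto the tensor product of modules, as an equivariant morphism. -/
noncomputable def tproj : M.eq ⊗ N.eq ⟶ (M ⊗ N).eq := tπ M.obj N.obj

/-- The projection onto the tensor product of modules, as a morphism of `C`. -/
noncomputable def tp : M.eq.obj ⊗ N.eq.obj ⟶ (M ⊗ N).eq.obj := (tproj M N).hom

lemma tp_comm (g : G) : (act g).map (tp M N) ≫ ((M ⊗ N).eq.v g).hom =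
    (Equivariant.tensV (M.eq.v g) (N.eq.v g)).hom ≫ tp M N :=
  (tproj M N).comm g

lemma tp_condition : M.aR ▷ N.eq.obj ≫ tp M N =
    (α_ _ _ _).hom ≫ M.eq.obj ◁ N.aL ≫ tp M N :=
  congrArg (Equivariant.Hom.hom (G := G) (C := C)) (tπ_condition M.obj N.obj)

lemma tp_aL : funObj G C ◁ tp M N ≫ (M ⊗ N).aL =
    (α_ _ _ _).inv ≫ M.aL ▷ N.eq.obj ≫ tp M N :=
  congrArg (Equivariant.Hom.hom (G := G) (C := C)) (tπ_actLeft M.obj N.obj)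

variable {N P} in
lemma tp_whiskerLeft (f : N ⟶ P) : tp M N ≫ (hom (M ◁ f)).hom =
    M.eq.obj ◁ (hom f).hom ≫ tp M P :=
  congrArg (Equivariant.Hom.hom (G := G) (C := C)) (tπ_whiskerLeft M.obj f.hom)

variable {M P} in
lemma tp_whiskerRight (f : M ⟶ P) : tp M N ≫ (hom (f ▷ N)).hom =
    (hom f).hom ▷ N.eq.obj ≫ tp P N :=
  congrArg (Equivariant.Hom.hom (G := G) (C := C)) (tπ_whiskerRight N.obj f.hom)

lemma tp_leftUnitor : tp (𝟙_ (FunMod G C)) M ≫ (hom (λ_ M).hom).hom = M.aL :=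
  congrArg (Equivariant.Hom.hom (G := G) (C := C)) (tπ_leftUnitor M.obj)

lemma tp_rightUnitor : tp M (𝟙_ (FunMod G C)) ≫ (hom (ρ_ M).hom).hom = M.aR :=
  congrArg (Equivariant.Hom.hom (G := G) (C := C)) (tπ_rightUnitor M.obj)

lemma tp_associator : tp M N ▷ P.eq.obj ≫ tp (M ⊗ N) P ≫ (hom (α_ M N P).hom).hom =
    (α_ _ _ _).hom ≫ M.eq.obj ◁ tp N P ≫ tp M (N ⊗ P) :=
  congrArg (Equivariant.Hom.hom (G := G) (C := C)) (tπ_associator M.obj N.obj P.obj)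

instance : Epi (tproj M N) :=
  coequalizer.π_epi (C := BraidedRev (Equivariant G C)) (f := M.obj.actRight ▷ N.obj.X)
    (g := (α_ _ _ _).hom ≫ M.obj.X ◁ N.obj.actLeft)

instance : Epi (tp M N) :=
  inferInstanceAs (Epi ((Equivariant.forget G C).map (tproj M N)))

/-- The tensor product of modules is a coequalizer in `C`. -/
noncomputable def isColimitTp :
    IsColimit (Cofork.ofπ (f := M.aR ▷ N.eq.obj) (g := (α_ _ _ _).hom ≫ M.eq.obj ◁ N.aL)
      (tp M N) ((tp_condition M N).trans (Category.assoc _ _ _).symm)) :=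
  isColimitCoforkMapOfIsColimit (Equivariant.forget G C) (coequalizer.condition _ _)
    (coequalizerIsCoequalizer (C := BraidedRev (Equivariant G C)) (M.obj.actRight ▷ N.obj.X)
      ((α_ _ _ _).hom ≫ M.obj.X ◁ N.obj.actLeft))

variable {M} in
-- The balancing relation for δ_x, with the right action on degree h evaluated by `comp_aR`. It
-- pairs E_x on the second factor with E_{hx} on the first, and this shift produces the twist by h⁻¹
-- in ⊗^rev.
lemma comp_tp {h x y : G} (e : h * x = y) {W : C} (hW : deg h W) (f : W ⟶ M.eq.obj) :
    (f ⊗ₘ N.idem x) ≫ tp M N = (f ≫ M.idem y) ▷ _ ≫ tp M N := by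
  have h₁ : ((f ⊗ₘ delta C x) ⊗ₘ 𝟙 N.eq.obj) ≫ M.aR ▷ N.eq.obj =
      (ρ_ _).hom ▷ _ ≫ (f ≫ M.idem y) ▷ N.eq.obj := by
    rw [← comp_whiskerRight, ← comp_aR e hW]
    simp
  have h₂ : (f ⊗ₘ (delta C x ⊗ₘ 𝟙 N.eq.obj)) ≫ M.eq.obj ◁ N.aL =
      W ◁ (λ_ _).hom ≫ (f ⊗ₘ N.idem x) := by
    rw [tensorHom_id, ← id_tensorHom, MonoidalCategory.tensorHom_comp_tensorHom, delta_aL,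
      ← id_tensorHom, MonoidalCategory.tensorHom_comp_tensorHom]
    simp
  have h₃ := congrArg (fun t => ((f ⊗ₘ delta C x) ⊗ₘ 𝟙 N.eq.obj) ≫ t) (tp_condition M N)
  simp only [reassoc_of% h₁, associator_naturality_assoc, reassoc_of% h₂] at h₃
  rw [triangle_assoc] at h₃
  exact ((cancel_epi _).1 h₃).symm

lemma tp_idem (x : G) : tp M N ≫ (M ⊗ N).idem x = M.idem x ▷ N.eq.obj ≫ tp M N := by
  rw [idem, leftUnitor_inv_naturality_assoc, whisker_exchange_assoc, tp_aL,
    associator_inv_naturality_left_assoc, ← comp_whiskerRight_assoc, delta_aL]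
  simp

variable {M N} in
/-- The morphism of `C` from the tensor product of modules given by a balanced morphism. -/
lemma exists_tdesc {T : C} (f : M.eq.obj ⊗ N.eq.obj ⟶ T)
    (h : ∀ g x : G, (inc M.eq.obj g ⊗ₘ N.idem x) ≫ f = (inc M.eq.obj g ≫ M.idem (g * x)) ▷ _ ≫ f) :
    ∃ f' : (M ⊗ N).eq.obj ⟶ T, tp M N ≫ f' = f := by
  -- The coequalizer condition is tested on M_g and δ_x, where it becomes the hypothesis.
  have h' : M.aR ▷ N.eq.obj ≫ f = ((α_ _ _ _).hom ≫ M.eq.obj ◁ N.aL) ≫ f :=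
    map_component_ext (G := G) (tensorRight (funObj G C) ⋙ tensorRight N.eq.obj) fun g =>
      fun_map_ext (tensorLeft (comp M.eq.obj g) ⋙ tensorRight N.eq.obj) fun x => by
    have h₁ : (_ ◁ delta C x) ▷ _ ≫ (inc M.eq.obj g ▷ _) ▷ _ ≫ M.aR ▷ N.eq.obj ≫ f =
        (ρ_ _).hom ▷ _ ≫ (inc M.eq.obj g ≫ M.idem (g * x)) ▷ N.eq.obj ≫ f := by
      simp only [← comp_whiskerRight_assoc, whisker_aR (M := M) rfl (deg_comp M.eq.obj g)]
    have h₂ : (_ ◁ delta C x) ▷ _ ≫ (inc M.eq.obj g ▷ _) ▷ _ ≫ ((α_ _ _ _).hom ≫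
        M.eq.obj ◁ N.aL) ≫ f = (ρ_ _).hom ▷ _ ≫ (inc M.eq.obj g ⊗ₘ N.idem x) ≫ f := by
      rw [← triangle_assoc, MonoidalCategory.tensorHom_def']
      simp only [Category.assoc]
      rw [← whiskerLeft_comp_assoc, ← delta_aL]
      simp [whisker_exchange_assoc]
    exact h₁.trans ((congrArg (fun t => (ρ_ _).hom ▷ _ ≫ t) (h g x).symm).trans h₂.symm)
  obtain ⟨l, hl⟩ := Cofork.IsColimit.desc' (isColimitTp M N) f h'
  exact ⟨l, hl⟩

end Tensor

end FunMod

namespace Rev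

variable {G : Type*} [Group G] [Fintype G] {C : Type*} [Category C] [Preadditive C]
  [HasFiniteBiproducts C] [MonoidalCategory C] [MonoidalPreadditive C] [CrossedData G C]
  [IsBraidedCrossed G C]

lemma untwist_associator (X : C) (Y Z : Equivariant G C) :
    untwist (tens G X Y.obj) Z.v ≫ untwist X Y.v ▷ Z.obj ≫ (α_ _ _ _).hom =
      assocHom X Y.obj Z.obj ≫ tensMap G (𝟙 X) (untwist Y.obj Z.v) ≫ untwist X (fun g => Equivariant.tensV (Y.v g) (Z.v g)) := by
  -- The equivariant structure of Y ⊗ Z carried over to Y ⊗^rev Z, so that `untwist` is equivariant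
  -- by construction.
  let w (g : G) : (act g).obj (tens G Y.obj Z.obj) ≅ tens G Y.obj Z.obj :=
    (act g).mapIso (untwistIso Y.obj Z.v) ≪≫ Equivariant.tensV (Y.v g) (Z.v g) ≪≫
      (untwistIso Y.obj Z.v).symm
  have hw (g : G) : (w g).hom ≫ untwist Y.obj Z.v =
      (act g).map (untwist Y.obj Z.v) ≫ (Equivariant.tensV (Y.v g) (Z.v g)).hom := by
    have := (untwistIso Y.obj Z.v).inv_hom_id
    rw [untwistIso_inv, untwistIso_hom] at this
    simp [w, this]
  have h := untwist_assoc X Y.v Z w (fun g => by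
    have h := actμ_untwist g (Y.v g) Z
    have h' := (untwistIso Y.obj Z.v).hom_inv_id
    rw [untwistIso_inv, untwistIso_hom] at h'
    simp only [w, Iso.trans_hom, Functor.mapIso_hom, untwistIso_hom, Iso.symm_hom, untwistIso_inv]
    rw [reassoc_of% h, h', Category.comp_id])
  rw [h, tensMap_untwist (𝟙 X) (untwist Y.obj Z.v) (fun g => (hw g).symm), id_tensorHom]

lemma comp_tensMap {X X' X'' Y Y' Y'' : C} (f : X ⟶ X') (f' : X' ⟶ X'') (g : Y ⟶ Y')
    (g' : Y' ⟶ Y'') : tensMap G f g ≫ tensMap G f' g' = tensMap G (f ≫ f') (g ≫ g') :=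
  tensMap_comp G f g f' g'

lemma comp_tensMap_assoc {X X' X'' Y Y' Y'' : C} (f : X ⟶ X') (f' : X' ⟶ X'') (g : Y ⟶ Y')
    (g' : Y' ⟶ Y'') {T : C} (t : tens G X'' Y'' ⟶ T) :
    tensMap G f g ≫ tensMap G f' g' ≫ t = tensMap G (f ≫ f') (g ≫ g') ≫ t := by
  rw [← Category.assoc, comp_tensMap]

end Rev

/-! ### The fiber functor is monoidal -/

namespace FunMod

open Rev

section Monoidal

variable {G : Type*} [Group G] [Fintype G] {C : Type u} [Category.{v} C] [Preadditive C]
  [HasFiniteBiproducts C] [MonoidalCategory C] [MonoidalPreadditive C] [CrossedData G C]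
  [IsBraidedCrossed G C] [HasCoequalizers (Equivariant G C)]
  [∀ X : Equivariant G C, PreservesColimitsOfSize.{0, 0} (tensorLeft X)]
  [∀ X : Equivariant G C, PreservesColimitsOfSize.{0, 0} (tensorRight X)]
  [IsIdempotentComplete C]

variable (M N P : FunMod G C)

/-- The tensor structure of the fiber functor. -/
noncomputable def fibμ : tens G M.fib N.fib ⟶ (M ⊗ N).fib :=
  tensMap G M.fi N.fi ≫ untwist M.eq.obj N.eq.v ≫ tp M N ≫ (M ⊗ N).fq

lemma idem_untwist {X : C} (f : X ⟶ M.eq.obj) {Y : C} (f' : Y ⟶ N.eq.obj) :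
    tensMap G f f' ≫ untwist M.eq.obj N.eq.v ≫ tp M N ≫ (M ⊗ N).idem 1 =
      tensMap G (f ≫ M.idem 1) f' ≫ untwist M.eq.obj N.eq.v ≫ tp M N := by
  have h := tensMap_untwist (G := G) (M.idem 1) (y := N.eq.v) (y' := N.eq.v) (𝟙 N.eq.obj)
    (fun g => by simp)
  rw [tensorHom_id] at h
  rw [tp_idem, ← reassoc_of% h, ← Category.assoc, comp_tensMap, Category.comp_id]

/-- On M ⊗_A N the idempotent E_1 acts through the first factor, where the inclusion of the fiber
absorbs it. So no projection is left, and identities for `fibμ` can be checked after the inclusion.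
-/
lemma fibμ_fi : fibμ M N ≫ (M ⊗ N).fi =
    tensMap G M.fi N.fi ≫ untwist M.eq.obj N.eq.v ≫ tp M N := by
  rw [fibμ, Category.assoc, Category.assoc, Category.assoc, fq_fi, idem_untwist, fi_idem]

instance : Epi M.fq := (SplitEpi.mk _ M.fi_fq).epi

lemma hom_fi_ext {T : C} {f f' : T ⟶ M.fib} (h : f ≫ M.fi = f' ≫ M.fi) : f = f' := by
  rw [← Category.comp_id f, ← Category.comp_id f', ← fi_fq, ← Category.assoc, h, Category.assoc]

variable {M P} in
lemma fibμ_natural_left (f : M ⟶ P) :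
    tensMap G (M.fi ≫ (hom f).hom ≫ P.fq) (𝟙 N.fib) ≫ fibμ P N =
      fibμ M N ≫ (M ⊗ N).fi ≫ (hom (f ▷ N)).hom ≫ (P ⊗ N).fq := by
  have h := tensMap_untwist (G := G) (hom f).hom (y := N.eq.v) (y' := N.eq.v) (𝟙 N.eq.obj)
    (fun g => by simp)
  rw [tensorHom_id] at h
  refine hom_fi_ext _ ?_
  rw [Category.assoc, fibμ_fi, comp_tensMap_assoc, fi_fq_hom, Category.assoc,
    fi_fq_hom, reassoc_of% fibμ_fi, tp_whiskerRight, ← reassoc_of% h, comp_tensMap_assoc,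
    Category.comp_id, Category.id_comp]

variable {N P} in
lemma fibμ_natural_right (f : N ⟶ P) :
    tensMap G (𝟙 M.fib) (N.fi ≫ (hom f).hom ≫ P.fq) ≫ fibμ M P =
      fibμ M N ≫ (M ⊗ N).fi ≫ (hom (M ◁ f)).hom ≫ (M ⊗ P).fq := by
  have h := tensMap_untwist (G := G) (𝟙 M.eq.obj) (y := N.eq.v) (y' := P.eq.v) (hom f).hom
    (hom f).comm
  rw [id_tensorHom] at h
  refine hom_fi_ext _ ?_
  rw [Category.assoc, fibμ_fi, comp_tensMap_assoc, fi_fq_hom, Category.assoc,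
    fi_fq_hom, reassoc_of% fibμ_fi, tp_whiskerLeft, ← reassoc_of% h, comp_tensMap_assoc,
    Category.comp_id, Category.id_comp]

/-- With all inclusions of fibers moved to the front, what remains is `untwist_associator` in `C`
and `tp_associator` for modules. -/
lemma fibμ_associator :
    tensMap G (fibμ M N) (𝟙 P.fib) ≫ fibμ (M ⊗ N) P ≫
        ((M ⊗ N) ⊗ P).fi ≫ (hom (α_ M N P).hom).hom ≫ (M ⊗ N ⊗ P).fq =
      assocHom M.fib N.fib P.fib ≫ tensMap G (𝟙 M.fib) (fibμ N P) ≫ fibμ M (N ⊗ P) := by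
  have h₁ := tensMap_untwist (G := G) (tp M N) (y := P.eq.v) (y' := P.eq.v) (𝟙 P.eq.obj)
    (fun g => by simp)
  have h₂ := tensMap_untwist (G := G) (untwist M.eq.obj N.eq.v) (y := P.eq.v) (y' := P.eq.v)
    (𝟙 P.eq.obj) (fun g => by simp)
  have h₃ := tensMap_untwist (G := G) (𝟙 M.eq.obj) (y := fun g => Equivariant.tensV (N.eq.v g) (P.eq.v g)) (y' := (N ⊗ P).eq.v)
    (tp N P) (tp_comm N P)
  rw [tensorHom_id] at h₁ h₂
  rw [id_tensorHom] at h₃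
  have h₄ : tensMap G (fibμ M N) (𝟙 P.fib) ≫ tensMap G (M ⊗ N).fi P.fi =
      tensMap G (tensMap G M.fi N.fi) P.fi ≫ tensMap G (untwist M.eq.obj N.eq.v) (𝟙 P.eq.obj) ≫
        tensMap G (tp M N) (𝟙 P.eq.obj) := by
    rw [comp_tensMap, comp_tensMap, comp_tensMap, fibμ_fi]
    simp
  have h₅ : tensMap G (𝟙 M.fib) (fibμ N P) ≫ tensMap G M.fi (N ⊗ P).fi =
      tensMap G M.fi (tensMap G N.fi P.fi) ≫ tensMap G (𝟙 M.eq.obj) (untwist N.eq.obj P.eq.v) ≫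
        tensMap G (𝟙 M.eq.obj) (tp N P) := by
    rw [comp_tensMap, comp_tensMap, comp_tensMap, fibμ_fi]
    simp
  have h₆ := tp_associator M N P
  have h₇ := untwist_associator M.eq.obj N.eq P.eq
  refine hom_fi_ext _ ?_
  rw [Category.assoc, Category.assoc, fi_fq_hom, reassoc_of% fibμ_fi, Category.assoc, Category.assoc,
    fibμ_fi, reassoc_of% h₄, reassoc_of% h₅, reassoc_of% h₁, h₆, reassoc_of% h₂, reassoc_of% h₇,
    reassoc_of% h₃, ← reassoc_of% (assocHom_naturality G)]

lemma unit_idem_eq (x : G) : (λ_ (funObj G C)).inv ≫ delta C x ▷ funObj G C ≫ funMul G C =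
    ev C x ≫ delta C x :=
  fun_map_ext (𝟭 C) fun y => by
    change delta C y ≫ _ = delta C y ≫ _
    have h := delta_funMul (C := C) x y
    rw [MonoidalCategory.tensorHom_def', Category.assoc] at h
    rw [leftUnitor_inv_naturality_assoc, h, Iso.inv_hom_id_assoc]
    by_cases e : x = y
    · subst e
      rfl
    · rw [reassoc_of% (delta_ev_ne (C := C) e), reassoc_of% (delta_ev_ne (C := C) (Ne.symm e))]
      simp

variable (G C) in
/-- The inclusion of the fiber of the unit object. -/
noncomputable def unitFi : (𝟙_ (FunMod G C)).fib ⟶ funObj G C := fi (𝟙_ (FunMod G C))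

variable (G C) in
/-- The projection to the fiber of the unit object. -/
noncomputable def unitFq : funObj G C ⟶ (𝟙_ (FunMod G C)).fib := fq (𝟙_ (FunMod G C))

lemma unitFi_fq : unitFi G C ≫ unitFq G C = 𝟙 _ := fi_fq (𝟙_ (FunMod G C))

lemma unitFq_fi : unitFq G C ≫ unitFi G C = ev C 1 ≫ delta C 1 :=
  (fq_fi (𝟙_ (FunMod G C))).trans (unit_idem_eq 1)

variable (G C) in
/-- The unit constraint of the fiber functor. -/
@[simps] noncomputable def fibε : 𝟙_ C ≅ (𝟙_ (FunMod G C)).fib where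
  hom := delta C (1 : G) ≫ unitFq G C
  inv := unitFi G C ≫ ev C (1 : G)
  hom_inv_id := by
    rw [Category.assoc, reassoc_of% unitFq_fi, delta_ev, Category.comp_id, delta_ev]
  inv_hom_id := by
    rw [Category.assoc, ← Category.assoc (ev C _), ← unitFq_fi, Category.assoc, unitFi_fq,
      Category.comp_id, unitFi_fq]

lemma fibε_fi : (fibε G C).hom ≫ unitFi G C = delta C (1 : G) := by
  rw [fibε_hom, Category.assoc, unitFq_fi, reassoc_of% (delta_ev (C := C) (1 : G))]

lemma fibμ_unit_left : fibμ (𝟙_ _) M ≫ fi _ ≫ (hom (λ_ M).hom).hom =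
    tensMap G (unitFi G C) M.fi ≫ untwist (funObj G C) M.eq.v ≫ M.aL := by
  rw [reassoc_of% fibμ_fi, tp_leftUnitor]
  rfl

lemma fibμ_unit_right : fibμ M (𝟙_ _) ≫ fi _ ≫ (hom (ρ_ M).hom).hom =
    tensMap G M.fi (unitFi G C) ≫ untwist M.eq.obj (fun g => funV g) ≫ M.aR := by
  rw [reassoc_of% fibμ_fi, tp_rightUnitor]
  rfl

lemma fib_leftUnitor : (leftU G M.fib).hom = tensMap G (fibε G C).hom (𝟙 M.fib) ≫
    fibμ (𝟙_ _) M ≫ fi _ ≫ (hom (λ_ M).hom).hom ≫ M.fq := by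
  have h₁ := leftU_inv_untwist M.eq
  rw [Iso.inv_comp_eq] at h₁
  have h₂ := leftU_naturality G M.fi
  have h := tensMap_untwist (G := G) (delta C (1 : G)) (y := M.eq.v) (y' := M.eq.v) (𝟙 M.eq.obj)
    (fun g => by simp)
  rw [tensorHom_id] at h
  refine hom_fi_ext _ ?_
  rw [Category.assoc, Category.assoc, fi_fq_hom, fibμ_unit_left, comp_tensMap_assoc, fibε_fi,
    Category.id_comp, ← Category.id_comp (delta C (1 : G)), ← Category.comp_id M.fi,
    ← comp_tensMap_assoc, reassoc_of% h, delta_aL, h₁, Category.assoc, Iso.inv_hom_id_assoc,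
    reassoc_of% h₂, Category.comp_id, fi_idem]

lemma fib_rightUnitor : rightHom G M.fib = tensMap G (𝟙 M.fib) (fibε G C).hom ≫
    fibμ M (𝟙_ _) ≫ fi _ ≫ (hom (ρ_ M).hom).hom ≫ M.fq := by
  refine (cancel_epi (rightU G M.fib).inv).1 ((rightU G M.fib).inv_hom_id.trans ?_)
  refine hom_fi_ext _ ?_
  rw [Category.assoc, Category.assoc, Category.assoc, fi_fq_hom, fibμ_unit_right,
    comp_tensMap_assoc, fibε_fi, Category.id_comp, rightU_inv]
  refine map_component_ext (G := G) (𝟭 C) fun g => ?_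
  change inc M.fib g ≫ _ = inc M.fib g ≫ _
  have hg := deg_comp M.fib g
  -- The twist by g⁻¹ turns δ_1 into δ_{g⁻¹}, whose right action on degree g is again E_1.
  have h₁ : comp M.fib g ◁ ε g⁻¹ ≫
      (inc M.fib g ≫ M.fi ⊗ₘ (act g⁻¹).map (delta C 1) ≫ (funV g⁻¹).hom) =
      (inc M.fib g ≫ M.fi ⊗ₘ delta C g⁻¹) := by
    rw [← id_tensorHom, MonoidalCategory.tensorHom_comp_tensorHom, delta_funV (mul_one _),
      Category.id_comp]
  rw [reassoc_of% (comp_rightInv hg), reassoc_of% (into_tensMap hg), Category.id_comp,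
    reassoc_of% (into_untwist hg), reassoc_of% h₁, comp_aR (mul_inv_cancel g) hg, Category.assoc,
    fi_idem, Iso.inv_hom_id_assoc]

/-- Supplies the inverse of `fibμ`. The map is balanced because on M_g ⊗ N both E_x on N, seen
through v_{g⁻¹}, and E_{gx} on M survive the projections to the fibers only when gx = 1, where both
act trivially. -/
lemma exists_retwist : ∃ κ : (M ⊗ N).eq.obj ⟶ tens G M.fib N.fib,
    tp M N ≫ κ = retwist M.eq.obj N.eq.v ≫ tensMap G M.fq N.fq := by
  refine exists_tdesc _ fun g x => ?_
  have hg := deg_comp M.eq.obj g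
  have h₁ : N.idem x ≫ (N.eq.v g⁻¹).inv = (N.eq.v g⁻¹).inv ≫ (act g⁻¹).map (N.idem (g * x)) := by
    rw [Iso.comp_inv_eq, Category.assoc, map_idem N (inv_mul_cancel_left g x), Iso.inv_hom_id_assoc]
  rw [MonoidalCategory.tensorHom_def', Category.assoc, reassoc_of% (whisker_retwist hg),
    reassoc_of% (whisker_retwist hg), ← whiskerLeft_comp_assoc, h₁, whiskerLeft_comp_assoc,
    reassoc_of% (whiskerLeft_into hg), into_tensMap, into_tensMap]
  by_cases e : g * x = 1
  · rw [e, Category.comp_id, Category.id_comp, idem_fq, Category.assoc, idem_fq]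
  · rw [Category.comp_id, idem_fq_ne N e, Category.assoc, idem_fq_ne M e]
    simp [into]

instance : IsIso (fibμ M N) := by
  obtain ⟨κ, hκ⟩ := exists_retwist M N
  refine ⟨(M ⊗ N).fi ≫ κ, ?_, ?_⟩
  · have h := (untwistIso M.eq.obj N.eq.v).hom_inv_id
    rw [untwistIso_hom, untwistIso_inv] at h
    rw [reassoc_of% fibμ_fi, hκ, reassoc_of% h, comp_tensMap, fi_fq, fi_fq, tensMap_id]
  · refine hom_fi_ext _ ((cancel_epi (M ⊗ N).fq).1 ((cancel_epi (tp M N)).1 ?_))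
    have h₁ : (M ⊗ N).fq ≫ (((M ⊗ N).fi ≫ κ) ≫ fibμ M N) ≫ (M ⊗ N).fi =
        (M ⊗ N).idem 1 ≫ κ ≫ tensMap G M.fi N.fi ≫ untwist M.eq.obj N.eq.v ≫ tp M N := by
      rw [Category.assoc, Category.assoc, fibμ_fi, ← Category.assoc, fq_fi]
    rw [h₁, Category.id_comp, fq_fi, reassoc_of% (tp_idem M N), tp_idem, reassoc_of% hκ,
      comp_tensMap_assoc, fq_fi, fq_fi]
    -- On M_g the two sides differ by E_{g⁻¹} on the second factor. By `comp_tp` this equals E_1 on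
    -- the first factor, which is already there.
    refine whisker_component_ext (G := G) fun g => ?_
    have hg := deg_comp M.eq.obj g
    rw [← comp_whiskerRight_assoc, reassoc_of% (whisker_retwist hg), ← comp_whiskerRight_assoc,
      reassoc_of% (into_tensMap hg), reassoc_of% (into_untwist hg), Category.id_comp,
      map_idem N (mul_one _), MonoidalCategory.tensorHom_def', whiskerLeft_comp, Category.assoc,
      Category.assoc, ← whiskerLeft_comp_assoc, Iso.inv_hom_id, whiskerLeft_id, Category.id_comp,
      Category.assoc (inc _ _), idem_idem]
    have h₂ := comp_tp N (mul_inv_cancel g) hg (inc M.eq.obj g ≫ M.idem 1)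
    rw [MonoidalCategory.tensorHom_def', Category.assoc, Category.assoc, idem_idem] at h₂
    exact h₂

noncomputable instance : (fiber G C).LaxMonoidal where
  ε := (fibε G C).hom
  μ M N := fibμ M N
  μ_natural_left f N := fibμ_natural_left N f
  μ_natural_right M f := fibμ_natural_right M f
  associativity M N P := fibμ_associator M N P
  left_unitality M := fib_leftUnitor M
  right_unitality M := fib_rightUnitor M

instance : IsIso (Functor.LaxMonoidal.ε (fiber G C)) :=
  inferInstanceAs (IsIso (fibε G C).hom)

instance (M N : FunMod G C) : IsIso (Functor.LaxMonoidal.μ (fiber G C) M N) :=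
  inferInstanceAs (IsIso (fibμ M N))

noncomputable instance : (fiber G C).Monoidal := Functor.Monoidal.ofLaxMonoidal _

end Monoidal

end FunMod

/-! ### Crossed braidings on homogeneous objects -/

namespace Rev

variable {G : Type*} [Group G] [Fintype G] {C : Type*} [Category C] [Preadditive C]
  [HasFiniteBiproducts C] [MonoidalCategory C] [MonoidalPreadditive C] [CrossedData G C]
  [IsBraidedCrossed G C]

lemma homogeneous_ext {a : G} {X Y T : C} (hX : deg a X) {f f' : tens G X Y ⟶ T}
    (h : into hX (𝟙 X) (𝟙 Y) ≫ f = into hX (𝟙 X) (𝟙 Y) ≫ f') : f = f' :=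
  tens_ext fun g => by
    by_cases e : g = a
    · subst e
      have h' := whiskerRight_into (V := Y) (Y := Y) hX (deg_comp X g) (inc X g) (𝟙 X) (𝟙 Y)
      rw [Category.comp_id] at h'
      rw [← h', Category.assoc, Category.assoc, h]
    · rw [IsBraidedCrossed.deg_orthogonal e (deg_comp X g) hX (inc X g), into_zero, zero_comp,
        zero_comp]

lemma actμ_natural (g : G) {X X' Y Y' : C} (f : X ⟶ X') (f' : Y ⟶ Y') :
    tensMap G ((act g).map f) ((act g).map f') ≫ actμ g X' Y' =
      actμ g X Y ≫ (act g).map (tensMap G f f') := by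
  have h (X X' Y Y' : Rev G C) (f : X ⟶ X') (f' : Y ⟶ Y') := IsAction.μ_natural g f f'
  exact h X X' Y Y' f f'

/-- `crossed_toOp` removes the braiding, and X has a single component; both sides reduce to f
tensored with v_{a⁻¹} ∘ a⁻¹(f'). -/
lemma crossed_tensMap_toOp {a : G} {X : C} (hX : deg a X) {Y X' : C} (Z : Equivariant G C)
    (f : X ⟶ X') (f' : Y ⟶ Z.obj) :
    crossed hX Y ≫ tensMap G ((act a⁻¹).map f' ≫ (Z.v a⁻¹).hom) f ≫ toOp G Z.obj X' =
      tensMap G f f' ≫ untwist X' Z.v :=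
  homogeneous_ext hX (by
    rw [tensMap_toOp, reassoc_of% crossed_toOp, reassoc_of% into_outof, reassoc_of% into_tensMap,
      into_untwist, Category.comp_id, Category.comp_id, (act _).map_id,
      MonoidalCategory.tensorHom_comp_tensorHom, Category.id_comp, Category.id_comp,
      Category.id_comp])

end Rev

/-! ### The fiber functor and the action of G -/

namespace FunMod

open Rev

section Twist

variable {G : Type*} [Group G] [Fintype G] {C : Type u} [Category.{v} C] [Preadditive C]
  [HasFiniteBiproducts C] [MonoidalCategory C] [MonoidalPreadditive C] [CrossedData G C]
  [IsBraidedCrossed G C]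

variable (g : G) (M N : FunMod G C)

/-- The twist of a module by right translation. -/
noncomputable abbrev tw : FunMod G C := DeEquiv.twist g M

/-- Right translation takes δ_x to δ_{xg}. In particular the fiber at 1 of the twist is the image of
E_g in M, which v_g identifies with g(M_1). -/
lemma idem_tw (x : G) : (tw g M).idem x = M.idem (x * g) := by
  have h : (tw g M).aL = funT C g ▷ M.eq.obj ≫ M.aL := rfl
  have h' : (tw g M).idem x = (λ_ _).inv ≫ delta C x ▷ M.eq.obj ≫ funT C g ▷ M.eq.obj ≫ M.aL := rfl
  rw [h', ← comp_whiskerRight_assoc, delta_T, delta_aL, Iso.inv_hom_id_assoc]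

variable [IsIdempotentComplete C]

/-- The inclusion of the fiber of the twist. -/
noncomputable def twi : (tw g M).fib ⟶ M.eq.obj := (tw g M).fi

/-- The projection to the fiber of the twist. -/
noncomputable def twq : M.eq.obj ⟶ (tw g M).fib := (tw g M).fq

lemma twi_twq : twi g M ≫ twq g M = 𝟙 _ := (tw g M).fi_fq

lemma twq_twi : twq g M ≫ twi g M = M.idem g :=
  ((tw g M).fq_fi.trans (idem_tw g M 1)).trans (congrArg _ (one_mul g))

lemma twi_idem : twi g M ≫ M.idem g = twi g M := by
  rw [← twq_twi, ← Category.assoc, twi_twq, Category.id_comp]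

lemma v_idem_v : (M.eq.v g).inv ≫ (act g).map (M.idem 1) ≫ (M.eq.v g).hom = M.idem g := by
  rw [map_idem M (mul_one g), Iso.inv_hom_id_assoc]

/-- The fiber of the twist is obtained by the action of `G` on `C`. -/
@[simps] noncomputable def fibη : (tw g M).fib ≅ (act g).obj M.fib where
  hom := twi g M ≫ (M.eq.v g).inv ≫ (act g).map M.fq
  inv := (act g).map M.fi ≫ (M.eq.v g).hom ≫ twq g M
  hom_inv_id := by
    have h := v_idem_v g M
    rw [← fq_fi, Functor.map_comp, Category.assoc] at h
    rw [Category.assoc, Category.assoc, reassoc_of% h, reassoc_of% twi_idem, twi_twq]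
  inv_hom_id := by
    have h := map_idem M (mul_one g)
    rw [Category.assoc, Category.assoc, reassoc_of% twq_twi, ← reassoc_of% h, Iso.hom_inv_id_assoc,
      ← Functor.map_comp, idem_fq, ← Functor.map_comp, fi_fq, CategoryTheory.Functor.map_id]

lemma fibη_v : (fibη g M).hom ≫ (act g).map M.fi ≫ (M.eq.v g).hom = twi g M := by
  have h := v_idem_v g M
  rw [← fq_fi, Functor.map_comp, Category.assoc] at h
  rw [fibη_hom, Category.assoc, Category.assoc, h, twi_idem]

lemma fibη_inv_twi : (fibη g M).inv ≫ twi g M = (act g).map M.fi ≫ (M.eq.v g).hom := by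
  rw [Iso.inv_comp_eq, fibη_v]

/-- g(M_1) is a retract of M by way of v_g, so compatibilities of `fibη` can be compared inside M;
there `fibη` becomes the inclusion of the fiber of the twist. -/
lemma act_fib_ext {T : C} {f f' : T ⟶ (act g).obj M.fib}
    (h : f ≫ (act g).map M.fi ≫ (M.eq.v g).hom = f' ≫ (act g).map M.fi ≫ (M.eq.v g).hom) : f = f' := by
  rw [← Category.assoc, ← Category.assoc, cancel_mono] at h
  have h' := congrArg (fun t => t ≫ (act g).map M.fq) h
  simpa only [Category.assoc, ← Functor.map_comp, fi_fq, CategoryTheory.Functor.map_id, Category.comp_id] using h'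

variable {M N} in
lemma fibη_natural (f : M ⟶ N) :
    ((tw g M).fi ≫ (hom ((DeEquiv.actFunctor g).map f)).hom ≫ (tw g N).fq) ≫ (fibη g N).hom =
      (fibη g M).hom ≫ (act g).map (M.fi ≫ (hom f).hom ≫ N.fq) := by
  have h : ((tw g M).fi ≫ (hom ((DeEquiv.actFunctor g).map f)).hom ≫ (tw g N).fq) ≫ twi g N =
      twi g M ≫ (hom f).hom := fi_fq_hom ((DeEquiv.actFunctor g).map f)
  refine act_fib_ext g N ?_
  rw [Category.assoc, fibη_v, h, Category.assoc, ← Functor.map_comp_assoc, fi_fq_hom,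
    Functor.map_comp_assoc, (hom f).comm, reassoc_of% fibη_v]

end Twist

section Monoidal

variable {G : Type*} [Group G] [Fintype G] {C : Type u} [Category.{v} C] [Preadditive C]
  [HasFiniteBiproducts C] [MonoidalCategory C] [MonoidalPreadditive C] [CrossedData G C]
  [IsBraidedCrossed G C] [HasCoequalizers (Equivariant G C)]
  [∀ X : Equivariant G C, PreservesColimitsOfSize.{0, 0} (tensorLeft X)]
  [∀ X : Equivariant G C, PreservesColimitsOfSize.{0, 0} (tensorRight X)]

variable (g : G) (M N : FunMod G C)

lemma tp_twist : tp (tw g M) (tw g N) ≫ (hom (DeEquiv.twistμ g M N)).hom = tp M N :=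
  congrArg (Equivariant.Hom.hom (G := G) (C := C))
    (DeEquiv.tπ_tensorTwist ((revFunctions G C).t g) M.obj N.obj)

variable {g M} in
-- The modules live in the reverse category, so the braiding appearing on representatives is the
-- inverse one of C^G.
lemma tp_braiding (hM : DeEquiv.degree g M) : tp M N ≫ (hom (DeEquiv.twistBraiding hM N)).hom =
    Equivariant.braidInv N.eq.obj M.eq.v ≫ tp (tw g N) M :=
  congrArg (Equivariant.Hom.hom (G := G) (C := C)) (tπ_tdesc M.obj N.obj _ (DeEquiv.braiding_balanced
      ((revFunctions G C).t g) M.property N.property (DeEquiv.inv_t (revFunctions G C) g) hM))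

variable [IsIdempotentComplete C]

/-- Twisting twice keeps the underlying object, so after inclusion into M the comparison is the
cocycle condition for v. -/
lemma fibη_γ {g h l : G} (e : g * h = l) :
    ((tw g (tw h M)).fi ≫ (hom (DeEquiv.twistγ e M)).hom ≫ (tw l M).fq) ≫ (fibη l M).hom =
      (fibη g (tw h M)).hom ≫ (act g).map (fibη h M).hom ≫ γ e M.fib := by
  have h₁ : ((tw g (tw h M)).fi ≫ (hom (DeEquiv.twistγ e M)).hom ≫ (tw l M).fq) ≫ twi l M =
      twi g (tw h M) := (fi_fq_hom (DeEquiv.twistγ e M)).trans (Category.comp_id _)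
  have h₂ : (fibη g (tw h M)).hom ≫ (act g).map (twi h M) ≫ (M.eq.v g).hom = twi g (tw h M) :=
    fibη_v g (tw h M)
  refine act_fib_ext l M ?_
  rw [Category.assoc, fibη_v, h₁, Category.assoc, Category.assoc,
    ← reassoc_of% (IsAction.γ_natural e), M.eq.v_mul e, ← Functor.map_comp_assoc,
    ← Functor.map_comp_assoc, Category.assoc, fibη_v, h₂]

lemma fibη_ι {u : G} (e : u = 1) :
    (M.fi ≫ (hom (DeEquiv.twistι e M)).hom ≫ (tw u M).fq) ≫ (fibη u M).hom = ι e M.fib := by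
  have h₁ : (M.fi ≫ (hom (DeEquiv.twistι e M)).hom ≫ (tw u M).fq) ≫ twi u M = M.fi :=
    (fi_fq_hom (DeEquiv.twistι e M)).trans (Category.comp_id _)
  refine act_fib_ext u M ?_
  rw [Category.assoc, fibη_v, h₁, ← reassoc_of% (IsAction.ι_natural e), Equivariant.ι_v,
    Category.comp_id]

lemma fibη_μ : fibμ (tw g M) (tw g N) ≫
    ((tw g M ⊗ tw g N).fi ≫ (hom (DeEquiv.twistμ g M N)).hom ≫ (tw g (M ⊗ N)).fq) ≫
      (fibη g (M ⊗ N)).hom =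
    tensMap G (fibη g M).hom (fibη g N).hom ≫ actμ g M.fib N.fib ≫ (act g).map (fibμ M N) := by
  have h₁ : ((tw g M ⊗ tw g N).fi ≫ (hom (DeEquiv.twistμ g M N)).hom ≫ (tw g (M ⊗ N)).fq) ≫
      twi g (M ⊗ N) = (tw g M ⊗ tw g N).fi ≫ (hom (DeEquiv.twistμ g M N)).hom :=
    fi_fq_hom (DeEquiv.twistμ g M N)
  have h₂ : fibμ (tw g M) (tw g N) ≫ (tw g M ⊗ tw g N).fi ≫ (hom (DeEquiv.twistμ g M N)).hom =
      tensMap G (twi g M) (twi g N) ≫ untwist M.eq.obj N.eq.v ≫ tp M N := by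
    rw [reassoc_of% fibμ_fi, tp_twist]
    rfl
  refine act_fib_ext g _ ?_
  rw [Category.assoc, Category.assoc, fibη_v]
  refine (congrArg (fun t => fibμ (tw g M) (tw g N) ≫ t) h₁).trans (h₂.trans (Eq.symm ?_))
  have h₃ : ((tensMap G (fibη g M).hom (fibη g N).hom ≫ actμ g M.fib N.fib ≫
      (act g).map (fibμ M N)) ≫ (act g).map (M ⊗ N).fi ≫ ((M ⊗ N).eq.v g).hom) =
      tensMap G (twi g M) (twi g N) ≫ untwist M.eq.obj N.eq.v ≫ tp M N := ?_
  · exact h₃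
  rw [Category.assoc, Category.assoc,
    ← Functor.map_comp_assoc, fibμ_fi, Functor.map_comp, Functor.map_comp, Category.assoc,
    Category.assoc, tp_comm, ← reassoc_of% actμ_natural, reassoc_of% actμ_untwist,
    comp_tensMap_assoc, comp_tensMap_assoc, Category.assoc, Category.assoc, fibη_v, fibη_v]

lemma fibη_ε : (fibε G C).hom ≫ ((𝟙_ (FunMod G C)).fi ≫ (hom (DeEquiv.twistε g)).hom ≫
    (tw g (𝟙_ (FunMod G C))).fq) ≫ (fibη g (𝟙_ (FunMod G C))).hom =
      ε g ≫ (act g).map (fibε G C).hom := by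
  have h₁ : ((𝟙_ (FunMod G C)).fi ≫ (hom (DeEquiv.twistε g)).hom ≫
      (tw g (𝟙_ (FunMod G C))).fq) ≫ twi g (𝟙_ (FunMod G C)) = unitFi G C ≫ funT C g :=
    fi_fq_hom (DeEquiv.twistε g)
  have h₂ : (act g).map (fibε G C).hom ≫ (act g).map (𝟙_ (FunMod G C)).fi ≫
      ((𝟙_ (FunMod G C)).eq.v g).hom = (act g).map (delta C (1 : G)) ≫ (funV g).hom := by
    rw [← Functor.map_comp_assoc]
    exact congrArg (fun t => (act g).map t ≫ (funV g).hom) fibε_fi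
  refine act_fib_ext g _ ?_
  have h₃ : (fibε G C).hom ≫ unitFi G C ≫ funT C g = delta C g := by
    rw [← Category.assoc]
    refine (congrArg (fun t => t ≫ funT C g) fibε_fi).trans ?_
    rw [delta_T, one_mul]
  rw [Category.assoc, Category.assoc, fibη_v]
  refine (congrArg (fun t => (fibε G C).hom ≫ t) h₁).trans (h₃.trans ?_)
  rw [Category.assoc, h₂]
  exact (delta_funV (mul_one g)).symm

variable {g M} in
-- The argument of part (a) once more: composing with the braiding of C^G turns the inverse braiding
-- into the identity and the crossed braiding of C^rev into its defining cancellation.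
lemma fib_braiding (hM : DeEquiv.degree g M) (hX : deg g⁻¹ M.fib) :
    fibμ M N ≫ (M ⊗ N).fi ≫ (hom (DeEquiv.twistBraiding hM N)).hom ≫ (tw g N ⊗ M).fq =
      (crossed hX N.fib ≫ tensMap G (eqToHom (by rw [inv_inv])) (𝟙 M.fib)) ≫
        tensMap G (fibη g N).inv (𝟙 M.fib) ≫ fibμ (tw g N) M := by
  have : IsIso (Equivariant.braidHom N.eq.obj M.eq.v) :=
    (Equivariant.braidIso N.eq.obj M.eq.v).isIso_hom
  have hi : Equivariant.braidInv N.eq.obj M.eq.v ≫ Equivariant.braidHom N.eq.obj M.eq.v = 𝟙 _ :=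
    (Equivariant.braidIso N.eq.obj M.eq.v).inv_hom_id
  -- The twist g(N) has the underlying object of N, so its projection is regarded as a map out of N
  -- ⊗ M.
  obtain ⟨q, hq⟩ : ∃ q : N.eq.obj ⊗ M.eq.obj ⟶ (tw g N ⊗ M).eq.obj, q = tp (tw g N) M := ⟨_, rfl⟩
  have h₀ : tp M N ≫ (hom (DeEquiv.twistBraiding hM N)).hom =
      Equivariant.braidInv N.eq.obj M.eq.v ≫ q := by
    subst hq
    exact tp_braiding N hM
  have h₁ : fibμ (tw g N) M ≫ (tw g N ⊗ M).fi =
      tensMap G (twi g N) M.fi ≫ untwist N.eq.obj M.eq.v ≫ q := by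
    subst hq
    exact fibμ_fi _ _
  have h₂ (a : G) (e : a = g) : eqToHom (by rw [e]) ≫ (act g).map N.fi ≫ (N.eq.v g).hom =
      (act a).map N.fi ≫ (N.eq.v a).hom := by
    subst e
    simp
  -- The essential identity; it involves only C^G and C^rev, before passing to the quotient ⊗_A.
  have h₃ : tensMap G M.fi N.fi ≫ untwist M.eq.obj N.eq.v ≫
        Equivariant.braidInv N.eq.obj M.eq.v =
      crossed hX N.fib ≫ tensMap G ((act g⁻¹⁻¹).map N.fi ≫ (N.eq.v g⁻¹⁻¹).hom) M.fi ≫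
        untwist N.eq.obj M.eq.v := by
    rw [← cancel_mono (Equivariant.braidHom N.eq.obj M.eq.v), Category.assoc, Category.assoc, hi,
      Category.comp_id, Category.assoc, Category.assoc, untwist_braidHom, crossed_tensMap_toOp]
  have h₄ : (M ⊗ N).fi ≫ (hom (DeEquiv.twistBraiding hM N)).hom ≫ (tw g N ⊗ M).fq ≫
      (tw g N ⊗ M).fi = (M ⊗ N).fi ≫ (hom (DeEquiv.twistBraiding hM N)).hom := by
    have h := fi_fq_hom (DeEquiv.twistBraiding hM N)
    rw [Category.assoc, Category.assoc] at h
    exact h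
  have h₅ : eqToHom (by rw [inv_inv]) ≫ (fibη g N).inv ≫ twi g N =
      (act g⁻¹⁻¹).map N.fi ≫ (N.eq.v g⁻¹⁻¹).hom := by
    rw [fibη_inv_twi, h₂ _ (inv_inv g)]
  have h₆ : fibμ M N ≫ (M ⊗ N).fi ≫ (hom (DeEquiv.twistBraiding hM N)).hom =
      crossed hX N.fib ≫ tensMap G ((act g⁻¹⁻¹).map N.fi ≫ (N.eq.v g⁻¹⁻¹).hom) M.fi ≫
        untwist N.eq.obj M.eq.v ≫ q := by
    rw [reassoc_of% fibμ_fi, h₀, reassoc_of% h₃]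
  have h₇ : tensMap G (eqToHom (by rw [inv_inv])) (𝟙 M.fib) ≫ tensMap G (fibη g N).inv (𝟙 M.fib) ≫
      tensMap G (twi g N) M.fi = tensMap G ((act g⁻¹⁻¹).map N.fi ≫ (N.eq.v g⁻¹⁻¹).hom) M.fi := by
    rw [comp_tensMap, comp_tensMap, h₅, Category.id_comp, Category.id_comp]
  refine hom_fi_ext _ ?_
  rw [Category.assoc, Category.assoc, Category.assoc, h₄, Category.assoc, Category.assoc,
    Category.assoc]
  refine h₆.trans (Eq.trans ?_ (congrArg (fun t => crossed hX N.fib ≫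
    tensMap G (eqToHom (by rw [inv_inv])) (𝟙 M.fib) ≫ tensMap G (fibη g N).inv (𝟙 M.fib) ≫ t)
    h₁.symm))
  rw [← reassoc_of% h₇]

end Monoidal

end FunMod

lemma isMonoidal_inverseMonoidal {C D : Type*} [Category C] [Category D] [MonoidalCategory C]
    [MonoidalCategory D] (e : C ≌ D) [e.functor.Monoidal] :
    letI := e.inverseMonoidal
    e.IsMonoidal := by
  let _ := e.toAdjunction.rightAdjointLaxMonoidal
  have h : e.toAdjunction.IsMonoidal := inferInstance
  exact h

/-- The inverse of a braided `G`-crossed equivalence is a braided `G`-crossed equivalence. -/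
lemma CrossedStructure.exists_inverse {G : Type*} [Group G] [Fintype G] {C D : Type*} [Category C]
    [MonoidalCategory C] [CrossedData G C] [Preadditive C] [Category D] [MonoidalCategory D]
    [CrossedData G D] [Preadditive D] [IsBraidedCrossed G D] (E : C ≌ D) [E.functor.Monoidal]
    (s : CrossedStructure G E.functor) :
    ∃ _ : E.inverse.Monoidal, Nonempty (CrossedStructure G E.inverse) := by
  let _ := E.inverseMonoidal
  have := isMonoidal_inverseMonoidal E
  exact ⟨inferInstance, ⟨CrossedStructure.symm E s⟩⟩

/-! ### Part (b): the braided crossed equivalence -/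

namespace FunMod

open Rev

variable {G : Type*} [Group G] [Fintype G] {C : Type u} [Category.{v} C] [Preadditive C]
  [HasFiniteBiproducts C] [MonoidalCategory C] [MonoidalPreadditive C] [CrossedData G C]
  [IsBraidedCrossed G C] [HasCoequalizers (Equivariant G C)]
  [∀ X : Equivariant G C, PreservesColimitsOfSize.{0, 0} (tensorLeft X)]
  [∀ X : Equivariant G C, PreservesColimitsOfSize.{0, 0} (tensorRight X)]
  [IsIdempotentComplete C]

variable (G C) in
/-- Taking fibers is a braided `G`-crossed functor. -/
noncomputable def fiberCrossed : CrossedStructure G (fiber G C) where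
  deg_iff _ M := deg_iff_fiber (M := M)
  η g M := fibη g M
  η_natural g _ _ f := fibη_natural g f
  η_γ e M := fibη_γ M e
  η_ι e M := fibη_ι M e
  η_μ g M N := fibη_μ g M N
  η_ε g := fibη_ε (C := C) g
  cb_compat {_ M} hM N := fib_braiding N hM ((deg_iff_fiber (M := M)).1 hM)

/-- Transported from C^rev along the fiber functor, with no separate verification for A-modules. -/
instance : IsBraidedCrossed G (FunMod G C) := by
  have h : IsBraidedCrossed G (Rev G C) := inferInstance
  exact CrossedStructure.isBraidedCrossed (D := Rev G C) (fiberCrossed G C)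

lemma exists_crossed_inverse : ∃ (_ : (fiber G C).inv.Monoidal),
    Nonempty (CrossedStructure G (fiber G C).inv) :=
  @CrossedStructure.exists_inverse G _ _ (FunMod G C) (Rev G C) _ _ _ _ _ _ _ _ _
    (fiber G C).asEquivalence (inferInstance : (fiber G C).Monoidal) (fiberCrossed G C)

lemma inv_additive : (fiber G C).inv.Additive :=
  @Equivalence.inverse_additive (FunMod G C) (Rev G C) _ _ _ _ (fiber G C).asEquivalence
    (inferInstance : (fiber G C).Additive)

section Linear

variable {k : Type*} [Field k] [Linear k C] [MonoidalLinear k C]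
  [∀ g : G, (act g : C ⥤ C).Linear k]

instance : (fiber G C).Linear k where
  map_smul {M N} f r := by
    have h : M.fi ≫ (r • (hom f).hom) ≫ N.fq = r • (M.fi ≫ (hom f).hom ≫ N.fq) := by
      simp
    exact h

instance (g : G) : (act g : FunMod G C ⥤ FunMod G C).Linear k where
  map_smul _ _ := rfl

variable (k) in
lemma inv_linear : (fiber G C).inv.Linear k :=
  @Equivalence.inverseLinear k _ (FunMod G C) (Rev G C) _ _ _ _ _ _ (fiber G C).asEquivalence
    (inferInstance : (fiber G C).Linear k)

/-- The fiber functor leads from modules to C^rev, so the equivalence in the required direction is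
its quasi-inverse. -/
lemma crossedEquivalent : CrossedEquivalent G k (Rev G C) (FunMod G C) := by
  obtain ⟨_, h⟩ := exists_crossed_inverse (G := G) (C := C)
  exact ⟨(fiber G C).inv, inv_additive, inferInstance, inferInstance, inv_linear k, h⟩

end Linear

end FunMod

/-! ### Invariance of the fusion property -/

section Fusion

variable {k : Type*} [Field k] {C D : Type*} [Category C] [Preadditive C] [Linear k C]
  [MonoidalCategory C] [Category D] [Preadditive D] [Linear k D] [MonoidalCategory D]

/-- The abelian structure has to extend the given addition on morphisms, and transport along an
additive equivalence keeps that addition. -/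
lemma exists_abelian {C D : Type*} [Category C] [Preadditive C] [Category D] [P : Preadditive D]
    (F : C ⥤ D) [F.Additive] [F.IsEquivalence] (h : ∃ a : Abelian D, a.toPreadditive = P) :
    ∃ a : Abelian C, a.toPreadditive = ‹Preadditive C› := by
  obtain ⟨a, rfl⟩ := h
  have : HasFiniteProducts C := ⟨fun _ => Adjunction.hasLimitsOfShape_of_equivalence F⟩
  exact ⟨abelianOfEquivalence F, rfl⟩

/-- A category which is equivalent to a fusion category by a linear tensor functor is a fusion
category. -/
theorem IsFusion.of_equivalence (F : C ⥤ D) [F.Monoidal] [F.Additive] [F.Linear k]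
    [F.IsEquivalence] (h : IsFusion k D) : IsFusion k C := by
  have ha := h.tensor_additive
  have hl := h.tensor_linear
  have hs := h.simple_unit
  have : MonoidalPreadditive C := monoidalPreadditive_of_faithful F
  have : F.inv.Additive :=
    @Equivalence.inverse_additive C D _ _ _ _ F.asEquivalence (inferInstance : F.Additive)
  refine ⟨exists_abelian F h.abelian, inferInstance, MonoidalLinear.ofFaithful k F, ?_, ?_, ?_, ?_,
    ?_⟩
  · obtain ⟨_⟩ := h.rigid
    exact ⟨rigidCategoryOfEquivalence (F := F) F.asEquivalence.toAdjunction⟩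
  · rw [← simple_obj_iff F]
    exact Simple.of_iso (Functor.Monoidal.εIso F).symm
  · intro X Y
    have := h.finite_hom (F.obj X) (F.obj Y)
    exact Module.Finite.of_injective (F.mapLinearMap k (X := X) (Y := Y)) F.map_injective
  · intro X
    obtain ⟨n, S, b, hS, ⟨hb⟩, ⟨i⟩⟩ := h.semisimple (F.obj X)
    refine ⟨n, fun j => F.inv.obj (S j), F.inv.mapBicone b, fun j => ?_,
      ⟨isBilimitOfPreserves F.inv hb⟩, ⟨F.asEquivalence.unitIso.app X ≪≫ F.inv.mapIso i⟩⟩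
    have := hS j
    exact simple_obj F.inv (S j)
  · obtain ⟨n, S, hS⟩ := h.finite_simples
    refine ⟨n, fun j => F.inv.obj (S j), fun X hX => ?_⟩
    obtain ⟨j, ⟨i⟩⟩ := hS (F.obj X) (simple_obj F X)
    exact ⟨j, ⟨F.asEquivalence.unitIso.app X ≪≫ F.inv.mapIso i⟩⟩

lemma IsFusion.isIdempotentComplete (h : IsFusion k C) : IsIdempotentComplete C := by
  obtain ⟨_, -⟩ := h.abelian
  infer_instance

end Fusion

end GCrossed

theorem proposition3p6 (k : Type*) [Field k] [IsAlgClosed k] [CharZero k]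
    (G : Type*) [Group G] [Fintype G]
    (C : Type*) [Category C] [Preadditive C] [HasFiniteBiproducts C] [Linear k C]
    [MonoidalCategory C] [MonoidalPreadditive C] [MonoidalLinear k C]
    [CrossedData G C] [IsBraidedCrossed G C] [∀ g : G, (CrossedData.act g : C ⥤ C).Linear k]
    (hC : IsFusion k C) :
    ∃ (_ : MonoidalPreadditive (Rev G C)) (_ : IsBraidedCrossed G (Rev G C))
      (_ : ∀ g : G, (CrossedData.act g : Rev G C ⥤ Rev G C).Linear k)
      (_ : HasCoequalizers (Equivariant G C))
      (_ : ∀ X : Equivariant G C, PreservesColimitsOfSize.{0, 0} (tensorLeft X))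
      (_ : ∀ X : Equivariant G C, PreservesColimitsOfSize.{0, 0} (tensorRight X)),
      IsBraidedCrossedFusion k G (Rev G C) ∧
      (∃ _ : (revIdentity G C).Braided,
        (revIdentity G C).IsEquivalence ∧ (revIdentity G C).Linear k ∧
        ∀ X Y : Equivariant G (Rev G C),
          BraidedRev.hom (Functor.OplaxMonoidal.δ (revIdentity G C) X Y) = revTensor X Y) ∧
      IsBraidedCrossedFusion k G (DeEquiv (revFunctions G C)) ∧
      CrossedEquivalent G k (Rev G C) (DeEquiv (revFunctions G C)) := by
  -- The fusion hypothesis supplies what tensor products over A and fibers need: coequalizers and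
  -- split idempotents from abelianness, colimit-preserving tensor products from rigidity.
  have h₁ := hC.hasCoequalizers
  have h₂ := hC.preserves_left
  have h₃ := hC.preserves_right
  have h₄ := hC.isIdempotentComplete
  have h₅ : HasCoequalizers (Equivariant G C) := inferInstance
  have h₆ : ∀ X : Equivariant G C, PreservesColimitsOfSize.{0, 0} (tensorLeft X) :=
    fun X => Equivariant.preservesColimits_tensorLeft X
  have h₇ : ∀ X : Equivariant G C, PreservesColimitsOfSize.{0, 0} (tensorRight X) :=
    fun X => Equivariant.preservesColimits_tensorRight X
  refine ⟨inferInstance, Rev.isBraidedCrossed G C, Rev.actLinear, h₅, h₆, h₇,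
    Rev.isBraidedCrossedFusion hC, ⟨Rev.revIdentityBraided G C, inferInstance, ?_, ?_⟩, ?_, ?_⟩
  · have := Rev.actLinear (k := k) (G := G) (C := C)
    exact Rev.revIdentity_linear G C
  · exact Rev.revIdentity_δ G C
  · exact ⟨IsFusion.of_equivalence (FunMod.fiber G C) (Rev.isFusion hC), inferInstance,
      inferInstance⟩
  · exact FunMod.crossedEquivalent
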